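/- Let $\mathsf{RCA}_0^\omega=\mathsf{E\text{-}PRA}^\omega+\mathsf{QF\text{-}AC}^{1,0}$ be Kohlenbach's base theory of higher-order Reverse Mathematics: classical logic in all finite types over $\mathbb N$, with $0$, successor, the combinators, the recursor $R_0$ of type $0$, quantifier-free induction, the axiom of extensionality, and the axiom of choice $(\forall f\in\mathbb N^{\mathbb N})(\exists n\in\mathbb N)A(f,n)\to(\exists F:\mathbb N^{\mathbb N}\to\mathbb N)(\forall f\in \mathbb N^{\mathbb N})A(f,F(f))$ for quantifier-free $A$. Real numbers are coded by Cauchy sequences of rationals $(q_n)$ with $|q_n-q_{n+i}|\le 2^{-n}$, functions on reals are functionals respecting equality of reals, and subsets of $\mathbb R$ are given by characteristic functions $\mathbb R\to\{0,1\}$. Let $\mathsf{FF}$ be the statement that Tait's fan functional exists: $$(\exists \Omega:(\mathbb N^{\mathbb N}\to\mathbb N)\to\mathbb N)(\forall Y\in C(2^{\mathbb N}))(\forall h,g\in 2^{\mathbb N})\big(\overline h\,\Omega(Y)=\overline g\,\Omega(Y)\to Y(h)=Y(g)\big),$$ where $\overline h n$ is the initial segment of $h$ of length $n$ and $Y\in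 C(2^{\mathbb N})$ means that $Y:\mathbb N^{\mathbb N}\to\mathbb N$ is (pointwise) continuous on $2^{\mathbb N}$. Interior and closure below are taken in the space $[0,1]$. A set $S\subset[0,1]$ is *semi-open* if $S\subset\overline{\mathrm{int}(S)}$, *semi-closed* if $\mathrm{int}(\overline S)\subset S$, an *$\alpha$-set* if $S\subset \mathrm{int}(\overline{\mathrm{int}(S)})$, *regular closed* if $S=\overline{\mathrm{int}(S)}$, an *$\mathcal A$-set* if $S=O\cap C$ with $O$ open and $C$ regular closed, and an *$\mathcal{AB}$-set* if $S=O\cap C$ with $O$ open and $C$ semi-open and semi-closed. A function $f:[0,1]\to\mathbb R$ is *$\alpha$-continuous*, *$s$-continuous*, *$\mathcal A$-continuous*, *$\mathcal{AB}$-continuous*, *contra-continuous*, *SR-continuous*, respectively, if for every open $G\subset\mathbb R$ the set $f^{-1}(G)$ is an $\alpha$-set, semi-open, an $\mathcal A$-set, an $\mathcal{AB}$-set, closed, both semi-open and semi-closed, respectively; it is *quasi-continuous* if for all $x\in[0,1]$, $\varepsilon>0$ and every open neighbourhood $U\subset[0,1]$ of $x$ there is a non-empty interval $(a,b)\subset U$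 with $|f(x)-f(y)|<\varepsilon$ for all $y\in(a,b)$. **Corollary 2.8.** $\mathsf{RCA}_0^\omega+\mathsf{FF}$ proves that there is a supremum functional for the functions $f:[0,1]\to\mathbb R$ that are $\alpha$-, $s$-, $\mathcal A$-, $\mathcal{AB}$-, quasi-, contra- or SR-continuous, i.e. that there is a functional $\Xi$ from the functions $[0,1]\to\mathbb R$ to the extended reals $\mathbb R\cup\{+\infty,-\infty\}$ such that $\Xi(f)=\sup_{x\in[0,1]}f(x)$ for every $f:[0,1]\to\mathbb R$ having at least one of these seven properties. -/

import Mathlib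

/-!
Kohlenbach's higher-order base theory `RCA₀^ω = E-PRA^ω + QF-AC^{1,0}`, written out as a
formal system: finite types, combinatory terms, formulas, a classical natural deduction
calculus and the axioms.  Afterwards real numbers, subsets and functions of the unit interval,
notions of weak continuity, suprema and Tait's fan functional are written as formulas of
this language.
-/

namespace HORM

/-! ### Syntax -/

/-- Finite types: the type `0` of natural numbers, and function types. -/
inductive Ty : Type
  | nat : Ty
  | arr : Ty → Ty → Ty
  deriving DecidableEq

infixr:62 " ⇾ " => Ty.arr

/-- The type `1 = 0 → 0`. -/
abbrev one : Ty := Ty.nat ⇾ Ty.nat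

/-- The type `2 = 1 → 0`. -/
abbrev two : Ty := one ⇾ Ty.nat

/-- Typed de Bruijn variables of a context; the most recently bound variable comes first. -/
inductive Var : List Ty → Ty → Type
  | zero {Γ : List Ty} {σ : Ty} : Var (σ :: Γ) σ
  | succ {Γ : List Ty} {σ τ : Ty} : Var Γ σ → Var (τ :: Γ) σ

/-- Terms of `E-PRA^ω`: variables, `0`, successor, the combinators `Π` (`K`) and `Σ` (`S`),
the recursor `R₀` for type `0` only, and application. -/
inductive Tm (Γ : List Ty) : Ty → Type
  | var {σ : Ty} : Var Γ σ → Tm Γ σ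
  | zero : Tm Γ Ty.nat
  | succ : Tm Γ (Ty.nat ⇾ Ty.nat)
  | K (σ τ : Ty) : Tm Γ (σ ⇾ τ ⇾ σ)
  | S (ρ σ τ : Ty) : Tm Γ ((ρ ⇾ σ ⇾ τ) ⇾ (ρ ⇾ σ) ⇾ ρ ⇾ τ)
  | R : Tm Γ (Ty.nat ⇾ Ty.nat ⇾ (Ty.nat ⇾ Ty.nat ⇾ Ty.nat) ⇾ Ty.nat)
  | app {σ τ : Ty} : Tm Γ (σ ⇾ τ) → Tm Γ σ → Tm Γ τ

infixl:80 " ⬝ " => Tm.app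

/-- Formulas: the only prime formulas are equations between terms of type `0` (and `⊥`). -/
inductive Fm : List Ty → Type
  | eq {Γ : List Ty} : Tm Γ Ty.nat → Tm Γ Ty.nat → Fm Γ
  | bot {Γ : List Ty} : Fm Γ
  | imp {Γ : List Ty} : Fm Γ → Fm Γ → Fm Γ
  | all {Γ : List Ty} (σ : Ty) : Fm (σ :: Γ) → Fm Γ

infix:70 " ≐ " => Fm.eq
infixr:50 " ⇛ " => Fm.imp
notation:max "∀[" σ "]" φ:45 => Fm.all σ φ

section Connectives

variable {Γ : List Ty}

def Fm.neg (φ : Fm Γ) : Fm Γ := φ ⇛ Fm.bot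
def Fm.and (φ ψ : Fm Γ) : Fm Γ := (φ ⇛ ψ.neg).neg
def Fm.or (φ ψ : Fm Γ) : Fm Γ := φ.neg ⇛ ψ
def Fm.ex (σ : Ty) (φ : Fm (σ :: Γ)) : Fm Γ := (Fm.all σ φ.neg).neg

end Connectives

infixr:60 " ⋏ " => Fm.and
infixr:55 " ⋎ " => Fm.or
notation:max "∃[" σ "]" φ:45 => Fm.ex σ φ

/-! ### Substitution -/

/-- Simultaneous substitutions. -/
abbrev Sub (Γ Δ : List Ty) : Type := ∀ σ : Ty, Var Γ σ → Tm Δ σ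

def Tm.subst {Γ Δ : List Ty} (s : Sub Γ Δ) : {σ : Ty} → Tm Γ σ → Tm Δ σ
  | _, .var x => s _ x
  | _, .zero => .zero
  | _, .succ => .succ
  | _, .K σ τ => .K σ τ
  | _, .S ρ σ τ => .S ρ σ τ
  | _, .R => .R
  | _, .app t u => .app (t.subst s) (u.subst s)

/-- Weakening by one variable. -/
def Tm.wk {Γ : List Ty} {σ τ : Ty} (t : Tm Γ σ) : Tm (τ :: Γ) σ :=
  t.subst (fun _ x => .var x.succ)

/-- The substitution sending the newest variable to `t` and the others according to `s`. -/
def Sub.cons {Γ Δ : List Ty} {σ : Ty} (t : Tm Δ σ) (s : Sub Γ Δ) : Sub (σ :: Γ) Δ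
  | _, .zero => t
  | _, .succ x => s _ x

/-- The extension of a substitution under a binder. -/
def Sub.lift {Γ Δ : List Ty} {σ : Ty} (s : Sub Γ Δ) : Sub (σ :: Γ) (σ :: Δ) :=
  Sub.cons (.var .zero) (fun _ x => (s _ x).wk)

def Fm.subst : {Γ Δ : List Ty} → Sub Γ Δ → Fm Γ → Fm Δ
  | _, _, s, .eq t u => .eq (t.subst s) (u.subst s)
  | _, _, _, .bot => .bot
  | _, _, s, .imp φ ψ => .imp (φ.subst s) (ψ.subst s)
  | _, _, s, .all σ φ => .all σ (φ.subst s.lift)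

def Fm.wk {Γ : List Ty} {σ : Ty} (φ : Fm Γ) : Fm (σ :: Γ) :=
  φ.subst (fun _ x => .var x.succ)

/-- `φ.inst t` is `φ` with `t` for its newest variable. -/
def Fm.inst {Γ : List Ty} {σ : Ty} (φ : Fm (σ :: Γ)) (t : Tm Γ σ) : Fm Γ :=
  φ.subst (Sub.cons t (fun _ x => .var x))

/-! The variables, counted from the innermost binder outwards. -/

abbrev v0 {Γ : List Ty} {σ : Ty} : Tm (σ :: Γ) σ := .var .zero
abbrev v1 {Γ : List Ty} {σ a : Ty} : Tm (a :: σ :: Γ) σ := .var (.succ .zero)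
abbrev v2 {Γ : List Ty} {σ a b : Ty} : Tm (a :: b :: σ :: Γ) σ := .var (.succ (.succ .zero))
abbrev v3 {Γ : List Ty} {σ a b c : Ty} : Tm (a :: b :: c :: σ :: Γ) σ :=
  .var (.succ (.succ (.succ .zero)))
abbrev v4 {Γ : List Ty} {σ a b c d : Ty} : Tm (a :: b :: c :: d :: σ :: Γ) σ :=
  .var (.succ (.succ (.succ (.succ .zero))))
abbrev v5 {Γ : List Ty} {σ a b c d e : Ty} : Tm (a :: b :: c :: d :: e :: σ :: Γ) σ :=
  .var (.succ (.succ (.succ (.succ (.succ .zero)))))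

/-- `λ`-abstraction, as defined from the combinators. -/
def Tm.lam {Γ : List Ty} {ρ : Ty} : {τ : Ty} → Tm (ρ :: Γ) τ → Tm Γ (ρ ⇾ τ)
  | _, .var .zero => .S ρ (ρ ⇾ ρ) ρ ⬝ .K ρ (ρ ⇾ ρ) ⬝ .K ρ ρ
  | _, .var (.succ x) => .K _ ρ ⬝ .var x
  | _, .zero => .K _ ρ ⬝ .zero
  | _, .succ => .K _ ρ ⬝ .succ
  | _, .K σ τ => .K _ ρ ⬝ .K σ τ
  | _, .S ρ' σ τ => .K _ ρ ⬝ .S ρ' σ τ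
  | _, .R => .K _ ρ ⬝ .R
  | _, .app t u => .S ρ _ _ ⬝ t.lam ⬝ u.lam

/-! ### Derivations -/

/-- Classical natural deduction: `Derives T Δ φ` says that `φ` is derivable from the
hypotheses `Δ` by means of the axioms `T` (whose free variables are read universally). -/
inductive Derives (T : (Γ : List Ty) → Fm Γ → Prop) : {Γ : List Ty} → List (Fm Γ) → Fm Γ → Prop
  | hyp {Γ : List Ty} {Δ : List (Fm Γ)} {φ : Fm Γ} : φ ∈ Δ → Derives T Δ φ
  | ax {Γ : List Ty} {Δ : List (Fm Γ)} {φ : Fm Γ} : T Γ φ → Derives T Δ φ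
  | impI {Γ : List Ty} {Δ : List (Fm Γ)} {φ ψ : Fm Γ} :
      Derives T (φ :: Δ) ψ → Derives T Δ (φ ⇛ ψ)
  | impE {Γ : List Ty} {Δ : List (Fm Γ)} {φ ψ : Fm Γ} :
      Derives T Δ (φ ⇛ ψ) → Derives T Δ φ → Derives T Δ ψ
  | raa {Γ : List Ty} {Δ : List (Fm Γ)} {φ : Fm Γ} :
      Derives T (φ.neg :: Δ) Fm.bot → Derives T Δ φ
  | allI {Γ : List Ty} {Δ : List (Fm Γ)} {σ : Ty} {φ : Fm (σ :: Γ)} :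
      Derives T (Δ.map Fm.wk) φ → Derives T Δ (Fm.all σ φ)
  | allE {Γ : List Ty} {Δ : List (Fm Γ)} {σ : Ty} {φ : Fm (σ :: Γ)} (t : Tm Γ σ) :
      Derives T Δ (Fm.all σ φ) → Derives T Δ (φ.inst t)

/-! ### The base theory -/

/-- Equality at higher types is defined extensionally. -/
def eqAt : (σ : Ty) → {Γ : List Ty} → Tm Γ σ → Tm Γ σ → Fm Γ
  | .nat, _, s, t => s ≐ t
  | .arr σ τ, _, s, t => ∀[σ] eqAt τ (s.wk ⬝ v0) (t.wk ⬝ v0)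

/-- Quantifier-free formulas. -/
def Fm.QF : {Γ : List Ty} → Fm Γ → Prop
  | _, .eq _ _ => True
  | _, .bot => True
  | _, .imp φ ψ => φ.QF ∧ ψ.QF
  | _, .all _ _ => False

/-- The (non-logical) axioms of `RCA₀^ω`: those of `E-PRA^ω`, i.e. equality and successor axioms,
defining equations of the combinators and of `R₀`, quantifier-free induction and
extensionality, together with `QF-AC^{1,0}`. -/
inductive RCAω : (Γ : List Ty) → Fm Γ → Prop
  | eq_refl {Γ : List Ty} (t : Tm Γ Ty.nat) : RCAω Γ (t ≐ t)
  | eq_eucl {Γ : List Ty} (s t u : Tm Γ Ty.nat) : RCAω Γ (s ≐ t ⇛ s ≐ u ⇛ t ≐ u)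
  | succ_ne_zero {Γ : List Ty} (t : Tm Γ Ty.nat) : RCAω Γ (Fm.neg (.succ ⬝ t ≐ .zero))
  | succ_inj {Γ : List Ty} (s t : Tm Γ Ty.nat) : RCAω Γ (.succ ⬝ s ≐ .succ ⬝ t ⇛ s ≐ t)
  | K_eq {Γ : List Ty} {σ τ : Ty} (s : Tm Γ σ) (t : Tm Γ τ) :
      RCAω Γ (eqAt σ (.K σ τ ⬝ s ⬝ t) s)
  | S_eq {Γ : List Ty} {ρ σ τ : Ty} (s : Tm Γ (ρ ⇾ σ ⇾ τ)) (t : Tm Γ (ρ ⇾ σ)) (u : Tm Γ ρ) :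
      RCAω Γ (eqAt τ (.S ρ σ τ ⬝ s ⬝ t ⬝ u) (s ⬝ u ⬝ (t ⬝ u)))
  | R_zero {Γ : List Ty} (s : Tm Γ Ty.nat) (t : Tm Γ (Ty.nat ⇾ Ty.nat ⇾ Ty.nat)) :
      RCAω Γ (.R ⬝ .zero ⬝ s ⬝ t ≐ s)
  | R_succ {Γ : List Ty} (n s : Tm Γ Ty.nat) (t : Tm Γ (Ty.nat ⇾ Ty.nat ⇾ Ty.nat)) :
      RCAω Γ (.R ⬝ (.succ ⬝ n) ⬝ s ⬝ t ≐ t ⬝ (.R ⬝ n ⬝ s ⬝ t) ⬝ n)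
  | induction {Γ : List Ty} (φ : Fm (Ty.nat :: Γ)) : φ.QF →
      RCAω Γ (φ.inst .zero ⇛
        (∀[Ty.nat] φ ⇛ φ.subst (Sub.cons (.succ ⬝ v0) (fun _ x => .var x.succ))) ⇛ ∀[Ty.nat] φ)
  | ext {Γ : List Ty} {σ τ : Ty} (s t : Tm Γ σ) (u : Tm Γ (σ ⇾ τ)) :
      RCAω Γ (eqAt σ s t ⇛ eqAt τ (u ⬝ s) (u ⬝ t))
  | qfac {Γ : List Ty} (φ : Fm (Ty.nat :: one :: Γ)) : φ.QF →
      RCAω Γ ((∀[one] ∃[Ty.nat] φ) ⇛ ∃[two] ∀[one]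
        φ.subst (Sub.cons (v1 ⬝ v0) (Sub.cons v0 (fun _ x => .var x.succ.succ))))

/-! ### Arithmetic -/

section Definitions

variable {Γ : List Ty}

def tone : Tm Γ Ty.nat := .succ ⬝ .zero
def ttwo : Tm Γ Ty.nat := .succ ⬝ tone
def tthree : Tm Γ Ty.nat := .succ ⬝ ttwo

def Tm.add (s t : Tm Γ Ty.nat) : Tm Γ Ty.nat := .R ⬝ t ⬝ s ⬝ (Tm.lam (Tm.lam (.succ ⬝ v1)))
def Tm.mul (s t : Tm Γ Ty.nat) : Tm Γ Ty.nat :=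
  .R ⬝ t ⬝ .zero ⬝ (Tm.lam (Tm.lam (Tm.add v1 s.wk.wk)))
def Tm.pred (t : Tm Γ Ty.nat) : Tm Γ Ty.nat := .R ⬝ t ⬝ .zero ⬝ (Tm.lam (Tm.lam v0))
/-- Truncated subtraction. -/
def Tm.sub (s t : Tm Γ Ty.nat) : Tm Γ Ty.nat := .R ⬝ t ⬝ s ⬝ (Tm.lam (Tm.lam (Tm.pred v1)))
/-- The power `2 ^ t`. -/
def Tm.pow2 (t : Tm Γ Ty.nat) : Tm Γ Ty.nat :=
  .R ⬝ t ⬝ tone ⬝ (Tm.lam (Tm.lam (Tm.add v1 v1)))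

def natLe (s t : Tm Γ Ty.nat) : Fm Γ := Tm.sub s t ≐ .zero
def natLt (s t : Tm Γ Ty.nat) : Fm Γ := natLe (.succ ⬝ s) t

/-! ### Rational numbers -/

/-- Three number terms, standing for the rational number `(p - m) / d`. -/
structure Rat' (Γ : List Ty) where
  p : Tm Γ Ty.nat
  m : Tm Γ Ty.nat
  d : Tm Γ Ty.nat

def Rat'.add (q r : Rat' Γ) : Rat' Γ :=
  ⟨(q.p.mul r.d).add (r.p.mul q.d), (q.m.mul r.d).add (r.m.mul q.d), q.d.mul r.d⟩

/-- `q ≤ r`, after clearing the (positive) denominators. -/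
def Rat'.le (q r : Rat' Γ) : Fm Γ :=
  natLe ((q.p.mul r.d).add (r.m.mul q.d)) ((q.m.mul r.d).add (r.p.mul q.d))

def Rat'.zero : Rat' Γ := ⟨.zero, .zero, tone⟩
def Rat'.one : Rat' Γ := ⟨tone, .zero, tone⟩

/-- The rational number `a / 2 ^ n`. -/
def Rat'.dyadic (a n : Tm Γ Ty.nat) : Rat' Γ := ⟨a, .zero, n.pow2⟩

/-! ### Real numbers -/

/-- Type `1` objects code sequences of rational numbers: the `n`-th one is
`(x(3n) - x(3n+1)) / (x(3n+2) + 1)`. -/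
def approx (x : Tm Γ one) (n : Tm Γ Ty.nat) : Rat' Γ :=
  ⟨x ⬝ (tthree.mul n), x ⬝ (.succ ⬝ (tthree.mul n)), .succ ⬝ (x ⬝ (.succ ⬝ (.succ ⬝ (tthree.mul n))))⟩

/-- `x` codes a real number: `|q_n - q_{n+i}| ≤ 2^{-n}` for all `n, i`. -/
def isReal (x : Tm Γ one) : Fm Γ :=
  ∀[Ty.nat] ∀[Ty.nat]
    ((approx x.wk.wk v1).le ((approx x.wk.wk (v1.add v0)).add (Rat'.dyadic tone v1)) ⋏
     (approx x.wk.wk (v1.add v0)).le ((approx x.wk.wk v1).add (Rat'.dyadic tone v1)))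

/-- `x ≤ y` for reals: `q_n ≤ r_n + 2^{1-n}` for all `n`. -/
def realLe (x y : Tm Γ one) : Fm Γ :=
  ∀[Ty.nat] (approx x.wk v0).le ((approx y.wk v0).add (Rat'.dyadic ttwo v0))

def realLt (x y : Tm Γ one) : Fm Γ := (realLe y x).neg
def realEq (x y : Tm Γ one) : Fm Γ := realLe x y ⋏ realLe y x

/-- `x + 2^{-k} ≤ y` for reals. -/
def realGapLe (x y : Tm Γ one) (k : Tm Γ Ty.nat) : Fm Γ :=
  ∀[Ty.nat] ((approx x.wk v0).add (Rat'.dyadic tone k.wk)).le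
    ((approx y.wk v0).add (Rat'.dyadic ttwo v0))

/-- `|x - y| < 2^{-k}` for reals. -/
def near (x y : Tm Γ one) (k : Tm Γ Ty.nat) : Fm Γ :=
  (realGapLe x y k).neg ⋏ (realGapLe y x k).neg

/-- `x` is a real number in `[0,1]`. -/
def unit (x : Tm Γ one) : Fm Γ :=
  isReal x ⋏ ∀[Ty.nat]
    (Rat'.zero.le ((approx x.wk v0).add (Rat'.dyadic tone v0)) ⋏
     (approx x.wk v0).le (Rat'.one.add (Rat'.dyadic tone v0)))

/-- `f` is a function `[0,1] → ℝ`, i.e. it respects equality of reals. -/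
def unitFun (f : Tm Γ (one ⇾ one)) : Fm Γ :=
  (∀[one] unit v0 ⇛ isReal (f.wk ⬝ v0)) ⋏
  (∀[one] ∀[one] unit v1 ⇛ unit v0 ⇛ realEq v1 v0 ⇛ realEq (f.wk.wk ⬝ v1) (f.wk.wk ⬝ v0))

/-- Equality of functions on `[0,1]`. -/
def unitFunEq (f g : Tm Γ (one ⇾ one)) : Fm Γ :=
  ∀[one] unit v0 ⇛ realEq (f.wk ⬝ v0) (g.wk ⬝ v0)

/-! ### Subsets of the real line and of the unit interval -/

/-- `F` is (the characteristic function `ℝ → {0,1}` of) a subset of `ℝ`. -/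
def isSet (F : Tm Γ two) : Fm Γ :=
  (∀[one] isReal v0 ⇛ (F.wk ⬝ v0 ≐ .zero ⋎ F.wk ⬝ v0 ≐ tone)) ⋏
  (∀[one] ∀[one] isReal v1 ⇛ isReal v0 ⇛ realEq v1 v0 ⇛ F.wk.wk ⬝ v1 ≐ F.wk.wk ⬝ v0)

/-- The set `G` is an open subset of `ℝ`. -/
def isOpenReal (G : Tm Γ two) : Fm Γ :=
  isSet G ⋏ ∀[one] isReal v0 ⇛ G.wk ⬝ v0 ≐ tone ⇛
    ∃[Ty.nat] ∀[one] isReal v0 ⇛ near v2 v0 v1 ⇛ G.wk.wk.wk ⬝ v0 ≐ tone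

/-- Virtual subsets of the space `[0,1]`, given by a formula on the newest variable. -/
abbrev VSet (Γ : List Ty) : Type := Fm (one :: Γ)

def VSet.weaken {σ : Ty} (A : VSet Γ) : VSet (σ :: Γ) :=
  Fm.subst (Sub.lift (fun _ x => .var x.succ)) A

/-- The set with characteristic function `F`. -/
def VSet.ofChar (F : Tm Γ two) : VSet Γ := F.wk ⬝ v0 ≐ tone

/-- The preimage `f⁻¹(G)`. -/
def VSet.preimage (f : Tm Γ (one ⇾ one)) (G : Tm Γ two) : VSet Γ := G.wk ⬝ (f.wk ⬝ v0) ≐ tone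

def VSet.compl (A : VSet Γ) : VSet Γ := Fm.neg A

def VSet.inter (A B : VSet Γ) : VSet Γ := Fm.and A B

/-- Interior in the space `[0,1]`. -/
def VSet.interior (A : VSet Γ) : VSet Γ :=
  ∃[Ty.nat] ∀[one] unit v0 ⇛ near v2 v0 v1 ⇛ A.weaken.weaken

/-- Closure in the space `[0,1]`. -/
def VSet.closure (A : VSet Γ) : VSet Γ :=
  ∀[Ty.nat] ∃[one] (unit v0 ⋏ near v2 v0 v1 ⋏ A.weaken.weaken)

/-- Inclusion of subsets of `[0,1]`. -/
def VSet.subset (A B : VSet Γ) : Fm Γ := ∀[one] unit v0 ⇛ A ⇛ B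

def VSet.seteq (A B : VSet Γ) : Fm Γ := A.subset B ⋏ B.subset A

/-- Openness in `[0,1]`: every point of `A` has a ball contained in `A`. -/
def VSet.isOpen (A : VSet Γ) : Fm Γ := A.subset A.interior
def VSet.isClosed (A : VSet Γ) : Fm Γ := A.compl.isOpen
def VSet.semiOpen (A : VSet Γ) : Fm Γ := A.subset A.interior.closure
def VSet.semiClosed (A : VSet Γ) : Fm Γ := A.closure.interior.subset A
def VSet.alphaSet (A : VSet Γ) : Fm Γ := A.subset A.interior.closure.interior
def VSet.regularClosed (A : VSet Γ) : Fm Γ := A.seteq A.interior.closure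

/-- `𝒜`-sets: intersections of an open and a regular closed set. -/
def VSet.aSet (A : VSet Γ) : Fm Γ :=
  ∃[two] ∃[two] (isSet v1 ⋏ isSet v0 ⋏
    (VSet.ofChar v1).isOpen ⋏ (VSet.ofChar v0).regularClosed ⋏
    A.weaken.weaken.seteq ((VSet.ofChar v1).inter (VSet.ofChar v0)))

/-- `𝒜ℬ`-sets: intersections of an open and a semi-closed semi-open set. -/
def VSet.abSet (A : VSet Γ) : Fm Γ :=
  ∃[two] ∃[two] (isSet v1 ⋏ isSet v0 ⋏
    (VSet.ofChar v1).isOpen ⋏ (VSet.ofChar v0).semiClosed ⋏ (VSet.ofChar v0).semiOpen ⋏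
    A.weaken.weaken.seteq ((VSet.ofChar v1).inter (VSet.ofChar v0)))

/-! ### Weak continuity of functions on the unit interval -/

def alphaCont (f : Tm Γ (one ⇾ one)) : Fm Γ :=
  ∀[two] isOpenReal v0 ⇛ (VSet.preimage f.wk v0).alphaSet

def sCont (f : Tm Γ (one ⇾ one)) : Fm Γ :=
  ∀[two] isOpenReal v0 ⇛ (VSet.preimage f.wk v0).semiOpen

def aCont (f : Tm Γ (one ⇾ one)) : Fm Γ :=
  ∀[two] isOpenReal v0 ⇛ (VSet.preimage f.wk v0).aSet

def abCont (f : Tm Γ (one ⇾ one)) : Fm Γ :=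
  ∀[two] isOpenReal v0 ⇛ (VSet.preimage f.wk v0).abSet

def contraCont (f : Tm Γ (one ⇾ one)) : Fm Γ :=
  ∀[two] isOpenReal v0 ⇛ (VSet.preimage f.wk v0).isClosed

def srCont (f : Tm Γ (one ⇾ one)) : Fm Γ :=
  ∀[two] isOpenReal v0 ⇛
    ((VSet.preimage f.wk v0).semiOpen ⋏ (VSet.preimage f.wk v0).semiClosed)

/-- Quasi-continuity: for `x ∈ [0,1]`, `k`, and an open neighbourhood `U` of `x` in `[0,1]`, there
are reals `a < b` with `(a,b) ⊆ U ⊆ [0,1]` and `|f(x) - f(y)| < 2^{-k}` for all `y ∈ (a,b)`. -/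
def quasiCont (f : Tm Γ (one ⇾ one)) : Fm Γ :=
  ∀[one] ∀[Ty.nat] ∀[two] unit v2 ⇛ isSet v0 ⇛ (VSet.ofChar v0).isOpen ⇛ v0 ⬝ v2 ≐ tone ⇛
    ∃[one] ∃[one] (isReal v1 ⋏ isReal v0 ⋏ realLt v1 v0 ⋏
      ∀[one] isReal v0 ⇛ realLt v2 v0 ⇛ realLt v0 v1 ⇛
        (unit v0 ⋏ v3 ⬝ v0 ≐ tone ⋏
          near (f.wk.wk.wk.wk.wk.wk ⬝ v5) (f.wk.wk.wk.wk.wk.wk ⬝ v0) v4))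

/-- At least one of the seven notions holds. -/
def tame (f : Tm Γ (one ⇾ one)) : Fm Γ :=
  alphaCont f ⋎ sCont f ⋎ aCont f ⋎ abCont f ⋎ quasiCont f ⋎ contraCont f ⋎ srCont f

/-! ### Extended reals and suprema -/

/-- Type `1` objects `s` code extended reals: `s(0)` is `0` for a real, which is then coded by
`n ↦ s(n+1)`, it is `1` for `+∞`, and `2` for `-∞`. -/
def extTag (s : Tm Γ one) : Tm Γ Ty.nat := s ⬝ .zero
def extReal (s : Tm Γ one) : Tm Γ one := Tm.lam (s.wk ⬝ (.succ ⬝ v0))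

def isExt (s : Tm Γ one) : Fm Γ :=
  (extTag s ≐ .zero ⋏ isReal (extReal s)) ⋎ extTag s ≐ tone ⋎ extTag s ≐ ttwo

def extEq (s t : Tm Γ one) : Fm Γ :=
  extTag s ≐ extTag t ⋏ (extTag s ≐ .zero ⇛ realEq (extReal s) (extReal t))

/-- `x ≤ s` for a real `x` and an extended real `s`. -/
def leExt (x s : Tm Γ one) : Fm Γ :=
  (extTag s ≐ .zero ⋏ realLe x (extReal s)) ⋎ extTag s ≐ tone

/-- `x < s` for a real `x` and an extended real `s`. -/
def ltExt (x s : Tm Γ one) : Fm Γ :=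
  (extTag s ≐ .zero ⋏ realLt x (extReal s)) ⋎ extTag s ≐ tone

/-- `s` is the supremum of `f` on `[0,1]`, in the extended reals. -/
def isSup (f : Tm Γ (one ⇾ one)) (s : Tm Γ one) : Fm Γ :=
  isExt s ⋏ (∀[one] unit v0 ⇛ leExt (f.wk ⬝ v0) s.wk) ⋏
  (∀[one] isReal v0 ⇛ ltExt v0 s.wk ⇛ ∃[one] (unit v0 ⋏ realLt v1 (f.wk.wk ⬝ v0)))

/-- There is a functional from functions `[0,1] → ℝ` to extended reals (respecting the equality
of such functions and of extended reals) that yields the supremum of every `f : [0,1] → ℝ`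
having one of the seven weak continuity properties. -/
def SupremumFunctional : Fm [] :=
  ∃[(one ⇾ one) ⇾ one]
    ((∀[one ⇾ one] unitFun v0 ⇛ isExt (v1 ⬝ v0)) ⋏
     (∀[one ⇾ one] ∀[one ⇾ one] unitFun v1 ⇛ unitFun v0 ⇛ unitFunEq v1 v0 ⇛
        extEq (v2 ⬝ v1) (v2 ⬝ v0)) ⋏
     (∀[one ⇾ one] unitFun v0 ⇛ tame v0 ⇛ isSup v0 (v1 ⬝ v0)))

/-! ### Tait's fan functional -/

/-- `h ∈ 2^ℕ`. -/
def cantor (h : Tm Γ one) : Fm Γ := ∀[Ty.nat] (h.wk ⬝ v0 ≐ .zero ⋎ h.wk ⬝ v0 ≐ tone)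

/-- The initial segments of `h` and `g` of length `n` agree. -/
def agree (h g : Tm Γ one) (n : Tm Γ Ty.nat) : Fm Γ :=
  ∀[Ty.nat] natLt v0 n.wk ⇛ h.wk ⬝ v0 ≐ g.wk ⬝ v0

/-- `Y` is (pointwise) continuous on `2^ℕ`. -/
def contCantor (Y : Tm Γ two) : Fm Γ :=
  ∀[one] cantor v0 ⇛ ∃[Ty.nat] ∀[one] cantor v0 ⇛ agree v2 v0 v1 ⇛
    Y.wk.wk.wk ⬝ v2 ≐ Y.wk.wk.wk ⬝ v0

end Definitions

/-- `FF`: the existence of Tait's fan functional. -/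
def FF : Fm [] :=
  ∃[two ⇾ Ty.nat] ∀[two] contCantor v0 ⇛ ∀[one] ∀[one] cantor v1 ⇛ cantor v0 ⇛
    agree v1 v0 (v3 ⬝ v2) ⇛ v2 ⬝ v1 ≐ v2 ⬝ v0

end HORM

namespace HORM

/-! ### Substitution lemmas -/

/-! The claim is about formal derivability, but the argument is semantic. A Henkin completeness
theorem (`completeness`) reduces it to one statement about extensional type structures: every model
of `RCA₀^ω` that satisfies `FF` satisfies `SupremumFunctional`. The numbers of such a model may be
nonstandard, so arithmetic, rationals and reals are rebuilt inside it. Only quantifier-free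
induction, the recursor `R₀` and `QF-AC^{1,0}` are available for this. Each functional must be shown
to be an element of the model, which is what `Internal`, `Dec` and `Rational` keep track of.

Inside a model the proof (`Model.exists_supFunctional`) splits on whether Kleene's quantifier is
present, i.e. whether some functional decides `∃ n, x n = 0` (`HasE`).

If it is absent, Grilliot's trick shows that every functional of type two is continuous on Cantor
space (`continuous_of_not_hasE`): a discontinuity would compute the quantifier. The fan functional
then gives a modulus of uniform continuity for every `Y`. Cantor space maps onto `[0,1]` by an
internal functional (`exists_parametrization`). So for any `f` the `n`-th rational approximation to
`f (r h)` depends on boundedly many bits of `h`, and the supremum is approximated by maxima over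
finitely many binary sequences (`exists_sup_of_modulus`). Weak continuity plays no role in this
case.

If it is present, equality and order of reals are decidable, and a bounded or unbounded sequence of
reals has a supremum in the extended reals, uniformly in the sequence (`HasE.exists_sup_seq`). It
remains to replace `[0,1]` by a countable dense sequence. For each of the seven classes, every value
`f x` is approximated by values at points of that sequence (`HasE.exists_near_of_tame`). For the
classes defined by preimages, except contra-continuity, the reason is that the preimage of a ball
around `f x` is a semi-open set or the intersection of one with an open set, and such a non-empty
set meets every dense set. A contra-continuous function is locally constant, because the complement
of the point `f x` is open. Quasi-continuity supplies an interval directly. -/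

def Sub.id {Γ : List Ty} : Sub Γ Γ := fun _ x => .var x

def Sub.wk {Γ : List Ty} {σ : Ty} : Sub Γ (σ :: Γ) := fun _ x => .var x.succ

def Sub.comp {Γ Δ Θ : List Ty} (s : Sub Γ Δ) (t : Sub Δ Θ) : Sub Γ Θ := fun _ x => (s _ x).subst t

theorem Sub.cons_ext {Γ Δ : List Ty} {σ : Ty} {s t : Sub (σ :: Γ) Δ}
    (h0 : s σ .zero = t σ .zero) (h1 : ∀ τ (x : Var Γ τ), s τ x.succ = t τ x.succ) : s = t := by
  funext τ x
  cases x with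
  | zero => exact h0
  | succ x => exact h1 _ x

@[simp] theorem Sub.cons_zero {Γ Δ : List Ty} {σ : Ty} (t : Tm Δ σ) (s : Sub Γ Δ) :
    Sub.cons t s σ .zero = t := rfl

@[simp] theorem Sub.cons_succ {Γ Δ : List Ty} {σ τ : Ty} (t : Tm Δ σ) (s : Sub Γ Δ) (x : Var Γ τ) :
    Sub.cons t s τ x.succ = s τ x := rfl

theorem Tm.subst_subst {Γ Δ Θ : List Ty} (s : Sub Γ Δ) (t : Sub Δ Θ) {σ : Ty} (u : Tm Γ σ) :
    (u.subst s).subst t = u.subst (s.comp t) := by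
  induction u <;> simp_all [Tm.subst, Sub.comp]

theorem Tm.subst_id {Γ : List Ty} {σ : Ty} (u : Tm Γ σ) : u.subst Sub.id = u := by
  induction u <;> simp_all [Tm.subst, Sub.id]

theorem Tm.wk_def {Γ : List Ty} {σ τ : Ty} (t : Tm Γ σ) : (t.wk : Tm (τ :: Γ) σ) = t.subst Sub.wk := rfl

theorem Tm.wk_subst_cons {Γ Δ : List Ty} {σ τ : Ty} (u : Tm Γ τ) (t : Tm Δ σ) (s : Sub Γ Δ) :
    u.wk.subst (Sub.cons t s) = u.subst s := by
  rw [Tm.wk_def, Tm.subst_subst]; rfl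

theorem Tm.wk_subst_lift {Γ Δ : List Ty} {σ τ : Ty} (u : Tm Γ τ) (s : Sub Γ Δ) :
    u.wk.subst (Sub.lift (σ := σ) s) = (u.subst s).wk := by
  rw [Sub.lift, Tm.wk_subst_cons, Tm.wk_def, Tm.subst_subst]; rfl

theorem Sub.lift_id {Γ : List Ty} {σ : Ty} : (Sub.id (Γ := Γ)).lift (σ := σ) = Sub.id :=
  Sub.cons_ext rfl fun _ _ => rfl

theorem Sub.lift_comp {Γ Δ Θ : List Ty} {σ : Ty} (s : Sub Γ Δ) (t : Sub Δ Θ) :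
    s.lift.comp t.lift = (s.comp t).lift (σ := σ) :=
  Sub.cons_ext rfl fun _ x => Tm.wk_subst_lift (s _ x) t

theorem Fm.subst_subst {Γ : List Ty} (φ : Fm Γ) : ∀ {Δ Θ : List Ty} (s : Sub Γ Δ) (t : Sub Δ Θ),
    (φ.subst s).subst t = φ.subst (s.comp t) := by
  induction φ with
  | eq a b => intro Δ Θ s t; simp [Fm.subst, Tm.subst_subst]
  | bot => intros; rfl
  | imp φ ψ h1 h2 => intro Δ Θ s t; simp [Fm.subst, h1, h2]
  | all σ φ h => intro Δ Θ s t; simp [Fm.subst, h, Sub.lift_comp]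

theorem Fm.subst_id {Γ : List Ty} (φ : Fm Γ) : φ.subst Sub.id = φ := by
  induction φ with
  | eq a b => simp [Fm.subst, Tm.subst_id]
  | bot => rfl
  | imp φ ψ h1 h2 => simp [Fm.subst, h1, h2]
  | all σ φ h => simp [Fm.subst, h, Sub.lift_id]

theorem Fm.wk_def {Γ : List Ty} {σ : Ty} (φ : Fm Γ) : (φ.wk : Fm (σ :: Γ)) = φ.subst Sub.wk := rfl

theorem Fm.wk_subst_lift {Γ Δ : List Ty} {σ : Ty} (φ : Fm Γ) (s : Sub Γ Δ) :
    φ.wk.subst (Sub.lift (σ := σ) s) = (φ.subst s).wk := by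
  rw [Fm.wk_def, Fm.wk_def, Fm.subst_subst, Fm.subst_subst]; rfl

theorem Fm.inst_subst {Γ Δ : List Ty} {σ : Ty} (φ : Fm (σ :: Γ)) (t : Tm Γ σ) (s : Sub Γ Δ) :
    (φ.inst t).subst s = (φ.subst s.lift).inst (t.subst s) := by
  rw [Fm.inst, Fm.inst, Fm.subst_subst, Fm.subst_subst]
  congr 1
  refine Sub.cons_ext rfl fun τ x => ?_
  change s τ x = (s τ x).wk.subst _
  rw [Tm.wk_subst_cons]; exact (Tm.subst_id _).symm

/-- Opens a universal quantifier with a fresh variable: after weakening, the bound variable may be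
instantiated by the new one, and this gives back the matrix. -/
theorem Fm.lift_wk_inst_zero {Γ : List Ty} {σ : Ty} (φ : Fm (σ :: Γ)) :
    (φ.subst (Sub.lift Sub.wk)).inst (.var .zero) = φ := by
  rw [Fm.inst, Fm.subst_subst]
  conv_rhs => rw [← Fm.subst_id φ]
  congr 1
  exact Sub.cons_ext rfl fun _ _ => rfl

theorem Fm.subst_lift_inst {Γ Δ : List Ty} {σ : Ty} (φ : Fm (σ :: Γ)) (t : Tm Δ σ) (s : Sub Γ Δ) :
    (φ.subst s.lift).inst t = φ.subst (Sub.cons t s) := by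
  rw [Fm.inst, Fm.subst_subst]
  congr 1
  refine Sub.cons_ext rfl fun τ x => ?_
  change (s τ x).wk.subst _ = _
  rw [Tm.wk_subst_cons]; exact Tm.subst_id _

theorem Fm.QF.subst {Γ : List Ty} {φ : Fm Γ} (h : φ.QF) {Δ : List Ty} (s : Sub Γ Δ) :
    (φ.subst s).QF := by
  induction φ with
  | eq a b => trivial
  | bot => trivial
  | imp φ ψ h1 h2 => exact ⟨h1 h.1 s, h2 h.2 s⟩
  | all σ φ _ => exact h.elim

theorem eqAt_subst (σ : Ty) : ∀ {Γ Δ : List Ty} (a b : Tm Γ σ) (s : Sub Γ Δ),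
    (eqAt σ a b).subst s = eqAt σ (a.subst s) (b.subst s) := by
  induction σ with
  | nat => intros; rfl
  | arr σ τ _ ih =>
    intro Γ Δ a b s
    simp only [eqAt, Fm.subst, ih, Tm.subst, Tm.wk_subst_lift]
    rfl

/-- The axioms are schemes in arbitrary terms, so substitution leads from instances to instances.
Derivations can therefore be moved between contexts, and axioms can be evaluated at terms over the
Henkin constants. -/
theorem RCAω.subst {Γ Δ : List Ty} {φ : Fm Γ} (h : RCAω Γ φ) (s : Sub Γ Δ) :
    RCAω Δ (φ.subst s) := by
  cases h with
  | eq_refl t => exact .eq_refl _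
  | eq_eucl a b c => exact .eq_eucl _ _ _
  | succ_ne_zero t => exact .succ_ne_zero _
  | succ_inj a b => exact .succ_inj _ _
  | K_eq a b => rw [eqAt_subst]; exact .K_eq _ _
  | S_eq a b c => rw [eqAt_subst]; exact .S_eq _ _ _
  | R_zero a b => exact .R_zero _ _
  | R_succ a b c => exact .R_succ _ _ _
  | induction φ hq =>
    have := RCAω.induction (φ.subst s.lift) (hq.subst _)
    simp only [Fm.subst, Fm.inst_subst, Fm.subst_subst] at this ⊢
    convert this using 6
    · rfl
    -- The two ways of forming the induction step, shifting to `succ` before or after substituting,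
    -- are the same substitution.
    refine Sub.cons_ext rfl fun τ x => ?_
    change ((Tm.var x.succ : Tm (_ :: Γ) τ)).subst _ = (s τ x).wk.subst _
    rw [Tm.wk_subst_cons]; rfl
  | ext a b c =>
    simp only [Fm.subst, eqAt_subst]; exact .ext _ _ _
  | qfac φ hq =>
    have := RCAω.qfac (φ.subst s.lift.lift) (hq.subst _)
    simp only [Fm.ex, Fm.neg, Fm.subst, Fm.subst_subst] at this ⊢
    convert this using 6
    congr 1
    refine Sub.cons_ext rfl fun τ x => ?_
    cases x with
    | zero => rfl
    | succ x =>
      change ((Tm.var x.succ.succ : Tm (_ :: _ :: Γ) τ)).subst _ = (s τ x).wk.wk.subst _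
      rw [Tm.wk_subst_cons, Tm.wk_subst_cons]
      change (s τ x).wk.wk = _
      rw [Tm.wk_def, Tm.wk_def, Tm.subst_subst]; rfl

/-! ### Derivability -/

section

variable {Γ : List Ty} {Δ Δ' : List (Fm Γ)} {φ ψ χ : Fm Γ}

/-- Derivability from the axioms of `RCA₀^ω`. -/
abbrev Prv {Γ : List Ty} (Δ : List (Fm Γ)) (φ : Fm Γ) : Prop := Derives RCAω Δ φ

theorem Prv.mono (h : Prv Δ φ) (hs : Δ ⊆ Δ') : Prv Δ' φ := by
  induction h with
  | hyp hm => exact .hyp (hs hm)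
  | ax ha => exact .ax ha
  | impI _ ih => exact .impI (ih (List.cons_subset_cons _ hs))
  | impE _ _ ih1 ih2 => exact .impE (ih1 hs) (ih2 hs)
  | raa _ ih => exact .raa (ih (List.cons_subset_cons _ hs))
  | allI _ ih => exact .allI (ih (List.map_subset _ hs))
  | allE t _ ih => exact .allE t (ih hs)

/-- Lets a derivation over one context of Henkin constants be reused over a larger one. -/
theorem Prv.subst (h : Prv Δ φ) : ∀ {Θ : List Ty} (s : Sub Γ Θ),
    Prv (Δ.map (Fm.subst s)) (φ.subst s) := by
  induction h with
  | hyp hm => intro Θ s; exact .hyp (List.mem_map_of_mem hm)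
  | ax ha => intro Θ s; exact .ax (ha.subst s)
  | impI _ ih => intro Θ s; exact .impI (ih s)
  | impE _ _ ih1 ih2 => intro Θ s; exact .impE (ih1 s) (ih2 s)
  | raa _ ih => intro Θ s; exact .raa (ih s)
  | @allI Γ Δ σ φ _ ih =>
    intro Θ s
    refine .allI ?_
    have := ih (Sub.lift s)
    rw [List.map_map] at this ⊢
    convert this using 2
    funext χ
    exact (Fm.wk_subst_lift χ s).symm
  | allE t _ ih =>
    intro Θ s
    rw [Fm.inst_subst]
    exact .allE _ (ih s)

theorem Prv.wk (h : Prv Δ φ) {σ : Ty} : Prv (Δ.map (Fm.wk (σ := σ))) φ.wk := h.subst Sub.wk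

theorem Prv.hyp0 : Prv (φ :: Δ) φ := .hyp (by simp)

theorem Prv.weak (h : Prv Δ φ) : Prv (ψ :: Δ) φ := h.mono (by simp)

theorem Prv.botE (h : Prv Δ .bot) : Prv Δ φ := .raa (h.mono (by simp))

theorem Prv.negE (h : Prv Δ φ.neg) (h' : Prv Δ φ) : Prv Δ .bot := .impE h h'

end

/-- A closed term of each type. -/
def Tm.dflt {Γ : List Ty} : (σ : Ty) → Tm Γ σ
  | .nat => .zero
  | .arr σ τ => .K τ σ ⬝ Tm.dflt τ

/-! ### Provable equality -/

section

variable {Γ : List Ty} {Δ : List (Fm Γ)}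

theorem Prv.eqAt_refl (σ : Ty) : ∀ {Γ : List Ty} {Δ : List (Fm Γ)} (a : Tm Γ σ), Prv Δ (eqAt σ a a) := by
  induction σ with
  | nat => intro Γ Δ a; exact .ax (.eq_refl a)
  | arr σ τ _ ih => intro Γ Δ a; exact .allI (ih _)

theorem Prv.eqAt_eucl (σ : Ty) : ∀ {Γ : List Ty} {Δ : List (Fm Γ)} {a b c : Tm Γ σ},
    Prv Δ (eqAt σ a b) → Prv Δ (eqAt σ a c) → Prv Δ (eqAt σ b c) := by
  induction σ with
  | nat => intro Γ Δ a b c h1 h2; exact .impE (.impE (.ax (.eq_eucl a b c)) h1) h2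
  | arr σ τ _ ih =>
    intro Γ Δ a b c h1 h2
    have key : ∀ {a b : Tm Γ (σ ⇾ τ)}, Prv Δ (eqAt _ a b) →
        Prv (Δ.map (Fm.wk (σ := σ))) (eqAt τ (a.wk ⬝ v0) (b.wk ⬝ v0)) := by
      intro a b h
      have := Derives.allE (.var .zero) h.wk
      change Prv _ (Fm.inst (Fm.subst (Sub.lift Sub.wk) _) _) at this
      rwa [Fm.lift_wk_inst_zero] at this
    exact .allI (ih (key h1) (key h2))

theorem Prv.eqAt_symm {σ : Ty} {a b : Tm Γ σ} (h : Prv Δ (eqAt σ a b)) : Prv Δ (eqAt σ b a) :=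
  Prv.eqAt_eucl σ h (Prv.eqAt_refl σ a)

theorem Prv.eqAt_trans {σ : Ty} {a b c : Tm Γ σ} (h : Prv Δ (eqAt σ a b)) (h' : Prv Δ (eqAt σ b c)) :
    Prv Δ (eqAt σ a c) :=
  Prv.eqAt_eucl σ h.eqAt_symm h'

/-- Congruence is where the extensionality axiom enters: it changes the argument under `f`. The
function is then changed by instantiating the pointwise definition of equality at `b`. -/
theorem Prv.eqAt_app {σ τ : Ty} {f g : Tm Γ (σ ⇾ τ)} {a b : Tm Γ σ} (h : Prv Δ (eqAt _ f g))
    (h' : Prv Δ (eqAt σ a b)) : Prv Δ (eqAt τ (f ⬝ a) (g ⬝ b)) := by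
  refine Prv.eqAt_trans (.impE (.ax (.ext a b f)) h') ?_
  have := Derives.allE b h
  rw [Fm.inst, eqAt_subst] at this
  simp only [Tm.subst, Tm.wk_subst_cons, Sub.cons_zero] at this
  rwa [show f.subst (fun _ x => .var x) = f from Tm.subst_id f,
    show g.subst (fun _ x => .var x) = g from Tm.subst_id g] at this

end

/-! ### Extensional models -/

/-- Extensional type structures with the constants of `E-PRA^ω`. -/
structure Model where
  C : Ty → Type
  app {σ τ : Ty} : C (σ ⇾ τ) → C σ → C τ
  zero : C Ty.nat
  succ : C one
  K (σ τ : Ty) : C (σ ⇾ τ ⇾ σ)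
  S (ρ σ τ : Ty) : C ((ρ ⇾ σ ⇾ τ) ⇾ (ρ ⇾ σ) ⇾ ρ ⇾ τ)
  R : C (Ty.nat ⇾ Ty.nat ⇾ (Ty.nat ⇾ Ty.nat ⇾ Ty.nat) ⇾ Ty.nat)
  ext {σ τ : Ty} {f g : C (σ ⇾ τ)} : (∀ x, app f x = app g x) → f = g
  succ_ne_zero (n : C Ty.nat) : app succ n ≠ zero
  succ_inj {m n : C Ty.nat} : app succ m = app succ n → m = n
  K_eq {σ τ : Ty} (a : C σ) (b : C τ) : app (app (K σ τ) a) b = a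
  S_eq {ρ σ τ : Ty} (a : C (ρ ⇾ σ ⇾ τ)) (b : C (ρ ⇾ σ)) (c : C ρ) :
    app (app (app (S ρ σ τ) a) b) c = app (app a c) (app b c)
  R_zero (a : C Ty.nat) (b : C (Ty.nat ⇾ Ty.nat ⇾ Ty.nat)) : app (app (app R zero) a) b = a
  R_succ (n a : C Ty.nat) (b : C (Ty.nat ⇾ Ty.nat ⇾ Ty.nat)) :
    app (app (app R (app succ n)) a) b = app (app b (app (app (app R n) a) b)) n

infixl:80 " ◃ " => Model.app _

namespace Model

attribute [simp] K_eq S_eq R_zero R_succ succ_ne_zero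

variable {M : Model}

/-- Assignments of values to the variables of a context. -/
abbrev Env (M : Model) (Γ : List Ty) : Type := ∀ σ : Ty, Var Γ σ → M.C σ

def nil : M.Env [] := fun _ x => nomatch x

def cons {Γ : List Ty} {σ : Ty} (a : M.C σ) (e : M.Env Γ) : M.Env (σ :: Γ)
  | _, .zero => a
  | _, .succ x => e _ x

infixr:67 " ◂ " => Model.cons

@[simp] theorem cons_zero {Γ : List Ty} {σ : Ty} (a : M.C σ) (e : M.Env Γ) :
    (a ◂ e) σ .zero = a := rfl

@[simp] theorem cons_succ {Γ : List Ty} {σ τ : Ty} (a : M.C σ) (e : M.Env Γ) (x : Var Γ τ) :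
    (a ◂ e) τ x.succ = e τ x := rfl

theorem env_ext {Γ : List Ty} {σ : Ty} {e e' : M.Env (σ :: Γ)} (h0 : e σ .zero = e' σ .zero)
    (h1 : ∀ τ (x : Var Γ τ), e τ x.succ = e' τ x.succ) : e = e' := by
  funext τ x
  cases x with
  | zero => exact h0
  | succ x => exact h1 _ x

/-- The value of a term. -/
def ev {Γ : List Ty} (e : M.Env Γ) : {σ : Ty} → Tm Γ σ → M.C σ
  | _, .var x => e _ x
  | _, .zero => M.zero
  | _, .succ => M.succ
  | _, .K σ τ => M.K σ τ
  | _, .S ρ σ τ => M.S ρ σ τ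
  | _, .R => M.R
  | _, .app t u => ev e t ◃ ev e u

/-- Truth of a formula. -/
def Sat : {Γ : List Ty} → M.Env Γ → Fm Γ → Prop
  | _, e, .eq t u => ev e t = ev e u
  | _, _, .bot => False
  | _, e, .imp φ ψ => Sat e φ → Sat e ψ
  | _, e, .all σ φ => ∀ a : M.C σ, Sat (a ◂ e) φ

section

variable {Γ Δ : List Ty} {σ τ : Ty} (e : M.Env Γ)

@[simp] theorem ev_var (x : Var Γ σ) : ev e (.var x) = e _ x := rfl
@[simp] theorem ev_zero : ev e .zero = M.zero := rfl
@[simp] theorem ev_succ : ev e .succ = M.succ := rfl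
@[simp] theorem ev_K : ev e (.K σ τ) = M.K σ τ := rfl
@[simp] theorem ev_R : ev e .R = M.R := rfl
@[simp] theorem ev_app (t : Tm Γ (σ ⇾ τ)) (u : Tm Γ σ) : ev e (t ⬝ u) = ev e t ◃ ev e u := rfl

@[simp] theorem ev_lam {ρ : Ty} (a : M.C ρ) : {τ : Ty} → (t : Tm (ρ :: Γ) τ) →
    ev e t.lam ◃ a = ev (a ◂ e) t
  | _, .var .zero => by simp [Tm.lam, ev]
  | _, .var (.succ x) => by simp [Tm.lam, ev]
  | _, .zero => by simp [Tm.lam, ev]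
  | _, .succ => by simp [Tm.lam, ev]
  | _, .K _ _ => by simp [Tm.lam, ev]
  | _, .S _ _ _ => by simp [Tm.lam, ev]
  | _, .R => by simp [Tm.lam, ev]
  | _, .app t u => by simp [Tm.lam, ev, ev_lam a t, ev_lam a u]

theorem ev_subst (s : Sub Γ Δ) (e : M.Env Δ) (t : Tm Γ σ) :
    ev e (t.subst s) = ev (fun _ x => ev e (s _ x)) t := by
  induction t <;> simp_all [Tm.subst, ev]

@[simp] theorem ev_wk (t : Tm Γ σ) (a : M.C τ) : ev (a ◂ e) t.wk = ev e t := by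
  rw [Tm.wk, ev_subst]; rfl

theorem cons_lift (s : Sub Γ Δ) (e : M.Env Δ) (a : M.C σ) :
    (fun τ x => ev (a ◂ e) (s.lift τ x)) = a ◂ (fun _ x => ev e (s _ x)) :=
  env_ext rfl fun _ _ => ev_wk _ _ _

theorem sat_subst (φ : Fm Γ) : ∀ {Δ : List Ty} (s : Sub Γ Δ) (e : M.Env Δ),
    Sat e (φ.subst s) ↔ Sat (fun _ x => ev e (s _ x)) φ := by
  induction φ with
  | eq t u => intro Δ s e; simp [Fm.subst, Sat, ev_subst]
  | bot => intros; rfl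
  | imp φ ψ h1 h2 => intro Δ s e; simp [Fm.subst, Sat, h1, h2]
  | all σ φ h => intro Δ s e; simp only [Fm.subst, Sat, h, cons_lift]

@[simp] theorem sat_eq (t u : Tm Γ Ty.nat) : Sat e (t ≐ u) ↔ ev e t = ev e u := Iff.rfl
@[simp] theorem sat_bot : Sat e .bot ↔ False := Iff.rfl
@[simp] theorem sat_imp (φ ψ : Fm Γ) : Sat e (φ ⇛ ψ) ↔ (Sat e φ → Sat e ψ) := Iff.rfl
@[simp] theorem sat_all (φ : Fm (σ :: Γ)) : Sat e (.all σ φ) ↔ ∀ a, Sat (a ◂ e) φ := Iff.rfl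
@[simp] theorem sat_neg (φ : Fm Γ) : Sat e φ.neg ↔ ¬ Sat e φ := Iff.rfl
@[simp] theorem sat_and (φ ψ : Fm Γ) : Sat e (φ ⋏ ψ) ↔ Sat e φ ∧ Sat e ψ := by
  simp [Fm.and]
@[simp] theorem sat_or (φ ψ : Fm Γ) : Sat e (φ ⋎ ψ) ↔ Sat e φ ∨ Sat e ψ := by
  simp only [Fm.or, sat_imp, sat_neg]; tauto
@[simp] theorem sat_ex (φ : Fm (σ :: Γ)) : Sat e (.ex σ φ) ↔ ∃ a, Sat (a ◂ e) φ := by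
  simp [Fm.ex]

end

/-- The axiom schemes of `RCA₀^ω`. -/
structure RCA (M : Model) : Prop where
  induction {Γ : List Ty} (φ : Fm (Ty.nat :: Γ)) (_ : φ.QF) (e : M.Env Γ)
    (_ : Sat (M.zero ◂ e) φ) (_ : ∀ n, Sat (n ◂ e) φ → Sat ((M.succ ◃ n) ◂ e) φ) (n : M.C Ty.nat) :
    Sat (n ◂ e) φ
  qfac {Γ : List Ty} (φ : Fm (Ty.nat :: one :: Γ)) (_ : φ.QF) (e : M.Env Γ)
    (_ : ∀ f, ∃ n, Sat (n ◂ f ◂ e) φ) : ∃ F : M.C two, ∀ f, Sat ((F ◃ f) ◂ f ◂ e) φ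

end Model

/-! ### Countability of the syntax -/

section Countability

def Ty.depth : Ty → ℕ
  | .nat => 0
  | .arr σ τ => max σ.depth τ.depth + 1

instance : Countable Ty := by
  have : ∀ n, {σ : Ty | σ.depth < n}.Countable := by
    intro n
    induction n with
    | zero => simp
    | succ n ih =>
      refine ((Set.countable_singleton Ty.nat).union (ih.image2 ih Ty.arr)).mono ?_
      rintro (_ | ⟨σ, τ⟩) h
      · exact .inl rfl
      · simp only [Ty.depth, Set.mem_ofPred_eq] at h
        exact .inr ⟨σ, by simp; omega, τ, by simp; omega, rfl⟩
  rw [← Set.countable_univ_iff]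
  exact (Set.countable_iUnion this).mono fun σ _ => Set.mem_iUnion.2 ⟨σ.depth + 1, by simp⟩

theorem countable_of_filtration {α : Type} (d : α → ℕ) (h : ∀ n, {a | d a < n}.Countable) :
    Countable α := by
  rw [← Set.countable_univ_iff]
  exact (Set.countable_iUnion h).mono fun a _ => Set.mem_iUnion.2 ⟨d a + 1, by simp⟩

def Var.idx : {Γ : List Ty} → {σ : Ty} → Var Γ σ → ℕ
  | _, _, .zero => 0
  | _, _, .succ x => x.idx + 1

theorem Var.idx_injective {Γ : List Ty} {σ : Ty} : Function.Injective (Var.idx : Var Γ σ → ℕ) := by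
  intro x
  induction x with
  | zero => intro y h; cases y with
    | zero => rfl
    | succ y => simp [Var.idx] at h
  | succ x ih => intro y h; cases y with
    | zero => simp [Var.idx] at h
    | succ y => simp only [Var.idx, Nat.add_right_cancel_iff] at h; rw [ih h]

def Tm.depth {Γ : List Ty} : {σ : Ty} → Tm Γ σ → ℕ
  | _, .app t u => max t.depth u.depth + 1
  | _, _ => 0

/-- Terms that are not applications. -/
def Tm.atom {Γ : List Ty} : {σ : Ty} → Tm Γ σ → Prop
  | _, .app _ _ => False
  | _, _ => True

/-- The code may forget the type parameters of `K` and `S`: it is compared only between terms of one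
fixed type, which determines them. The value at applications is a placeholder. -/
def Tm.atomCode {Γ : List Ty} : {σ : Ty} → Tm Γ σ → ℕ
  | _, .var x => x.idx + 6
  | _, .zero => 0
  | _, .succ => 1
  | _, .K _ _ => 2
  | _, .S _ _ _ => 3
  | _, .R => 4
  | _, .app _ _ => 5

theorem Tm.countable_atoms {Γ : List Ty} {σ : Ty} : {t : Tm Γ σ | t.atom}.Countable := by
  refine Set.MapsTo.countable_of_injOn (f := Tm.atomCode) (Set.mapsTo_univ _ _) ?_ Set.countable_univ
  intro t ht u hu h
  cases t <;> cases u <;>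
    first | rfl | exact ht.elim | exact hu.elim | (simp [Tm.atomCode] at h; try omega)
  rw [Var.idx_injective h]

instance {Γ : List Ty} {σ : Ty} : Countable (Tm Γ σ) := by
  refine countable_of_filtration Tm.depth fun n => ?_
  induction n generalizing σ with
  | zero => simp
  | succ n ih =>
    refine (Tm.countable_atoms.union
      (Set.countable_iUnion fun ρ : Ty => (@ih (ρ ⇾ σ)).image2 (@ih ρ) Tm.app)).mono ?_
    intro t h
    cases t with
    | app t u =>
      simp only [Tm.depth, Set.mem_ofPred_eq] at h
      exact .inr (Set.mem_iUnion.2 ⟨_, t, by simp; omega, u, by simp; omega, rfl⟩)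
    | _ => exact .inl trivial

def Fm.depth : {Γ : List Ty} → Fm Γ → ℕ
  | _, .imp φ ψ => max φ.depth ψ.depth + 1
  | _, .all _ φ => φ.depth + 1
  | _, _ => 0

instance {Γ : List Ty} : Countable (Fm Γ) := by
  refine countable_of_filtration Fm.depth fun n => ?_
  induction n generalizing Γ with
  | zero => simp
  | succ n ih =>
    refine ((((Set.countable_univ.image2 Set.countable_univ Fm.eq).union
      (Set.countable_singleton .bot)).union (ih.image2 ih Fm.imp)).union
      (Set.countable_iUnion fun σ : Ty => (@ih (σ :: Γ)).image (Fm.all σ))).mono ?_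
    intro φ h
    cases φ with
    | eq a b => exact .inl (.inl (.inl ⟨a, trivial, b, trivial, rfl⟩))
    | bot => exact .inl (.inl (.inr rfl))
    | imp φ ψ =>
      simp only [Fm.depth, Set.mem_ofPred_eq] at h
      exact .inl (.inr ⟨φ, by simp; omega, ψ, by simp; omega, rfl⟩)
    | all σ φ =>
      simp only [Fm.depth, Set.mem_ofPred_eq] at h
      exact .inr (Set.mem_iUnion.2 ⟨σ, φ, by simp; omega, rfl⟩)

end Countability

/-! ### The Henkin construction -/

namespace Henkin

theorem exists_tyEnum : ∃ f : ℕ → Ty, Function.Surjective f :=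
  haveI : Nonempty Ty := ⟨.nat⟩
  exists_surjective_nat Ty

theorem exists_fmEnum (Γ : List Ty) : ∃ f : ℕ → Fm Γ, Function.Surjective f :=
  haveI : Nonempty (Fm Γ) := ⟨.bot⟩
  exists_surjective_nat (Fm Γ)

noncomputable section

/-- The type of the `n`-th Henkin constant. -/
def τ (n : ℕ) : Ty := exists_tyEnum.choose n.unpair.1

/-- The context of the first `n` Henkin constants. -/
def Γ : ℕ → List Ty
  | 0 => []
  | n + 1 => τ n :: Γ n

/-- The `i`-th Henkin constant, or a default term if it is not available. -/
def get : (n i : ℕ) → Tm (Γ n) (τ i)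
  | 0, i => Tm.dflt (τ i)
  | n + 1, i => if h : i = n then h ▸ .var .zero else (get n i).wk

/-- The embedding of `Γ m` into `Γ n` for `m ≤ n`, extended by default terms to all `m` and `n`. -/
def emb : (m n : ℕ) → Sub (Γ m) (Γ n)
  | 0, _ => fun _ x => nomatch x
  | m + 1, n => Sub.cons (get n m) (emb m n)

theorem get_self (n : ℕ) : get (n + 1) n = .var .zero := by simp [get]

theorem get_succ {n i : ℕ} (h : i ≠ n) : get (n + 1) i = (get n i).wk := dif_neg h

/-- Restricting to `m ≤ n` keeps the default terms out of the picture: each of the first `m`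
constants is already present in `Γ n`. -/
theorem emb_succ_right {m n : ℕ} (h : m ≤ n) : emb m (n + 1) = (emb m n).comp Sub.wk := by
  induction m with
  | zero => funext _ x; nomatch x
  | succ m ih =>
    refine Sub.cons_ext ?_ fun τ x => ?_
    · exact get_succ (by omega)
    · exact congrFun (congrFun (ih (by omega)) τ) x

theorem emb_self (n : ℕ) : emb n n = Sub.id := by
  induction n with
  | zero => funext _ x; nomatch x
  | succ n ih =>
    refine Sub.cons_ext (get_self n) fun τ x => ?_
    change emb n (n + 1) τ x = _
    rw [emb_succ_right le_rfl, ih]; rfl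

theorem get_emb {k i n : ℕ} (h : i < k) : (get k i).subst (emb k n) = get n i := by
  induction k with
  | zero => omega
  | succ k ih =>
    by_cases hi : i = k
    · subst hi; rw [get_self]; rfl
    · rw [get_succ hi]
      exact (Tm.wk_subst_cons _ _ _).trans (ih (by omega))

theorem emb_comp {m k n : ℕ} (h : m ≤ k) : (emb m k).comp (emb k n) = emb m n := by
  induction m with
  | zero => funext _ x; nomatch x
  | succ m ih =>
    refine Sub.cons_ext (get_emb (by omega)) fun τ x => ?_
    exact congrFun (congrFun (ih (by omega)) τ) x

/-- The formula treated at stage `n`. -/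
def stage (n : ℕ) : Fm (τ n :: Γ n) :=
  ((exists_fmEnum (τ n :: Γ n.unpair.2.unpair.1)).choose n.unpair.2.unpair.2).subst
    (emb n.unpair.2.unpair.1 n).lift

/-- The index `n` codes a type, a context length and a formula, and it bounds each of these numbers.
So every formula comes up at a stage where its constants already exist. The transport by `h` is
needed because `σ` and `τ n` agree only propositionally. -/
theorem exists_stage (k : ℕ) (σ : Ty) (φ : Fm (σ :: Γ k)) :
    ∃ n, k ≤ n ∧ ∃ h : σ = τ n, stage n = h ▸ φ.subst (emb k n).lift := by
  obtain ⟨a, ha⟩ := exists_tyEnum.choose_spec σ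
  subst ha
  obtain ⟨j, hj⟩ := (exists_fmEnum _).choose_spec φ
  refine ⟨Nat.pair a (Nat.pair k j), (Nat.left_le_pair k j).trans (Nat.right_le_pair _ _), ?_⟩
  have h : exists_tyEnum.choose a = τ (Nat.pair a (Nat.pair k j)) := by simp [τ]
  refine ⟨h, ?_⟩
  subst hj
  -- Once `n` is a variable, its three components can be substituted for `a`, `k` and `j`, and the
  -- transport disappears.
  generalize hn : Nat.pair a (Nat.pair k j) = n at h
  have h1 : n.unpair.1 = a := by rw [← hn]; simp
  have h2 : k = n.unpair.2.unpair.1 := by rw [← hn]; simp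
  have h3 : j = n.unpair.2.unpair.2 := by rw [← hn]; simp
  clear hn
  subst h1 h2 h3
  rfl

/-! ### Consistency of the stages of the Henkin theory -/

def Con {Γ : List Ty} (Δ : List (Fm Γ)) : Prop := ¬ Prv Δ .bot

open Classical in
/-- The theory of stage `n`. -/
def Th (Δ₀ : List (Fm [])) : (n : ℕ) → List (Fm (Γ n))
  | 0 => Δ₀
  | n + 1 =>
    let H := (stage n ⇛ (Fm.all _ (stage n)).wk) :: (Th Δ₀ n).map Fm.wk
    if Con (stage n :: H) then stage n :: H else (stage n).neg :: H

theorem con_decide {Γ : List Ty} {Δ : List (Fm Γ)} {φ : Fm Γ} (h : Con Δ) (h' : ¬ Con (φ :: Δ)) :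
    Con (φ.neg :: Δ) := fun hb => h' fun h1 => h (.impE (.impI hb) (.impI h1))

/-- If the new axiom were refutable, then `φ` would hold for the fresh constant, hence for all
values, and this already gives the axiom. The default term serves to discard the fresh variable from
the resulting derivation of `⊥`, since every type is inhabited. -/
theorem con_henkin {Γ : List Ty} {Δ : List (Fm Γ)} (h : Con Δ) {σ : Ty} (φ : Fm (σ :: Γ)) :
    Con ((φ ⇛ (Fm.all _ φ).wk) :: Δ.map Fm.wk) := by
  intro hb
  have hn : Prv (Δ.map Fm.wk) (φ ⇛ (Fm.all _ φ).wk).neg := .impI hb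
  have h1 : Prv (Δ.map Fm.wk) φ := by
    refine .raa (.impE hn.weak (.impI (Prv.botE ?_)))
    exact Prv.negE Prv.hyp0.weak Prv.hyp0
  have h2 : Prv Δ (Fm.all _ φ) := .allI h1
  have h3 : Prv (Δ.map (Fm.wk (σ := σ))) .bot := .impE hn (.impI (Prv.weak h2.wk))
  exact h (.allE (Tm.dflt σ) (.allI h3))

theorem con_theory {Δ₀ : List (Fm [])} (h : Con Δ₀) (n : ℕ) : Con (Th Δ₀ n) := by
  induction n with
  | zero => exact h
  | succ n ih =>
    have := con_henkin ih (stage n)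
    simp only [Th]
    split_ifs with hc
    · exact hc
    · exact con_decide this hc

variable {Δ₀ : List (Fm [])}

theorem theory_succ (n : ℕ) : ∃ φ, (φ = stage n ∨ φ = (stage n).neg) ∧ Th Δ₀ (n + 1) =
    φ :: (stage n ⇛ (Fm.all _ (stage n)).wk) :: (Th Δ₀ n).map Fm.wk := by
  by_cases h : Con (stage n :: (stage n ⇛ (Fm.all _ (stage n)).wk) :: (Th Δ₀ n).map Fm.wk)
  · exact ⟨stage n, .inl rfl, if_pos h⟩
  · exact ⟨(stage n).neg, .inr rfl, if_neg h⟩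

theorem henkin_mem (n : ℕ) : (stage n ⇛ (Fm.all _ (stage n)).wk) ∈ Th Δ₀ (n + 1) := by
  obtain ⟨φ, _, h⟩ := theory_succ (Δ₀ := Δ₀) n
  rw [h]; exact .tail _ (.head _)

theorem decide_mem (n : ℕ) : stage n ∈ Th Δ₀ (n + 1) ∨ (stage n).neg ∈ Th Δ₀ (n + 1) := by
  obtain ⟨φ, rfl | rfl, h⟩ := theory_succ (Δ₀ := Δ₀) n
  · left; rw [h]; exact .head _
  · right; rw [h]; exact .head _

theorem map_wk_subset (n : ℕ) : (Th Δ₀ n).map Fm.wk ⊆ Th Δ₀ (n + 1) := by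
  obtain ⟨φ, _, h⟩ := theory_succ (Δ₀ := Δ₀) n
  rw [h]; exact fun χ hχ => .tail _ (.tail _ hχ)

theorem subst_emb_succ {m n : ℕ} (h : m ≤ n) (φ : Fm (Γ m)) :
    φ.subst (emb m (n + 1)) = (φ.subst (emb m n)).wk :=
  (congrArg (fun s => φ.subst s) (emb_succ_right h)).trans (Fm.subst_subst φ _ _).symm

theorem prv_emb {m n : ℕ} (h : m ≤ n) {φ : Fm (Γ m)} (hp : Prv (Th Δ₀ m) φ) :
    Prv (Th Δ₀ n) (φ.subst (emb m n)) := by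
  induction n, h using Nat.le_induction with
  | base => rwa [emb_self, Fm.subst_id]
  | succ n hn ih =>
    rw [subst_emb_succ hn]
    exact ih.wk.mono (map_wk_subset n)

/-- Truth in the limit. -/
def T (Δ₀ : List (Fm [])) (n : ℕ) (φ : Fm (Γ n)) : Prop :=
  ∃ N, n ≤ N ∧ Prv (Th Δ₀ N) (φ.subst (emb n N))

theorem T_of_prv {n : ℕ} {φ : Fm (Γ n)} (h : Prv (Th Δ₀ n) φ) : T Δ₀ n φ :=
  ⟨n, le_rfl, by rwa [emb_self, Fm.subst_id]⟩

theorem T_emb {m n : ℕ} (h : m ≤ n) {φ : Fm (Γ m)} : T Δ₀ n (φ.subst (emb m n)) ↔ T Δ₀ m φ := by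
  constructor
  · rintro ⟨N, hN, hp⟩
    rw [Fm.subst_subst, emb_comp h] at hp
    exact ⟨N, h.trans hN, hp⟩
  · rintro ⟨N, hN, hp⟩
    refine ⟨max n N, le_max_left _ _, ?_⟩
    have := prv_emb (le_max_right n N) hp
    rwa [Fm.subst_subst, emb_comp hN, ← emb_comp (k := n) h, ← Fm.subst_subst] at this

theorem T_mp {n : ℕ} {φ ψ : Fm (Γ n)} (h : T Δ₀ n (φ ⇛ ψ)) (h' : T Δ₀ n φ) : T Δ₀ n ψ := by
  obtain ⟨N, hN, hp⟩ := h
  obtain ⟨N', hN', hp'⟩ := h'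
  refine ⟨max N N', hN.trans (le_max_left _ _), ?_⟩
  have h1 := prv_emb (le_max_left N N') hp
  have h2 := prv_emb (le_max_right N N') hp'
  rw [Fm.subst_subst, emb_comp hN] at h1
  rw [Fm.subst_subst, emb_comp hN'] at h2
  exact .impE h1 h2

theorem T_taut {n : ℕ} {φ : Fm (Γ n)} (h : Prv [] φ) : T Δ₀ n φ := T_of_prv (h.mono (by simp))

theorem not_T_bot (hc : Con Δ₀) {n : ℕ} : ¬ T Δ₀ n .bot := fun ⟨N, _, hp⟩ => con_theory hc N hp

theorem wk_lift_emb {k n : ℕ} (h : k ≤ n) (φ : Fm (Γ k)) {σ : Ty} (hσ : σ = τ n) :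
    (hσ ▸ (φ.wk : Fm (σ :: Γ k)).subst (emb k n).lift : Fm (τ n :: Γ n)) = φ.subst (emb k (n + 1)) := by
  subst hσ
  exact (Fm.wk_subst_lift _ _).trans (subst_emb_succ h φ).symm

/-- Each stage decides its own formula. A formula without the new constant is also treated at some
stage, as its weakening by a dummy variable. -/
theorem T_or_neg {n : ℕ} (φ : Fm (Γ n)) : T Δ₀ n φ ∨ T Δ₀ n φ.neg := by
  obtain ⟨m, hm, hσ, he⟩ := exists_stage n .nat φ.wk
  rw [wk_lift_emb hm] at he
  have hm' : n ≤ m + 1 := by omega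
  rcases decide_mem (Δ₀ := Δ₀) m with h | h
  · left; rw [← T_emb hm']; rw [he] at h; exact T_of_prv (.hyp h)
  · right; rw [← T_emb hm']; rw [he] at h; exact T_of_prv (.hyp h)

theorem T_imp {n : ℕ} {φ ψ : Fm (Γ n)} :
    T Δ₀ n (φ ⇛ ψ) ↔ (T Δ₀ n φ → T Δ₀ n ψ) := by
  refine ⟨T_mp, fun h => ?_⟩
  rcases T_or_neg (Δ₀ := Δ₀) φ with h1 | h1
  · exact T_mp (T_taut (.impI (.impI (.hyp (by simp))))) (h h1)
  · exact T_mp (T_taut (.impI (.impI (Prv.botE (.impE (φ := φ) (.hyp (by simp [Fm.neg])) Prv.hyp0))))) h1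

/-- The quantifier has to range over terms of later stages, as these name further elements. From
right to left, the constant introduced at the stage that treats `φ` is a counterexample if there is
one, by the Henkin axiom. -/
theorem T_all {n : ℕ} {σ : Ty} {φ : Fm (σ :: Γ n)} :
    T Δ₀ n (.all σ φ) ↔ ∀ m, n ≤ m → ∀ t : Tm (Γ m) σ, T Δ₀ m (φ.subst (Sub.cons t (emb n m))) := by
  constructor
  · intro h m hm t
    rw [← T_emb hm] at h
    obtain ⟨N, hN, hp⟩ := h
    refine ⟨N, hN, ?_⟩
    rw [← Fm.subst_lift_inst, Fm.inst_subst]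
    exact .allE _ hp
  · intro h
    obtain ⟨m, hm, rfl, he⟩ := exists_stage n σ φ
    have hm' : n ≤ m + 1 := by omega
    rw [← T_emb hm']
    have h1 := h (m + 1) hm' (.var .zero)
    have h2 : φ.subst (Sub.cons (.var .zero) (emb n (m + 1))) = stage m := by
      rw [he, emb_succ_right hm]; rfl
    have h3 : (Fm.all _ φ).subst (emb n (m + 1)) = (Fm.all _ (stage m)).wk := by
      rw [he, subst_emb_succ hm]; rfl
    exact (congrArg (T Δ₀ (m + 1)) h3).mpr
      (T_mp (T_of_prv (.hyp (henkin_mem m))) ((congrArg (T Δ₀ (m + 1)) h2).mp h1))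

/-! ### The term model -/

variable (Δ₀) in
/-- Terms over the Henkin constants, up to provable equality. -/
def termSetoid (σ : Ty) : Setoid (Σ n, Tm (Γ n) σ) where
  r a b := ∃ N, a.1 ≤ N ∧ b.1 ≤ N ∧
    Prv (Th Δ₀ N) (eqAt σ (a.2.subst (emb a.1 N)) (b.2.subst (emb b.1 N)))
  iseqv :=
    { refl := fun a => ⟨a.1, le_rfl, le_rfl, Prv.eqAt_refl _ _⟩
      symm := fun ⟨N, h1, h2, h⟩ => ⟨N, h2, h1, h.eqAt_symm⟩
      trans := by
        rintro a b c ⟨N, h1, h2, h⟩ ⟨N', h1', h2', h'⟩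
        refine ⟨max N N', h1.trans (le_max_left _ _), h2'.trans (le_max_right _ _), ?_⟩
        have e1 := prv_emb (le_max_left N N') h
        have e2 := prv_emb (le_max_right N N') h'
        rw [eqAt_subst, Tm.subst_subst, Tm.subst_subst, emb_comp h1, emb_comp h2] at e1
        rw [eqAt_subst, Tm.subst_subst, Tm.subst_subst, emb_comp h1', emb_comp h2'] at e2
        exact e1.eqAt_trans e2 }

variable (Δ₀) in
def mk {σ : Ty} (n : ℕ) (t : Tm (Γ n) σ) : Quotient (termSetoid Δ₀ σ) := Quotient.mk _ ⟨n, t⟩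

theorem mk_eq_iff {σ : Ty} {n : ℕ} {t u : Tm (Γ n) σ} :
    mk Δ₀ n t = mk Δ₀ n u ↔ T Δ₀ n (eqAt σ t u) := by
  rw [mk, mk, Quotient.eq]
  constructor
  · rintro ⟨N, h, _, hp⟩
    exact ⟨N, h, by rwa [eqAt_subst]⟩
  · rintro ⟨N, h, hp⟩
    exact ⟨N, h, h, by rwa [eqAt_subst] at hp⟩

theorem mk_emb {σ : Ty} {m n : ℕ} (h : m ≤ n) (t : Tm (Γ m) σ) :
    mk Δ₀ n (t.subst (emb m n)) = mk Δ₀ m t := by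
  refine Quotient.sound ⟨n, le_rfl, h, ?_⟩
  change Prv _ (eqAt σ ((t.subst (emb m n)).subst (emb n n)) _)
  rw [emb_self, Tm.subst_id]; exact Prv.eqAt_refl _ _

theorem exists_mk {σ : Ty} (a : Quotient (termSetoid Δ₀ σ)) : ∃ n, ∀ m, n ≤ m →
    ∃ t, a = mk Δ₀ m t := by
  obtain ⟨⟨n, t⟩, rfl⟩ := Quotient.exists_rep a
  exact ⟨n, fun m h => ⟨_, (mk_emb h t).symm⟩⟩

variable (Δ₀) in
-- Function and argument may live in different contexts, so both are first moved to the larger one.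
def mapp {σ τ : Ty} (f : Quotient (termSetoid Δ₀ (σ ⇾ τ))) (a : Quotient (termSetoid Δ₀ σ)) :
    Quotient (termSetoid Δ₀ τ) :=
  Quotient.liftOn₂ f a
    (fun f a => mk Δ₀ (max f.1 a.1)
      (f.2.subst (emb f.1 (max f.1 a.1)) ⬝ a.2.subst (emb a.1 (max f.1 a.1)))) (by
    rintro f a g b ⟨N, h1, h2, h⟩ ⟨N', h1', h2', h'⟩
    refine Quotient.sound ⟨max N N', by simp; omega, by simp; omega, ?_⟩
    have e1 := prv_emb (le_max_left N N') h
    have e2 := prv_emb (le_max_right N N') h'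
    rw [eqAt_subst, Tm.subst_subst, Tm.subst_subst, emb_comp h1, emb_comp h2] at e1
    rw [eqAt_subst, Tm.subst_subst, Tm.subst_subst, emb_comp h1', emb_comp h2'] at e2
    simp only [Tm.subst, Tm.subst_subst]
    rw [emb_comp (by simp), emb_comp (by simp), emb_comp (by simp), emb_comp (by simp)]
    exact e1.eqAt_app e2)

theorem mapp_mk {σ τ : Ty} {n : ℕ} (f : Tm (Γ n) (σ ⇾ τ)) (a : Tm (Γ n) σ) :
    mapp Δ₀ (mk Δ₀ n f) (mk Δ₀ n a) = mk Δ₀ n (f ⬝ a) := by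
  -- The stage `max n n` equals `n` only propositionally, so it is generalised before being
  -- substituted.
  have : ∀ N, N = n → mk Δ₀ N (f.subst (emb n N) ⬝ a.subst (emb n N)) = mk Δ₀ n (f ⬝ a) := by
    rintro N rfl
    rw [emb_self, Tm.subst_id, Tm.subst_id]
  exact this _ (max_self n)

theorem T_ax {n : ℕ} {φ : Fm (Γ n)} (h : RCAω _ φ) : T Δ₀ n φ := T_of_prv (.ax h)

theorem exists_mk₂ {σ τ : Ty} (a : Quotient (termSetoid Δ₀ σ)) (b : Quotient (termSetoid Δ₀ τ)) :
    ∃ n t u, a = mk Δ₀ n t ∧ b = mk Δ₀ n u := by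
  obtain ⟨m, hm⟩ := exists_mk a
  obtain ⟨n, hn⟩ := exists_mk b
  obtain ⟨t, ht⟩ := hm (max m n) (le_max_left _ _)
  obtain ⟨u, hu⟩ := hn (max m n) (le_max_right _ _)
  exact ⟨_, t, u, ht, hu⟩

theorem exists_mk₃ {σ τ ρ : Ty} (a : Quotient (termSetoid Δ₀ σ)) (b : Quotient (termSetoid Δ₀ τ))
    (c : Quotient (termSetoid Δ₀ ρ)) :
    ∃ n t u v, a = mk Δ₀ n t ∧ b = mk Δ₀ n u ∧ c = mk Δ₀ n v := by
  obtain ⟨m, hm⟩ := exists_mk a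
  obtain ⟨n, hn⟩ := exists_mk b
  obtain ⟨k, hk⟩ := exists_mk c
  obtain ⟨t, ht⟩ := hm (max m (max n k)) (by simp)
  obtain ⟨u, hu⟩ := hn (max m (max n k)) (by simp)
  obtain ⟨v, hv⟩ := hk (max m (max n k)) (by simp)
  exact ⟨_, t, u, v, ht, hu, hv⟩

theorem mk_const {σ : Ty} (t : ∀ {Γ : List Ty}, Tm Γ σ)
    (ht : ∀ {Γ Δ : List Ty} (s : Sub Γ Δ), (t : Tm Γ σ).subst s = t) (n : ℕ) :
    mk Δ₀ 0 t = mk Δ₀ n t := by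
  rw [← mk_emb (Nat.zero_le n), ht]

/-- Equality at a function type is by definition a universally quantified equality. By `T_all` this
is tested on all terms of later stages, which represent all elements. -/
theorem mapp_ext {σ τ : Ty} {f g : Quotient (termSetoid Δ₀ (σ ⇾ τ))}
    (h : ∀ x, mapp Δ₀ f x = mapp Δ₀ g x) : f = g := by
  obtain ⟨n, f, g, rfl, rfl⟩ := exists_mk₂ f g
  rw [mk_eq_iff]
  refine T_all.2 fun m hm t => ?_
  rw [eqAt_subst]
  simp only [Tm.subst, Tm.wk_subst_cons, Sub.cons_zero]
  rw [← mk_eq_iff, ← mapp_mk, ← mapp_mk, mk_emb hm, mk_emb hm]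
  exact h _

variable (Δ₀) in
def termModel (hc : Con Δ₀) : Model where
  C σ := Quotient (termSetoid Δ₀ σ)
  app := mapp Δ₀
  zero := mk Δ₀ 0 .zero
  succ := mk Δ₀ 0 .succ
  K σ τ := mk Δ₀ 0 (.K σ τ)
  S ρ σ τ := mk Δ₀ 0 (.S ρ σ τ)
  R := mk Δ₀ 0 .R
  ext := mapp_ext
  succ_ne_zero a := by
    obtain ⟨n, t, _, rfl, _⟩ := exists_mk₂ a a
    rw [mk_const .succ (fun _ => rfl) n, mk_const .zero (fun _ => rfl) n, mapp_mk, Ne, mk_eq_iff]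
    exact fun h => not_T_bot hc (T_mp (T_ax (.succ_ne_zero t)) h)
  succ_inj {a b} := by
    obtain ⟨n, t, u, rfl, rfl⟩ := exists_mk₂ a b
    rw [mk_const .succ (fun _ => rfl) n, mapp_mk, mapp_mk, mk_eq_iff, mk_eq_iff]
    exact T_mp (T_ax (.succ_inj t u))
  K_eq {σ τ} a b := by
    obtain ⟨n, t, u, rfl, rfl⟩ := exists_mk₂ a b
    rw [mk_const (.K σ τ) (fun _ => rfl) n, mapp_mk, mapp_mk, mk_eq_iff]
    exact T_ax (.K_eq t u)
  S_eq {ρ σ τ} a b c := by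
    obtain ⟨n, t, u, v, rfl, rfl, rfl⟩ := exists_mk₃ a b c
    rw [mk_const (.S ρ σ τ) (fun _ => rfl) n]
    simp only [mapp_mk]
    rw [mk_eq_iff]
    exact T_ax (.S_eq t u v)
  R_zero a b := by
    obtain ⟨n, t, u, rfl, rfl⟩ := exists_mk₂ a b
    rw [mk_const .zero (fun _ => rfl) n, mk_const .R (fun _ => rfl) n]
    simp only [mapp_mk]
    rw [mk_eq_iff]
    exact T_ax (.R_zero t u)
  R_succ a b c := by
    obtain ⟨n, t, u, v, rfl, rfl, rfl⟩ := exists_mk₃ a b c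
    rw [mk_const .succ (fun _ => rfl) n, mk_const .R (fun _ => rfl) n]
    simp only [mapp_mk]
    rw [mk_eq_iff]
    exact T_ax (.R_succ t u v)

variable (hc : Con Δ₀)

/-- The assignment given by a substitution. -/
def env {Θ : List Ty} {n : ℕ} (s : Sub Θ (Γ n)) : (termModel Δ₀ hc).Env Θ := fun _ x => mk Δ₀ n (s _ x)

theorem env_emb {Θ : List Ty} {m n : ℕ} (h : m ≤ n) (s : Sub Θ (Γ m)) :
    env hc (s.comp (emb m n)) = env hc s := by
  funext _ x; exact mk_emb h _

theorem env_cons {Θ : List Ty} {σ : Ty} {n : ℕ} (s : Sub Θ (Γ n)) (t : Tm (Γ n) σ) :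
    env hc (Sub.cons t s) = Model.cons (M := termModel Δ₀ hc) (mk Δ₀ n t) (env hc s) :=
  Model.env_ext rfl fun _ _ => rfl

theorem ev_env {Θ : List Ty} {σ : Ty} {n : ℕ} (s : Sub Θ (Γ n)) (t : Tm Θ σ) :
    Model.ev (env hc s) t = mk Δ₀ n (t.subst s) := by
  induction t with
  | var x => rfl
  | app t u h1 h2 => exact (congrArg₂ (mapp Δ₀) h1 h2).trans (mapp_mk _ _)
  | zero => exact mk_const .zero (fun _ => rfl) n
  | succ => exact mk_const .succ (fun _ => rfl) n
  | K σ τ => exact mk_const (.K σ τ) (fun _ => rfl) n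
  | S ρ σ τ => exact mk_const (.S ρ σ τ) (fun _ => rfl) n
  | R => exact mk_const .R (fun _ => rfl) n

/-- The truth lemma: validity in the term model coincides with being derived at some stage. -/
theorem sat_env {Θ : List Ty} (φ : Fm Θ) : ∀ {n : ℕ} (s : Sub Θ (Γ n)),
    Model.Sat (env hc s) φ ↔ T Δ₀ n (φ.subst s) := by
  induction φ with
  | eq a b =>
    intro n s
    rw [Model.sat_eq, ev_env, ev_env]
    exact mk_eq_iff
  | bot => intro n s; exact ⟨False.elim, not_T_bot hc⟩
  | imp φ ψ h1 h2 => intro n s; rw [Model.sat_imp, h1, h2, ← T_imp]; rfl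
  | all σ φ h =>
    intro n s
    have key : ∀ {m : ℕ}, n ≤ m → ∀ t : Tm (Γ m) σ,
        (Model.Sat (Model.cons (M := termModel Δ₀ hc) (mk Δ₀ m t) (env hc s)) φ ↔
          T Δ₀ m ((φ.subst s.lift).subst (Sub.cons t (emb n m)))) := by
      intro m hm t
      rw [← env_emb hc hm, ← env_cons, h, Fm.subst_subst]
      have : s.lift.comp (Sub.cons t (emb n m)) = Sub.cons t (s.comp (emb n m)) :=
        Sub.cons_ext rfl fun τ x => Tm.wk_subst_cons _ _ _
      rw [this]
    rw [Model.sat_all, Fm.subst, T_all]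
    constructor
    · intro hs m hm t
      exact (key hm t).1 (hs _)
    · intro hT a
      obtain ⟨m, hm⟩ := exists_mk a
      obtain ⟨t, rfl⟩ := hm (max m n) (le_max_left _ _)
      exact (key (le_max_right _ _) t).2 (hT _ (le_max_right _ _) t)

/-- A context is finite, so the values of its variables have representatives at a common stage;
hence the truth lemma covers all assignments. -/
theorem exists_env {Θ : List Ty} (e : (termModel Δ₀ hc).Env Θ) : ∃ n, ∃ s : Sub Θ (Γ n), e = env hc s := by
  induction Θ with
  | nil =>
    refine ⟨0, Sub.id, ?_⟩
    funext _ x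
    nomatch x
  | cons σ Θ ih =>
    obtain ⟨n, s, hs⟩ := ih fun _ x => e _ x.succ
    obtain ⟨m, hm⟩ := exists_mk (e σ .zero)
    obtain ⟨t, ht⟩ := hm (max m n) (le_max_left _ _)
    refine ⟨max m n, Sub.cons t (s.comp (emb n (max m n))), ?_⟩
    rw [env_cons, env_emb hc (le_max_right _ _), ← hs, ← ht]
    exact Model.env_ext rfl fun _ _ => rfl

theorem sat_ax {Θ : List Ty} {φ : Fm Θ} (h : RCAω _ φ) (e : (termModel Δ₀ hc).Env Θ) :
    Model.Sat e φ := by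
  obtain ⟨n, s, rfl⟩ := exists_env hc e
  rw [sat_env]
  exact T_ax (h.subst s)

theorem termModel_RCA : (termModel Δ₀ hc).RCA where
  induction φ hq e h0 hS n := by
    have := sat_ax hc (.induction φ hq) e
    simp only [Model.sat_imp, Model.sat_all, Fm.inst, Model.sat_subst] at this
    refine this ?_ (fun n h => ?_) n
    · convert h0 using 1
      exact Model.env_ext rfl fun _ _ => rfl
    · convert hS n h using 1
      exact Model.env_ext rfl fun _ _ => rfl
  qfac φ hq e h := by
    have := sat_ax hc (.qfac φ hq) e
    simp only [Model.sat_imp, Model.sat_all, Model.sat_ex, Model.sat_subst] at this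
    obtain ⟨F, hF⟩ := this h
    refine ⟨F, fun f => ?_⟩
    convert hF f using 1
    exact Model.env_ext rfl fun _ x => by cases x <;> rfl

end

end Henkin

/-- Completeness of `RCA₀^ω` with respect to extensional models. -/
theorem completeness {φ ψ : Fm []}
    (h : ∀ M : Model, M.RCA → Model.Sat (M := M) Model.nil φ → Model.Sat (M := M) Model.nil ψ) :
    Derives RCAω [φ] ψ := by
  -- A failing derivation makes `ψ.neg, φ` consistent, and their term model contradicts the
  -- hypothesis.
  by_contra hn
  have hc : Henkin.Con [ψ.neg, φ] := fun hb => hn (.raa hb)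
  have hsat : ∀ χ ∈ [ψ.neg, φ], Model.Sat (M := Henkin.termModel _ hc) Model.nil χ := by
    intro χ hχ
    have : (Model.nil : (Henkin.termModel _ hc).Env []) = Henkin.env hc (n := 0) Sub.id := by
      funext _ x; nomatch x
    rw [this]
    refine (Henkin.sat_env hc χ (n := 0) Sub.id).2 ?_
    exact (congrArg (Henkin.T _ 0) (Fm.subst_id χ)).mpr (Henkin.T_of_prv (.hyp hχ))
  exact hsat ψ.neg (by simp) (h _ (Henkin.termModel_RCA hc) (hsat φ (by simp)))

/-! ### The ordered field of fractions of an ordered semiring -/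

section Fractions

variable (α : Type) [CommSemiring α] [LinearOrder α] [IsStrictOrderedRing α]
  [CanonicallyOrderedAdd α]

/-- Formal fractions `(p - m) / d`. -/
structure PreFrac where
  p : α
  m : α
  d : α
  pos : 0 < d

variable {α}

/-- Stated without subtraction or division: the middle fraction is eliminated by cancelling its
denominator and adding the same terms on both sides. -/
theorem fracRel_trans {p m d p' m' d' p'' m'' d'' : α} (hd : 0 < d')
    (h : p * d' + m' * d = p' * d + m * d') (h' : p' * d'' + m'' * d' = p'' * d' + m' * d'') :
    p * d'' + m'' * d = p'' * d + m * d'' := by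
  refine mul_right_cancel₀ hd.ne' (add_right_cancel (b := p' * d * d'' + m' * d * d'') ?_)
  calc _ = (p * d' + m' * d) * d'' + (p' * d'' + m'' * d') * d := by ring
    _ = (p' * d + m * d') * d'' + (p'' * d' + m' * d'') * d := by rw [h, h']
    _ = _ := by ring

instance fracSetoid : Setoid (PreFrac α) where
  r x y := x.p * y.d + y.m * x.d = y.p * x.d + x.m * y.d
  iseqv :=
    { refl := fun x => by ring
      symm := fun {x y} h => by rw [h]
      trans := fun {x y z} h h' => fracRel_trans y.pos h h' }

variable (α) in
def Frac : Type := Quotient (fracSetoid (α := α))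

namespace Frac

def mk (p m d : α) (h : 0 < d) : Frac α := Quotient.mk _ ⟨p, m, d, h⟩

theorem mk_eq {p m d p' m' d' : α} {h : 0 < d} {h' : 0 < d'} :
    mk p m d h = mk p' m' d' h' ↔ p * d' + m' * d = p' * d + m * d' := Quotient.eq

theorem ind {P : Frac α → Prop} (h : ∀ p m d hd, P (mk p m d hd)) (x : Frac α) : P x :=
  Quotient.ind (fun x => h x.p x.m x.d x.pos) x

instance : Zero (Frac α) := ⟨mk 0 0 1 one_pos⟩
instance : One (Frac α) := ⟨mk 1 0 1 one_pos⟩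

instance : Add (Frac α) := ⟨fun x y => Quotient.liftOn₂ x y
  (fun x y => mk (x.p * y.d + y.p * x.d) (x.m * y.d + y.m * x.d) (x.d * y.d) (mul_pos x.pos y.pos)) (by
    intro x y x' y' h h'
    rw [mk_eq]
    change x.p * x'.d + x'.m * x.d = x'.p * x.d + x.m * x'.d at h
    change y.p * y'.d + y'.m * y.d = y'.p * y.d + y.m * y'.d at h'
    calc _ = (x.p * x'.d + x'.m * x.d) * (y.d * y'.d) + (y.p * y'.d + y'.m * y.d) * (x.d * x'.d) := by
          ring
      _ = (x'.p * x.d + x.m * x'.d) * (y.d * y'.d) + (y'.p * y.d + y.m * y'.d) * (x.d * x'.d) := by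
          rw [h, h']
      _ = _ := by ring)⟩

instance : Neg (Frac α) := ⟨fun x => Quotient.liftOn x (fun x => mk x.m x.p x.d x.pos) (by
    intro x x' h
    rw [mk_eq]
    change x.p * x'.d + x'.m * x.d = x'.p * x.d + x.m * x'.d at h
    rw [add_comm, add_comm (x'.m * x.d), h])⟩

instance : Mul (Frac α) := ⟨fun x y => Quotient.liftOn₂ x y
  (fun x y => mk (x.p * y.p + x.m * y.m) (x.p * y.m + x.m * y.p) (x.d * y.d) (mul_pos x.pos y.pos)) (by
    intro x y x' y' h h'
    rw [mk_eq]
    change x.p * x'.d + x'.m * x.d = x'.p * x.d + x.m * x'.d at h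
    change y.p * y'.d + y'.m * y.d = y'.p * y.d + y.m * y'.d at h'
    -- The factors are changed one at a time, through the product of the new first and the old
    -- second factor.
    refine fracRel_trans (p' := x'.p * y.p + x'.m * y.m) (m' := x'.p * y.m + x'.m * y.p)
      (mul_pos x'.pos y.pos) ?_ ?_
    · calc _ = (x.p * x'.d + x'.m * x.d) * (y.p * y.d) + (x'.p * x.d + x.m * x'.d) * (y.m * y.d) := by
            ring
        _ = (x'.p * x.d + x.m * x'.d) * (y.p * y.d) + (x.p * x'.d + x'.m * x.d) * (y.m * y.d) := by
            rw [h]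
        _ = _ := by ring
    · calc _ = (y.p * y'.d + y'.m * y.d) * (x'.p * x'.d) + (y'.p * y.d + y.m * y'.d) * (x'.m * x'.d) := by
            ring
        _ = (y'.p * y.d + y.m * y'.d) * (x'.p * x'.d) + (y.p * y'.d + y'.m * y.d) * (x'.m * x'.d) := by
            rw [h']
        _ = _ := by ring)⟩

theorem add_mk (p m d p' m' d' : α) (h : 0 < d) (h' : 0 < d') : mk p m d h + mk p' m' d' h' =
    mk (p * d' + p' * d) (m * d' + m' * d) (d * d') (mul_pos h h') := rfl
theorem mul_mk (p m d p' m' d' : α) (h : 0 < d) (h' : 0 < d') : mk p m d h * mk p' m' d' h' =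
    mk (p * p' + m * m') (p * m' + m * p') (d * d') (mul_pos h h') := rfl
theorem neg_mk (p m d : α) (h : 0 < d) : -mk p m d h = mk m p d h := rfl
theorem zero_def : (0 : Frac α) = mk 0 0 1 one_pos := rfl
theorem one_def : (1 : Frac α) = mk 1 0 1 one_pos := rfl

instance : CommRing (Frac α) where
  add_assoc x y z := by
    induction x using ind; induction y using ind; induction z using ind
    simp only [add_mk, mk_eq]; ring
  zero_add x := by induction x using ind; simp only [add_mk, zero_def, mk_eq]; ring
  add_zero x := by induction x using ind; simp only [add_mk, zero_def, mk_eq]; ring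
  add_comm x y := by
    induction x using ind; induction y using ind
    simp only [add_mk, mk_eq]; ring
  mul_assoc x y z := by
    induction x using ind; induction y using ind; induction z using ind
    simp only [mul_mk, mk_eq]; ring
  one_mul x := by induction x using ind; simp only [mul_mk, one_def, mk_eq]; ring
  mul_one x := by induction x using ind; simp only [mul_mk, one_def, mk_eq]; ring
  mul_comm x y := by
    induction x using ind; induction y using ind
    simp only [mul_mk, mk_eq]; ring
  left_distrib x y z := by
    induction x using ind; induction y using ind; induction z using ind
    simp only [mul_mk, add_mk, mk_eq]; ring
  right_distrib x y z := by
    induction x using ind; induction y using ind; induction z using ind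
    simp only [mul_mk, add_mk, mk_eq]; ring
  zero_mul x := by induction x using ind; simp only [mul_mk, zero_def, mk_eq]; ring
  mul_zero x := by induction x using ind; simp only [mul_mk, zero_def, mk_eq]; ring
  neg_add_cancel x := by
    induction x using ind; simp only [neg_mk, add_mk, zero_def, mk_eq]; ring
  nsmul := nsmulRec
  zsmul := zsmulRec

/-- Nonnegative fractions. -/
def Nonneg (x : Frac α) : Prop := ∃ c d h, x = mk c 0 d h

theorem nonneg_add {x y : Frac α} : x.Nonneg → y.Nonneg → (x + y).Nonneg := by
  rintro ⟨c, d, h, rfl⟩ ⟨c', d', h', rfl⟩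
  exact ⟨c * d' + c' * d, d * d', mul_pos h h', by rw [add_mk]; simp only [zero_mul, add_zero]⟩

theorem nonneg_mul {x y : Frac α} : x.Nonneg → y.Nonneg → (x * y).Nonneg := by
  rintro ⟨c, d, h, rfl⟩ ⟨c', d', h', rfl⟩
  exact ⟨c * c', d * d', mul_pos h h', by rw [mul_mk]; simp only [zero_mul, mul_zero, add_zero]⟩

/-- In a canonically ordered semiring the larger of `p` and `m` is the smaller plus some `c`, so one
of the two signs has numerator `c`. -/
theorem nonneg_total (x : Frac α) : x.Nonneg ∨ (-x).Nonneg := by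
  induction x using ind with | h p m d h
  rcases le_total m p with hh | hh <;> obtain ⟨c, rfl⟩ := exists_add_of_le hh
  · exact .inl ⟨c, d, h, by rw [mk_eq]; ring⟩
  · exact .inr ⟨c, d, h, by rw [neg_mk, mk_eq]; ring⟩

theorem eq_zero_of_nonneg {x : Frac α} : x.Nonneg → (-x).Nonneg → x = 0 := by
  rintro ⟨c, d, h, rfl⟩ ⟨c', d', h', e⟩
  rw [neg_mk, mk_eq] at e
  have : c = 0 := by
    have h1 : c' * d + c * d' = 0 := by rw [← e]; ring
    have h2 : c * d' = 0 := (add_eq_zero.1 h1).2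
    exact (mul_eq_zero.1 h2).resolve_right h'.ne'
  subst this
  rw [zero_def, mk_eq]; ring

open Classical in
noncomputable instance : LinearOrder (Frac α) where
  le x y := (y - x).Nonneg
  le_refl x := ⟨0, 1, one_pos, by rw [sub_self]; rfl⟩
  le_trans x y z h h' := by
    have := nonneg_add h h'
    rwa [show y - x + (z - y) = z - x by ring] at this
  le_antisymm x y h h' := by
    have := eq_zero_of_nonneg h' (by rwa [neg_sub])
    exact sub_eq_zero.1 this
  le_total x y := by
    have := nonneg_total (y - x)
    rwa [neg_sub] at this
  toDecidableLE := Classical.decRel _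

theorem le_def {x y : Frac α} : x ≤ y ↔ (y - x).Nonneg := Iff.rfl

instance : IsOrderedAddMonoid (Frac α) where
  add_le_add_left x y h z := by
    rw [le_def] at h ⊢
    rwa [show y + z - (x + z) = y - x by ring]

instance : Nontrivial (Frac α) :=
  ⟨⟨0, 1, by rw [zero_def, one_def, Ne, mk_eq]; simp⟩⟩

theorem exists_inv {x : Frac α} (hx : x ≠ 0) : ∃ y, x * y = 1 := by
  induction x using ind with | h p m d h
  rcases lt_trichotomy m p with hh | rfl | hh
  · obtain ⟨c, rfl⟩ := exists_add_of_le hh.le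
    have hc : 0 < c := by simpa using hh
    exact ⟨mk d 0 c hc, by rw [mul_mk, one_def, mk_eq]; ring⟩
  · exact (hx (by rw [zero_def, mk_eq]; ring)).elim
  · obtain ⟨c, rfl⟩ := exists_add_of_le hh.le
    have hc : 0 < c := by simpa using hh
    exact ⟨mk 0 d c hc, by rw [mul_mk, one_def, mk_eq]; ring⟩

open Classical in
noncomputable instance : Field (Frac α) where
  inv x := if h : x = 0 then 0 else (exists_inv h).choose
  mul_inv_cancel x hx := by
    change x * (dite _ _ _) = 1
    rw [dif_neg hx]; exact (exists_inv hx).choose_spec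
  inv_zero := dif_pos rfl
  nnqsmul := _
  qsmul := _

instance : IsStrictOrderedRing (Frac α) :=
  haveI : ZeroLEOneClass (Frac α) := ⟨⟨1, 1, one_pos, by rw [sub_zero]; rfl⟩⟩
  .of_mul_pos fun x y hx hy => by
    have h : (x * y - 0).Nonneg := by
      rw [sub_zero]
      refine nonneg_mul ?_ ?_
      · simpa using le_def.1 hx.le
      · simpa using le_def.1 hy.le
    exact lt_of_le_of_ne (le_def.2 h) (mul_ne_zero hx.ne' hy.ne').symm

/-- The embedding of the semiring. -/
def of : α →+* Frac α where
  toFun a := mk a 0 1 one_pos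
  map_zero' := rfl
  map_one' := rfl
  map_add' a b := by rw [add_mk, mk_eq]; ring
  map_mul' a b := by rw [mul_mk, mk_eq]; ring

theorem of_nonneg (a : α) : 0 ≤ of a := le_def.2 ⟨a, 1, one_pos, by rw [sub_zero]; rfl⟩

theorem of_injective : Function.Injective (of : α → Frac α) := fun a b h => by
  have := mk_eq.1 h
  simpa using this

theorem of_strictMono : StrictMono (of : α → Frac α) := fun a b h => by
  obtain ⟨c, rfl⟩ := exists_add_of_le h.le
  have hc : (of c : Frac α) ≠ 0 := by
    rw [← map_zero of]
    exact fun e => by rw [of_injective e] at h; simp at h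
  rw [map_add]
  exact lt_add_of_pos_right _ (lt_of_le_of_ne (of_nonneg c) hc.symm)

theorem exists_eq (x : Frac α) : ∃ p m d : α, 0 < d ∧ x = (of p - of m) / of d := by
  induction x using ind with | h p m d h
  refine ⟨p, m, d, h, ?_⟩
  have hd : (of d : Frac α) ≠ 0 := by
    have := of_strictMono h; rw [map_zero] at this; exact this.ne'
  rw [eq_div_iff hd, sub_eq_add_neg]
  change mk _ _ _ _ * mk _ _ _ _ = mk _ _ _ _ + -mk _ _ _ _
  rw [neg_mk, mul_mk, add_mk, mk_eq]; ring

end Frac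

end Fractions

namespace Model

/-! ### Arithmetic in a model -/

/-- The natural numbers of a model. -/
abbrev N (M : Model) : Type := M.C Ty.nat

/-! ### Arithmetic operations and their recursion equations -/

section Operations

variable {M : Model}

def add (a b : M.N) : M.N := M.R ◃ b ◃ a ◃ ev nil (Tm.lam (Tm.lam (.succ ⬝ v1)))
def mul (a b : M.N) : M.N := M.R ◃ b ◃ M.zero ◃ ev (a ◂ nil) (Tm.lam (Tm.lam (Tm.add v1 v2)))
def pred (a : M.N) : M.N := M.R ◃ a ◃ M.zero ◃ ev nil (Tm.lam (Tm.lam v0))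
def sub (a b : M.N) : M.N := M.R ◃ b ◃ a ◃ ev nil (Tm.lam (Tm.lam (Tm.pred v1)))
def pow2 (a : M.N) : M.N := M.R ◃ a ◃ (M.succ ◃ M.zero) ◃ ev nil (Tm.lam (Tm.lam (Tm.add v1 v1)))

instance : Zero M.N := ⟨M.zero⟩
instance : One M.N := ⟨M.succ ◃ M.zero⟩
instance : Add M.N := ⟨add⟩
instance : Mul M.N := ⟨mul⟩

theorem ext₂ {ρ σ τ : Ty} {f g : M.C (ρ ⇾ σ ⇾ τ)} (h : ∀ x y, f ◃ x ◃ y = g ◃ x ◃ y) : f = g :=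
  M.ext fun x => M.ext fun y => h x y

variable {Γ : List Ty} (e : M.Env Γ)

@[simp] theorem zero_eq : M.zero = 0 := rfl

@[simp] theorem ev_tone : ev e tone = 1 := rfl

@[simp] theorem ev_add (s t : Tm Γ Ty.nat) : ev e (s.add t) = ev e s + ev e t := by
  change _ = add _ _
  rw [add, Tm.add, ev_app, ev_app, ev_app]
  congr 1

@[simp] theorem ev_mul (s t : Tm Γ Ty.nat) : ev e (s.mul t) = ev e s * ev e t := by
  change _ = mul _ _
  rw [mul, Tm.mul, ev_app, ev_app, ev_app]
  congr 1
  -- `Tm.mul` abstracts over a compound term and `mul` over a variable. The resulting combinator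
  -- terms differ, and extensionality identifies their values.
  exact ext₂ fun x y => by simp

@[simp] theorem ev_pred (t : Tm Γ Ty.nat) : ev e (t.pred) = pred (ev e t) := by
  rw [pred, Tm.pred, ev_app, ev_app, ev_app]
  congr 1

@[simp] theorem ev_sub (s t : Tm Γ Ty.nat) : ev e (s.sub t) = sub (ev e s) (ev e t) := by
  rw [sub, Tm.sub, ev_app, ev_app, ev_app]
  congr 1

@[simp] theorem ev_pow2 (t : Tm Γ Ty.nat) : ev e (t.pow2) = pow2 (ev e t) := by
  rw [pow2, Tm.pow2, ev_app, ev_app, ev_app]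
  congr 1

theorem R_zero' (a : M.N) (b) : M.R ◃ 0 ◃ a ◃ b = a := M.R_zero a b

theorem add_succ' (a b : M.N) : a + M.succ ◃ b = M.succ ◃ (a + b) := by
  change add _ _ = M.succ ◃ add _ _
  rw [add, M.R_succ]
  simp [add]

theorem add_zero' (a : M.N) : a + 0 = a := R_zero' _ _

@[simp] theorem succ_eq (a : M.N) : M.succ ◃ a = a + 1 := by
  rw [show (1 : M.N) = M.succ ◃ 0 from rfl, add_succ', add_zero']

theorem R_succ' (n a : M.N) (b) : M.R ◃ (n + 1) ◃ a ◃ b = b ◃ (M.R ◃ n ◃ a ◃ b) ◃ n := by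
  rw [← succ_eq, M.R_succ]

attribute [simp] R_zero' R_succ'

theorem add_one_assoc (a b : M.N) : a + (b + 1) = (a + b) + 1 := by
  simpa using add_succ' a b

theorem mul_zero' (a : M.N) : a * 0 = 0 := by
  change mul _ _ = _
  simp [mul]

theorem mul_succ' (a b : M.N) : a * (b + 1) = a * b + a := by
  change mul _ _ = mul _ _ + _
  simp [mul]

@[simp] theorem pred_zero : pred (0 : M.N) = 0 := by simp [pred]
@[simp] theorem pred_succ (a : M.N) : pred (a + 1) = a := by simp [pred]
@[simp] theorem sub_zero' (a : M.N) : sub a 0 = a := by simp [sub]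
theorem sub_succ' (a b : M.N) : sub a (b + 1) = pred (sub a b) := by simp [sub]
@[simp] theorem pow2_zero : pow2 (0 : M.N) = 1 := R_zero' _ _
theorem pow2_succ (a : M.N) : pow2 (a + 1) = pow2 a + pow2 a := by simp [pow2]

theorem add_one_ne_zero (a : M.N) : a + 1 ≠ 0 := by
  rw [← succ_eq]; exact M.succ_ne_zero a

theorem add_one_inj {a b : M.N} (h : a + 1 = b + 1) : a = b := by
  rw [← succ_eq, ← succ_eq] at h; exact M.succ_inj h

end Operations

/-! ### The ordered semiring of numbers, by quantifier-free induction -/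

section Semiring

variable {M : Model} [hM : Fact M.RCA]

/-- Induction applies to a predicate once a quantifier-free formula defining it, with parameters in
`e`, is exhibited. Existential statements below are proved by first naming a witness by a term. -/
theorem ind {Γ : List Ty} (φ : Fm (Ty.nat :: Γ)) (hq : φ.QF) (e : M.Env Γ) {P : M.N → Prop}
    (hP : ∀ n, Sat (n ◂ e) φ ↔ P n) (h0 : P 0) (hS : ∀ n, P n → P (n + 1)) (n : M.N) : P n := by
  rw [← hP]
  refine hM.out.induction φ hq e ((hP _).2 h0) (fun n h => ?_) n
  rw [succ_eq, hP]; exact hS n ((hP n).1 h)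

theorem zero_add' (a : M.N) : 0 + a = a := by
  refine ind (P := fun n => 0 + n = n) (Tm.add .zero v0 ≐ v0) (by simp [Fm.QF]) nil (fun n => by simp)
    (by exact add_zero' 0) (fun n h => ?_) a
  rw [add_one_assoc, h]

theorem succ_add' (a b : M.N) : (a + 1) + b = (a + b) + 1 := by
  refine ind (Tm.add (Tm.add v1 tone) v0 ≐ Tm.add (Tm.add v1 v0) tone) (by simp [Fm.QF])
    (a ◂ nil) (fun n => by simp; rfl) (by simp only [add_zero']) (fun n h => ?_) b
  rw [add_one_assoc, h, add_one_assoc]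

theorem add_comm' (a b : M.N) : a + b = b + a := by
  refine ind (Tm.add v1 v0 ≐ Tm.add v0 v1) (by simp [Fm.QF])
    (a ◂ nil) (fun n => by simp; rfl) (by rw [add_zero', zero_add']) (fun n h => ?_) b
  rw [add_one_assoc, h, succ_add']

theorem add_assoc' (a b c : M.N) : a + b + c = a + (b + c) := by
  refine ind (Tm.add (Tm.add v1 v2) v0 ≐ Tm.add v1 (Tm.add v2 v0)) (by simp [Fm.QF])
    (a ◂ b ◂ nil) (fun n => by simp; rfl) (by simp only [add_zero']) (fun n h => ?_) c
  rw [add_one_assoc, h, add_one_assoc, add_one_assoc]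

instance : AddCommMonoid M.N where
  add_assoc := add_assoc'
  zero_add := zero_add'
  add_zero := add_zero'
  add_comm := add_comm'
  nsmul := nsmulRec

theorem zero_mul' (a : M.N) : 0 * a = 0 := by
  refine ind (Tm.mul .zero v0 ≐ .zero) (by simp [Fm.QF]) nil (fun n => by simp; rfl)
    (by exact mul_zero' 0) (fun n h => ?_) a
  rw [mul_succ', h, add_zero]

theorem succ_mul' (a b : M.N) : (a + 1) * b = a * b + b := by
  refine ind (Tm.mul (Tm.add v1 tone) v0 ≐ Tm.add (Tm.mul v1 v0) v0) (by simp [Fm.QF])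
    (a ◂ nil) (fun n => by simp; rfl) (by simp only [mul_zero', add_zero]) (fun n h => ?_) b
  rw [mul_succ', h, mul_succ', add_assoc, add_assoc, add_left_comm n a 1]

theorem mul_comm' (a b : M.N) : a * b = b * a := by
  refine ind (Tm.mul v1 v0 ≐ Tm.mul v0 v1) (by simp [Fm.QF])
    (a ◂ nil) (fun n => by simp; rfl) (by rw [mul_zero', zero_mul']) (fun n h => ?_) b
  rw [mul_succ', h, succ_mul']

theorem mul_add' (a b c : M.N) : a * (b + c) = a * b + a * c := by
  refine ind (Tm.mul v1 (Tm.add v2 v0) ≐ Tm.add (Tm.mul v1 v2) (Tm.mul v1 v0)) (by simp [Fm.QF])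
    (a ◂ b ◂ nil) (fun n => by simp; rfl) (by simp only [mul_zero', add_zero]) (fun n h => ?_) c
  rw [add_one_assoc, mul_succ', h, mul_succ', add_assoc]

theorem mul_assoc' (a b c : M.N) : a * b * c = a * (b * c) := by
  refine ind (Tm.mul (Tm.mul v1 v2) v0 ≐ Tm.mul v1 (Tm.mul v2 v0)) (by simp [Fm.QF])
    (a ◂ b ◂ nil) (fun n => by simp; rfl) (by simp only [mul_zero']) (fun n h => ?_) c
  rw [mul_succ', h, mul_succ', mul_add']

theorem one_mul' (a : M.N) : 1 * a = a := by
  have := succ_mul' 0 a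
  rwa [zero_add, zero_mul', zero_add] at this

instance : CommSemiring M.N where
  mul_assoc := mul_assoc'
  one_mul := one_mul'
  mul_one a := by rw [mul_comm', one_mul']
  mul_comm := mul_comm'
  left_distrib := mul_add'
  right_distrib a b c := by rw [mul_comm', mul_add', mul_comm', mul_comm' c]
  zero_mul := zero_mul'
  mul_zero := mul_zero'

theorem eq_zero_or_succ (a : M.N) : a = 0 ∨ ∃ b, a = b + 1 := by
  have : a = 0 ∨ a = pred a + 1 := by
    refine ind (v0 ≐ .zero ⋎ v0 ≐ .succ ⬝ Tm.pred v0) (by simp [Fm.QF, Fm.or, Fm.neg]) nil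
      (fun n => by simp; rfl) (Or.inl rfl) (fun n _ => ?_) a
    right; simp
  exact this.imp_right fun h => ⟨_, h⟩

theorem add_right_cancel' {a b c : M.N} : a + c = b + c → a = b := by
  refine ind (Tm.add v1 v0 ≐ Tm.add v2 v0 ⇛ v1 ≐ v2) (by simp [Fm.QF]) (a ◂ b ◂ nil)
    (fun n => by simp; rfl) (by simp) (fun n h hh => ?_) c
  exact h (add_one_inj (by rwa [add_assoc, add_assoc]))

theorem eq_zero_of_add {a b : M.N} (h : a + b = 0) : a = 0 := by
  rcases eq_zero_or_succ b with rfl | ⟨c, rfl⟩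
  · simpa using h
  · rw [← add_assoc] at h; exact (add_one_ne_zero _ h).elim

theorem sub_succ_succ (a b : M.N) : sub (a + 1) (b + 1) = sub a b := by
  refine ind (Tm.sub (Tm.add v1 tone) (Tm.add v0 tone) ≐ Tm.sub v1 v0) (by simp [Fm.QF]) (a ◂ nil)
    (fun n => by simp; rfl) (by have := sub_succ' (a + 1) 0; simpa using this) (fun n h => ?_) b
  rw [sub_succ', h, sub_succ']

theorem sub_add (a b : M.N) : sub (b + a) a = b := by
  refine ind (Tm.sub (Tm.add v1 v0) v0 ≐ v1) (by simp [Fm.QF]) (b ◂ nil)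
    (fun n => by simp; rfl) (by simp) (fun n h => ?_) a
  rw [← add_assoc, sub_succ_succ, h]

theorem zero_sub' (a : M.N) : sub 0 a = 0 := by
  refine ind (Tm.sub .zero v0 ≐ .zero) (by simp [Fm.QF]) nil
    (fun n => by simp; rfl) (by simp) (fun n h => ?_) a
  rw [sub_succ', h, pred_zero]

theorem sub_of_add (a b : M.N) : sub a (b + a) = 0 := by
  refine ind (Tm.sub v0 (Tm.add v1 v0) ≐ .zero) (by simp [Fm.QF]) (b ◂ nil)
    (fun n => by simp; rfl) (by simp [zero_sub']) (fun n h => ?_) a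
  rw [← add_assoc, sub_succ_succ, h]

/-- Truncated subtraction names the witness for comparability, so totality of the order becomes a
quantifier-free disjunction and is accessible to induction. -/
theorem add_sub_total (a b : M.N) : a + sub b a = b ∨ b + sub a b = a := by
  refine ind (Tm.add v1 (Tm.sub v0 v1) ≐ v0 ⋎ Tm.add v0 (Tm.sub v1 v0) ≐ v1)
    (by simp [Fm.QF, Fm.or, Fm.neg]) (a ◂ nil) (fun n => by simp; rfl) (by simp)
    (fun n h => ?_) b
  have key : ∀ c : M.N, a + sub (a + c) a = a + c := fun c => by rw [add_comm a c, sub_add, add_comm]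
  rcases h with h | h
  · left; rw [← h, add_assoc]; exact key _
  · rcases eq_zero_or_succ (sub a n) with h0 | ⟨c, hc⟩
    · left; rw [h0, add_zero] at h; rw [h]; exact key 1
    · right
      rw [hc, add_comm c, ← add_assoc] at h
      rw [← h, add_comm (n + 1) c, sub_add, add_comm]

theorem sub_eq_zero_iff {a b : M.N} : sub a b = 0 ↔ ∃ c, b = a + c := by
  constructor
  · intro h
    rcases add_sub_total a b with h' | h'
    · exact ⟨_, h'.symm⟩
    · rw [h, add_zero] at h'; exact ⟨0, by rw [h', add_zero]⟩
  · rintro ⟨c, rfl⟩; rw [add_comm]; exact sub_of_add _ _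

open Classical in
noncomputable instance : LinearOrder M.N where
  le a b := ∃ c, b = a + c
  le_refl a := ⟨0, (add_zero a).symm⟩
  le_trans := by
    rintro a b c ⟨d, rfl⟩ ⟨f, rfl⟩
    exact ⟨_, add_assoc _ _ _⟩
  le_antisymm := by
    rintro a b ⟨c, rfl⟩ ⟨d, h⟩
    have : c = 0 := by
      rw [add_assoc] at h
      have h1 : 0 + a = (c + d) + a := by rw [zero_add, add_comm]; exact h
      exact eq_zero_of_add (add_right_cancel' h1).symm
    rw [this, add_zero]
  le_total a b := (add_sub_total a b).imp (fun h => ⟨_, h.symm⟩) (fun h => ⟨_, h.symm⟩)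
  toDecidableLE := Classical.decRel _

theorem sub_eq_zero_iff_le {a b : M.N} : sub a b = 0 ↔ a ≤ b := sub_eq_zero_iff

theorem add_one_le_iff {a b : M.N} : a + 1 ≤ b ↔ a < b := by
  rw [lt_iff_le_and_ne]
  constructor
  · rintro ⟨c, rfl⟩
    refine ⟨⟨1 + c, add_assoc _ _ _⟩, fun h => ?_⟩
    have h1 : 0 + a = (c + 1) + a := by rw [zero_add, add_comm, add_comm c, ← add_assoc]; exact h
    exact add_one_ne_zero c (add_right_cancel' h1).symm
  · rintro ⟨⟨c, rfl⟩, h⟩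
    rcases eq_zero_or_succ c with rfl | ⟨d, rfl⟩
    · simp at h
    · exact ⟨d, by rw [add_assoc, add_comm 1 d]⟩

instance : CanonicallyOrderedAdd M.N where
  exists_add_of_le h := h
  le_add_self _ b := ⟨b, add_comm _ _⟩
  le_self_add _ b := ⟨b, rfl⟩

instance : IsOrderedCancelAddMonoid M.N where
  add_le_add_left := by
    rintro a b ⟨c, rfl⟩ d
    exact ⟨c, by rw [add_right_comm]⟩
  le_of_add_le_add_left := by
    rintro a b c ⟨d, h⟩
    exact ⟨d, add_right_cancel' (c := a) (by rw [add_comm, h, add_assoc, add_comm])⟩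

instance : Nontrivial M.N := ⟨⟨0, 0 + 1, (add_one_ne_zero 0).symm⟩⟩

theorem mul_lt_mul_left' {a b c : M.N} (hc : 0 < c) (h : a < b) : c * a < c * b := by
  obtain ⟨d, rfl⟩ := add_one_le_iff.2 h
  obtain ⟨f, rfl⟩ := add_one_le_iff.2 hc
  -- Here `c = 0 + 1 + f` and `b = a + 1 + d`, so that `c * b = c * a + 1 + (f + c * d)`.
  refine add_one_le_iff.1 ⟨f + (0 + 1 + f) * d, ?_⟩
  ring

instance : IsStrictOrderedRing M.N where
  zero_le_one := zero_le
  mul_lt_mul_of_pos_left _ hc _ _ h := mul_lt_mul_left' hc h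
  mul_lt_mul_of_pos_right _ hc _ _ h := by
    simpa only [mul_comm] using mul_lt_mul_left' hc h

theorem pow2_pos (a : M.N) : 0 < pow2 a := by
  have : pow2 a ≠ 0 := by
    refine ind (Fm.neg (Tm.pow2 v0 ≐ .zero)) (by simp [Fm.QF, Fm.neg]) nil
      (fun n => by simp; rfl) (by simp) (fun n h => ?_) a
    rw [pow2_succ]; exact fun h' => h (eq_zero_of_add h')
  exact pos_iff_ne_zero.2 this

theorem lt_pow2 (a : M.N) : a + 1 ≤ pow2 a := by
  refine ind (natLe (Tm.add v0 tone) (Tm.pow2 v0)) (by simp [Fm.QF, natLe]) nil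
      (fun n => by simp [natLe, sub_eq_zero_iff_le]; rfl) (by simp) (fun n h => ?_) a
  rw [pow2_succ]
  exact add_le_add h (le_trans (by rw [add_comm]; exact ⟨n, rfl⟩) h)

@[simp] theorem sat_natLe {Γ : List Ty} (e : M.Env Γ) (s t : Tm Γ Ty.nat) :
    Sat e (natLe s t) ↔ ev e s ≤ ev e t := by
  simp [natLe, sub_eq_zero_iff_le]

@[simp] theorem sat_natLt {Γ : List Ty} (e : M.Env Γ) (s t : Tm Γ Ty.nat) :
    Sat e (natLt s t) ↔ ev e s < ev e t := by
  simp [natLt, add_one_le_iff]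

end Semiring

section Reals

variable {M : Model} [hM : Fact M.RCA]

/-! ### Rational numbers of a model -/

/-- The rational numbers of a model. -/
def Q (M : Model) [Fact M.RCA] : Type := Frac M.N

noncomputable instance : Field M.Q := inferInstanceAs (Field (Frac M.N))
noncomputable instance : LinearOrder M.Q := inferInstanceAs (LinearOrder (Frac M.N))
instance : IsStrictOrderedRing M.Q := inferInstanceAs (IsStrictOrderedRing (Frac M.N))
instance : IsOrderedRing M.Q := inferInstance
instance : IsOrderedAddMonoid M.Q := inferInstance
noncomputable instance : CommRing M.Q := inferInstance
instance : ZeroLEOneClass M.Q := inferInstance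
noncomputable instance : Semiring M.Q := inferInstance
noncomputable instance : PartialOrder M.Q := inferInstance
noncomputable instance : Preorder M.Q := inferInstance
noncomputable instance : LE M.Q := inferInstance
noncomputable instance : LT M.Q := inferInstance

/-- The embedding of the natural numbers into the rationals. -/
noncomputable def ι : M.N →+* M.Q := Frac.of

theorem ι_nonneg (a : M.N) : 0 ≤ ι a := Frac.of_nonneg a

theorem exists_eq_div (x : M.Q) : ∃ p m d : M.N, 0 < d ∧ x = (ι p - ι m) / ι d := Frac.exists_eq x

theorem ι_le {a b : M.N} : ι a ≤ ι b ↔ a ≤ b := (Frac.of_strictMono (α := M.N)).le_iff_le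

theorem ι_lt {a b : M.N} : ι a < ι b ↔ a < b := (Frac.of_strictMono (α := M.N)).lt_iff_lt

theorem ι_pos {a : M.N} : 0 < ι a ↔ 0 < a := by rw [← ι_lt, map_zero]

/-- The rational number `2 ^ (-n)`. -/
noncomputable def ε (n : M.N) : M.Q := (ι (pow2 n))⁻¹

theorem ε_pos (n : M.N) : 0 < ε n := inv_pos.2 (ι_pos.2 (pow2_pos n))

@[simp] theorem ε_zero : ε (0 : M.N) = 1 := by simp [ε]

theorem ε_succ (n : M.N) : ε (n + 1) = ε n / 2 := by
  rw [ε, ε, pow2_succ, map_add, ← two_mul, mul_inv]; ring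

theorem ε_add_le (m n : M.N) : ε (m + n) ≤ ε m := by
  unfold ε
  have h := ι_pos.2 (pow2_pos m)
  refine inv_anti₀ h (ι_le.2 ?_)
  refine ind (natLe (Tm.pow2 v1) (Tm.pow2 (Tm.add v1 v0))) (by simp [Fm.QF, natLe]) (m ◂ nil)
    (fun n => by simp; rfl) (by simp) (fun n h => ?_) n
  rw [← add_assoc, pow2_succ]
  exact h.trans ⟨_, rfl⟩

theorem ε_anti {m n : M.N} (h : m ≤ n) : ε n ≤ ε m := by
  obtain ⟨k, rfl⟩ := h
  exact ε_add_le m k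

theorem exists_natCast_gt (x : M.Q) : ∃ n : M.N, x < ι n := by
  obtain ⟨p, m, d, hd, rfl⟩ := exists_eq_div x
  -- Since `d` is at least `1`, the fraction is at most `p`.
  refine ⟨p + 1, ?_⟩
  have hd' : 1 ≤ ι d := by
    rw [← map_one ι, ι_le]
    have := add_one_le_iff.2 hd
    rwa [zero_add] at this
  rw [div_lt_iff₀ (by linarith), map_add, map_one]
  have h1 := ι_nonneg p
  have h2 := ι_nonneg m
  nlinarith

theorem exists_ε_lt {δ : M.Q} (h : 0 < δ) : ∃ n, ε n < δ := by
  obtain ⟨n, hn⟩ := exists_natCast_gt δ⁻¹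
  refine ⟨n, ?_⟩
  rw [ε]
  refine inv_lt_of_inv_lt₀ h (hn.trans_le (ι_le.2 ?_))
  exact le_trans ⟨1, rfl⟩ (lt_pow2 n)

/-- The field is archimedean with respect to the numbers of the model, standard or not, so
arbitrarily small internal errors can be dropped. -/
theorem le_of_forall_ε {a b : M.Q} (c : M.Q) (hc : 0 < c) (h : ∀ n, a ≤ b + c * ε n) : a ≤ b := by
  by_contra hn
  push Not at hn
  obtain ⟨n, hn'⟩ := exists_ε_lt (δ := (a - b) / c) (div_pos (by linarith) hc)
  rw [lt_div_iff₀ hc] at hn'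
  linarith [h n]

/-! ### Terms for rational numbers -/

section

variable {Γ : List Ty} (e : M.Env Γ)

@[simp] theorem ev_ttwo : ev e ttwo = 2 := by
  simp [ttwo, one_add_one_eq_two]

@[simp] theorem ev_tthree : ev e tthree = 3 := by
  simp [tthree, two_add_one_eq_three]

/-- The value of a rational number. -/
noncomputable def rv (q : Rat' Γ) : M.Q := (ι (ev e q.p) - ι (ev e q.m)) / ι (ev e q.d)

/-- A term that vanishes if and only if `q ≤ r`. -/
def _root_.HORM.Rat'.leTm (q r : Rat' Γ) : Tm Γ Ty.nat :=
  ((q.p.mul r.d).add (r.m.mul q.d)).sub ((q.m.mul r.d).add (r.p.mul q.d))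

theorem ev_leTm {q r : Rat' Γ} (hq : 0 < ev e q.d) (hr : 0 < ev e r.d) :
    ev e (q.leTm r) = 0 ↔ rv e q ≤ rv e r := by
  have h1 := ι_pos.2 hq
  have h2 := ι_pos.2 hr
  rw [Rat'.leTm, ev_sub, sub_eq_zero_iff_le, ← ι_le, rv, rv, div_le_div_iff₀ h1 h2]
  simp only [ev_add, ev_mul, map_add, map_mul]
  constructor <;> intro h <;> linarith

theorem sat_ratLe {q r : Rat' Γ} (hq : 0 < ev e q.d) (hr : 0 < ev e r.d) :
    Sat e (q.le r) ↔ rv e q ≤ rv e r := by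
  rw [← ev_leTm e hq hr, Rat'.le, sat_natLe, Rat'.leTm, ev_sub, sub_eq_zero_iff_le]

theorem rv_add {q r : Rat' Γ} (hq : 0 < ev e q.d) (hr : 0 < ev e r.d) :
    rv e (q.add r) = rv e q + rv e r := by
  have h1 := (ι_pos.2 hq).ne'
  have h2 := (ι_pos.2 hr).ne'
  simp only [rv, Rat'.add, ev_add, ev_mul, map_add, map_mul]
  field_simp
  ring

theorem d_add_pos {q r : Rat' Γ} (hq : 0 < ev e q.d) (hr : 0 < ev e r.d) :
    0 < ev e (q.add r).d := by
  simp only [Rat'.add, ev_mul]; exact mul_pos hq hr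

theorem d_dyadic_pos (a n : Tm Γ Ty.nat) : 0 < ev e (Rat'.dyadic a n).d := by
  simp only [Rat'.dyadic, ev_pow2]; exact pow2_pos _

theorem rv_dyadic (a n : Tm Γ Ty.nat) : rv e (Rat'.dyadic a n) = ι (ev e a) * ε (ev e n) := by
  simp [rv, Rat'.dyadic, ε, div_eq_mul_inv]

theorem rv_zero : rv e Rat'.zero = 0 := by simp [rv, Rat'.zero]

theorem rv_one : rv e Rat'.one = 1 := by simp [rv, Rat'.one]

theorem d_approx_pos (x : Tm Γ one) (n : Tm Γ Ty.nat) : 0 < ev e (approx x n).d := by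
  simp only [approx, ev_app, ev_succ, succ_eq]
  exact lt_of_lt_of_le zero_lt_one ⟨_, add_comm _ _⟩

end

/-- The `n`-th rational approximation coded by `x`. -/
noncomputable def q (x : M.C one) (n : M.N) : M.Q :=
  (ι (x ◃ (3 * n)) - ι (x ◃ (3 * n + 1))) / (ι (x ◃ (3 * n + 1 + 1)) + 1)

theorem rv_approx {Γ : List Ty} (e : M.Env Γ) (x : Tm Γ one) (n : Tm Γ Ty.nat) :
    rv e (approx x n) = q (ev e x) (ev e n) := by
  simp [rv, approx, q]

/-! ### Real numbers of a model -/

def IsReal (x : M.C one) : Prop := ∀ n i, q x n ≤ q x (n + i) + ε n ∧ q x (n + i) ≤ q x n + ε n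

/-- `x - y ≤ c`. -/
def Le (x y : M.C one) (c : M.Q) : Prop := ∀ n, q x n - q y n ≤ c + 2 * ε n

/-- Equality of reals. -/
def REq (x y : M.C one) : Prop := Le x y 0 ∧ Le y x 0

/-- `|x - y| < 2 ^ (-k)`. -/
def Near (x y : M.C one) (k : M.N) : Prop := ¬ Le x y (-ε k) ∧ ¬ Le y x (-ε k)

/-- The reals in the unit interval. -/
def Unit (x : M.C one) : Prop := IsReal x ∧ ∀ n, 0 ≤ q x n + ε n ∧ q x n ≤ 1 + ε n

def UnitFun (f : M.C (one ⇾ one)) : Prop :=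
  (∀ x, Unit x → IsReal (f ◃ x)) ∧ ∀ x y, Unit x → Unit y → REq x y → REq (f ◃ x) (f ◃ y)

section

variable {Γ : List Ty} (e : M.Env Γ)

@[simp] theorem sat_isReal (x : Tm Γ one) : Sat e (isReal x) ↔ IsReal (ev e x) := by
  simp only [isReal, sat_all, sat_and, IsReal]
  refine forall_congr' fun n => forall_congr' fun i => ?_
  rw [sat_ratLe _ (d_approx_pos _ _ _) (d_add_pos _ (d_approx_pos _ _ _) (d_dyadic_pos _ _ _)),
    sat_ratLe _ (d_approx_pos _ _ _) (d_add_pos _ (d_approx_pos _ _ _) (d_dyadic_pos _ _ _)),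
    rv_add _ (d_approx_pos _ _ _) (d_dyadic_pos _ _ _),
    rv_add _ (d_approx_pos _ _ _) (d_dyadic_pos _ _ _)]
  simp [rv_approx, rv_dyadic]

@[simp] theorem sat_realLe (x y : Tm Γ one) : Sat e (realLe x y) ↔ Le (ev e x) (ev e y) 0 := by
  simp only [realLe, sat_all, Le]
  refine forall_congr' fun n => ?_
  rw [sat_ratLe _ (d_approx_pos _ _ _) (d_add_pos _ (d_approx_pos _ _ _) (d_dyadic_pos _ _ _)),
    rv_add _ (d_approx_pos _ _ _) (d_dyadic_pos _ _ _)]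
  simp only [rv_approx, rv_dyadic, ev_ttwo, ev_wk, ev_var, cons_zero, map_ofNat]
  constructor <;> intro h <;> linarith

@[simp] theorem sat_realLt (x y : Tm Γ one) : Sat e (realLt x y) ↔ ¬ Le (ev e y) (ev e x) 0 := by
  simp [realLt]

@[simp] theorem sat_realEq (x y : Tm Γ one) : Sat e (realEq x y) ↔ REq (ev e x) (ev e y) := by
  simp [realEq, REq]

theorem sat_realGapLe (x y : Tm Γ one) (k : Tm Γ Ty.nat) :
    Sat e (realGapLe x y k) ↔ Le (ev e x) (ev e y) (-ε (ev e k)) := by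
  simp only [realGapLe, sat_all, Le]
  refine forall_congr' fun n => ?_
  rw [sat_ratLe _ (d_add_pos _ (d_approx_pos _ _ _) (d_dyadic_pos _ _ _))
      (d_add_pos _ (d_approx_pos _ _ _) (d_dyadic_pos _ _ _)),
    rv_add _ (d_approx_pos _ _ _) (d_dyadic_pos _ _ _),
    rv_add _ (d_approx_pos _ _ _) (d_dyadic_pos _ _ _)]
  simp only [rv_approx, rv_dyadic, ev_tone, ev_ttwo, ev_wk, ev_var, cons_zero, map_one, map_ofNat]
  constructor <;> intro h <;> linarith

@[simp] theorem sat_near (x y : Tm Γ one) (k : Tm Γ Ty.nat) :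
    Sat e (near x y k) ↔ Near (ev e x) (ev e y) (ev e k) := by
  simp [near, sat_realGapLe, Near]

@[simp] theorem sat_unit (x : Tm Γ one) : Sat e (unit x) ↔ Unit (ev e x) := by
  simp only [unit, sat_all, sat_and, Unit, sat_isReal]
  refine and_congr_right fun _ => forall_congr' fun n => ?_
  have h0 : ∀ {Γ : List Ty} (e : M.Env Γ), 0 < ev e Rat'.zero.d := fun e => by
    simp [Rat'.zero]
  have h1 : ∀ {Γ : List Ty} (e : M.Env Γ), 0 < ev e Rat'.one.d := fun e => by
    simp [Rat'.one]
  rw [sat_ratLe _ (h0 _) (d_add_pos _ (d_approx_pos _ _ _) (d_dyadic_pos _ _ _)),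
    sat_ratLe _ (d_approx_pos _ _ _) (d_add_pos _ (h1 _) (d_dyadic_pos _ _ _)),
    rv_add _ (d_approx_pos _ _ _) (d_dyadic_pos _ _ _), rv_add _ (h1 _) (d_dyadic_pos _ _ _)]
  simp [rv_approx, rv_dyadic, rv_zero, rv_one]

@[simp] theorem sat_unitFun (f : Tm Γ (one ⇾ one)) : Sat e (unitFun f) ↔ UnitFun (ev e f) := by
  simp [unitFun, UnitFun]

end

/-! ### Order of the reals -/

theorem IsReal.abs_le {x : M.C one} (h : IsReal x) {m n : M.N} (hmn : m ≤ n) :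
    q x m ≤ q x n + ε m ∧ q x n ≤ q x m + ε m := by
  obtain ⟨i, rfl⟩ := hmn
  exact h m i

/-- Adding the two estimates at index `n` would double the slack. They are added at a later index
`k` instead, where the slack `4 * ε k` vanishes in the limit; moving both ends back to `n` costs `2
* ε n`. -/
theorem Le.trans {x y z : M.C one} {c d : M.Q} (hx : IsReal x) (hz : IsReal z) (h : Le x y c)
    (h' : Le y z d) : Le x z (c + d) := by
  intro n
  refine le_of_forall_ε 4 (by norm_num) fun m => ?_
  have key : ∀ k, n ≤ k → q x n - q z n ≤ c + d + 2 * ε n + 4 * ε k := by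
    intro k hk
    linarith [h k, h' k, (hx.abs_le hk).1, (hz.abs_le hk).2]
  rcases le_total n m with hm | hm
  · exact key m hm
  · linarith [key n le_rfl, ε_anti hm]

theorem Le.mono {x y : M.C one} {c d : M.Q} (h : Le x y c) (hcd : c ≤ d) : Le x y d := fun n =>
  (h n).trans (by linarith)

/-- Going from index `k` to a large index changes each side by at most `ε k`, which is exactly the
slack allowed by `Le`. -/
theorem le_of_eventually {x y : M.C one} {c : M.Q} (hx : IsReal x) (hy : IsReal y) (n : M.N)
    (h : ∀ m, n ≤ m → q x m - q y m ≤ c) : Le x y c := by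
  intro k
  have h1 := h (k + n) ⟨k, add_comm _ _⟩
  have h2 := hx k n
  have h3 := hy k n
  linarith [h2.1, h3.2]

/-- `x - y < c` implies `x - y ≤ d` for some `d < c`. -/
theorem exists_le_of_not_le {x y : M.C one} {c : M.Q} (hx : IsReal x) (hy : IsReal y)
    (h : ¬ Le y x (-c)) : ∃ d, d < c ∧ Le x y d := by
  simp only [Le, not_forall, not_le] at h
  obtain ⟨n, hn⟩ := h
  refine ⟨q x n - q y n + 2 * ε n, by linarith, le_of_eventually hx hy n fun m hm => ?_⟩
  linarith [(hx.abs_le hm).2, (hy.abs_le hm).1]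

theorem not_le_of_le {x y : M.C one} {c d : M.Q} (hd : d < c) (h : Le x y d) :
    ¬ Le y x (-c) := by
  intro h'
  have : c ≤ d := le_of_forall_ε 4 (by norm_num) fun n => by linarith [h n, h' n]
  linarith

theorem REq.refl {x : M.C one} : REq x x :=
  ⟨fun n => by linarith [ε_pos n], fun n => by linarith [ε_pos n]⟩

theorem REq.symm {x y : M.C one} (h : REq x y) : REq y x := ⟨h.2, h.1⟩

theorem REq.trans {x y z : M.C one} (hx : IsReal x) (hz : IsReal z) (h : REq x y) (h' : REq y z) :
    REq x z :=
  ⟨by simpa using h.1.trans hx hz h'.1, by simpa using h'.2.trans hz hx h.2⟩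

/-- A strict inequality of reals leaves room for a rational `d` strictly below the radius, with
which triangle inequalities can be computed. -/
theorem near_iff {x y : M.C one} {k : M.N} (hx : IsReal x) (hy : IsReal y) :
    Near x y k ↔ ∃ d, d < ε k ∧ Le x y d ∧ Le y x d := by
  constructor
  · rintro ⟨h1, h2⟩
    obtain ⟨d, hd, h⟩ := exists_le_of_not_le hx hy h2
    obtain ⟨d', hd', h'⟩ := exists_le_of_not_le hy hx h1
    exact ⟨max d d', max_lt hd hd', h.mono (le_max_left _ _), h'.mono (le_max_right _ _)⟩
  · rintro ⟨d, hd, h1, h2⟩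
    exact ⟨not_le_of_le hd h2, not_le_of_le hd h1⟩

theorem Near.symm {x y : M.C one} {k : M.N} (h : Near x y k) : Near y x k := ⟨h.2, h.1⟩

theorem near_of_approx {x y : M.C one} {k n : M.N} (h1 : q x n - q y n + 2 * ε n < ε k)
    (h2 : q y n - q x n + 2 * ε n < ε k) : Near x y k :=
  ⟨fun h => by linarith [h n], fun h => by linarith [h n]⟩

theorem near_self (x : M.C one) (k : M.N) : Near x x k := by
  refine near_of_approx (n := k + 1 + 1) ?_ ?_ <;>
  · rw [ε_succ, ε_succ]; linarith [ε_pos k]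

theorem Near.mono {x y : M.C one} {k k' : M.N} (h : Near x y k) (hk : k' ≤ k) : Near x y k' :=
  ⟨fun h' => h.1 (h'.mono (by linarith [ε_anti hk])), fun h' => h.2 (h'.mono (by linarith [ε_anti hk]))⟩

theorem Near.congr_right {x y z : M.C one} {k : M.N} (hx : IsReal x) (hy : IsReal y) (hz : IsReal z)
    (h : Near x y k) (h' : REq y z) : Near x z k := by
  obtain ⟨d, hd, h1, h2⟩ := (near_iff hx hy).1 h
  refine (near_iff hx hz).2 ⟨d, hd, ?_, ?_⟩
  · simpa using h1.trans hx hz h'.1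
  · simpa using h'.2.trans hz hx h2

/-- Balls are open. -/
theorem Near.exists_ball {x y : M.C one} {k : M.N} (hx : IsReal x) (hy : IsReal y) (h : Near x y k) :
    ∃ m, ∀ z, IsReal z → Near y z m → Near x z k := by
  obtain ⟨d, hd, h1, h2⟩ := (near_iff hx hy).1 h
  obtain ⟨m, hm⟩ := exists_ε_lt (δ := ε k - d) (by linarith)
  refine ⟨m, fun z hz hn => ?_⟩
  obtain ⟨d', hd', h1', h2'⟩ := (near_iff hy hz).1 hn
  refine (near_iff hx hz).2 ⟨d + d', by linarith, h1.trans hx hz h1', ?_⟩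
  rw [add_comm]; exact h2'.trans hz hx h2

theorem exists_not_near {x y : M.C one} (hx : IsReal x) (hy : IsReal y) (h : ¬ REq x y) :
    ∃ m, ¬ Near x y m := by
  by_contra hn
  push Not at hn
  refine h ⟨fun n => ?_, fun n => ?_⟩
  · refine le_of_forall_ε 1 one_pos fun m => ?_
    obtain ⟨d, hd, h1, h2⟩ := (near_iff hx hy).1 (hn m)
    linarith [h1 n]
  · refine le_of_forall_ε 1 one_pos fun m => ?_
    obtain ⟨d, hd, h1, h2⟩ := (near_iff hx hy).1 (hn m)
    linarith [h2 n]

end Reals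

/-! ### Internal functions and decidable predicates -/

section Internal

variable {M : Model}

/-- `f` is represented by an element of the model. -/
@[fun_prop]
def Internal {ρ σ : Ty} (f : M.C ρ → M.C σ) : Prop := ∃ c : M.C (ρ ⇾ σ), ∀ x, c ◃ x = f x

@[fun_prop]
theorem Internal.id {ρ : Ty} : Internal (fun x : M.C ρ => x) := ⟨ev nil (Tm.lam v0), fun x => by simp⟩

@[fun_prop]
theorem Internal.const {ρ σ : Ty} (a : M.C σ) : Internal (fun _ : M.C ρ => a) :=
  ⟨M.K _ _ ◃ a, fun x => by simp⟩

@[fun_prop]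
theorem Internal.app {ρ σ τ : Ty} {f : M.C ρ → M.C (σ ⇾ τ)} {g : M.C ρ → M.C σ} (hf : Internal f)
    (hg : Internal g) : Internal (fun x => f x ◃ g x) := by
  obtain ⟨c, hc⟩ := hf
  obtain ⟨d, hd⟩ := hg
  exact ⟨M.S _ _ _ ◃ c ◃ d, fun x => by simp [hc, hd]⟩

@[fun_prop]
theorem Internal.comp {ρ σ τ : Ty} {f : M.C σ → M.C τ} {g : M.C ρ → M.C σ} (hf : Internal f)
    (hg : Internal g) : Internal (fun x => f (g x)) := by
  obtain ⟨c, hc⟩ := hf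
  obtain ⟨d, hd⟩ := hg
  exact ⟨ev (c ◂ d ◂ nil) (Tm.lam (v1 ⬝ (v2 ⬝ v0))), fun x => by simp [hc, hd]⟩

variable {ρ : Ty} {f g : M.C ρ → M.N}

theorem Internal.map₂ (hf : Internal f) (hg : Internal g) (t : Tm [Ty.nat, Ty.nat] Ty.nat) :
    Internal (fun x => ev (f x ◂ g x ◂ nil) t) := by
  obtain ⟨c, hc⟩ := hf
  obtain ⟨d, hd⟩ := hg
  exact ⟨ev (c ◂ d ◂ nil) (Tm.lam ((Tm.lam (Tm.lam (t.subst
    (Sub.cons v0 (Sub.cons v1 fun _ (x : Var [] _) => nomatch x))))) ⬝ (v2 ⬝ v0) ⬝ (v1 ⬝ v0))), fun x => by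
    simp only [ev_lam, ev_app, ev_var, cons_zero, cons_succ, hc, hd, ev_subst]
    congr 1
    exact env_ext rfl fun _ x => by cases x with
      | zero => rfl
      | succ x => nomatch x⟩

@[fun_prop]
theorem Internal.add (hf : Internal f) (hg : Internal g) : Internal (fun x => f x + g x) := by
  simpa using hf.map₂ hg (Tm.add v0 v1)

@[fun_prop]
theorem Internal.mul (hf : Internal f) (hg : Internal g) : Internal (fun x => f x * g x) := by
  simpa using hf.map₂ hg (Tm.mul v0 v1)

@[fun_prop]
theorem Internal.sub (hf : Internal f) (hg : Internal g) : Internal (fun x => Model.sub (f x) (g x)) := by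
  simpa using hf.map₂ hg (Tm.sub v0 v1)

@[fun_prop]
theorem Internal.pow2 (hf : Internal f) : Internal (fun x => Model.pow2 (f x)) := by
  simpa using hf.map₂ hf (Tm.pow2 v0)

/-- Case distinction. -/
def _root_.HORM.Tm.cond {Γ : List Ty} (s t u : Tm Γ Ty.nat) : Tm Γ Ty.nat :=
  .R ⬝ s ⬝ t ⬝ Tm.lam (Tm.lam u.wk.wk)

theorem exists_rec (a : M.N) (g : M.C (Ty.nat ⇾ Ty.nat ⇾ Ty.nat)) :
    ∃ f : M.C one, f ◃ 0 = a ∧ ∀ n, f ◃ (n + 1) = g ◃ (f ◃ n) ◃ n :=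
  ⟨ev (a ◂ g ◂ nil) (Tm.lam (.R ⬝ v0 ⬝ v1 ⬝ v2)), by simp, fun n => by simp⟩

/-- The recursion is uniform in a parameter `h`, which yields one functional rather than one
sequence for each `h`. -/
theorem exists_rec' {ρ : Ty} (a : M.N) (g : M.C (ρ ⇾ Ty.nat ⇾ Ty.nat ⇾ Ty.nat)) :
    ∃ f : M.C (ρ ⇾ one), (∀ h, f ◃ h ◃ 0 = a) ∧ ∀ h n, f ◃ h ◃ (n + 1) = g ◃ h ◃ (f ◃ h ◃ n) ◃ n :=
  ⟨ev (a ◂ g ◂ nil) (Tm.lam (Tm.lam (.R ⬝ v0 ⬝ v2 ⬝ (v3 ⬝ v1)))), fun h => by simp, fun h n => by simp⟩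

/-- `P` has an internal characteristic function. -/
@[fun_prop]
def Dec (P : M.C ρ → Prop) : Prop := ∃ χ : M.C ρ → M.N, Internal χ ∧ ∀ x, P x ↔ χ x = 0

end Internal

variable {M : Model} [hM : Fact M.RCA]

/-- Case distinction. -/
noncomputable def cnd (a b c : M.N) : M.N := if a = 0 then b else c

@[simp] theorem cnd_zero (b c : M.N) : cnd 0 b c = b := if_pos rfl

theorem cnd_pos {a : M.N} (b c : M.N) (h : a = 0) : cnd a b c = b := if_pos h

theorem cnd_neg {a : M.N} (b c : M.N) (h : a ≠ 0) : cnd a b c = c := if_neg h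

@[simp] theorem cnd_one (b c : M.N) : cnd 1 b c = c := cnd_neg b c (M.succ_ne_zero M.zero)

theorem cnd_sub_pos {x y : M.N} (b c : M.N) (h : x ≤ y) : cnd (sub x y) b c = b :=
  cnd_pos b c (sub_eq_zero_iff_le.2 h)

theorem cnd_sub_neg {x y : M.N} (b c : M.N) (h : ¬ x ≤ y) : cnd (sub x y) b c = c :=
  cnd_neg b c (mt sub_eq_zero_iff_le.1 h)

@[simp] theorem ev_cond {Γ : List Ty} (e : M.Env Γ) (s t u : Tm Γ Ty.nat) :
    ev e (Tm.cond s t u) = cnd (ev e s) (ev e t) (ev e u) := by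
  simp only [Tm.cond, ev_app, ev_R]
  rcases eq_zero_or_succ (ev e s) with h | ⟨n, h⟩
  · simp [h]
  · rw [h, cnd_neg _ _ (add_one_ne_zero n)]
    simp

/-! ### Closure properties of decidable predicates and of rational-valued maps -/

section

variable {ρ : Ty}

variable {P P' : M.C ρ → Prop} {f g : M.C ρ → M.N}

@[fun_prop]
theorem Dec.eq (hf : Internal f) (hg : Internal g) : Dec (fun x => f x = g x) :=
  ⟨fun x => Model.sub (f x) (g x) + Model.sub (g x) (f x), by fun_prop, fun x => by
    simp only [add_eq_zero, sub_eq_zero_iff_le, ← le_antisymm_iff]⟩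

@[fun_prop]
theorem Dec.le (hf : Internal f) (hg : Internal g) : Dec (fun x => f x ≤ g x) :=
  ⟨fun x => Model.sub (f x) (g x), by fun_prop, fun x => sub_eq_zero_iff_le.symm⟩

@[fun_prop]
theorem Dec.and (h : Dec P) (h' : Dec P') : Dec (fun x => P x ∧ P' x) := by
  obtain ⟨χ, h, hχ⟩ := h
  obtain ⟨χ', h', hχ'⟩ := h'
  exact ⟨fun x => χ x + χ' x, by fun_prop, fun x => by simp only [hχ, hχ', add_eq_zero]⟩

@[fun_prop]
theorem Dec.not (h : Dec P) : Dec (fun x => ¬ P x) := by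
  obtain ⟨χ, h, hχ⟩ := h
  refine ⟨fun x => Model.sub 1 (χ x), by fun_prop, fun x => ?_⟩
  beta_reduce
  rw [hχ, sub_eq_zero_iff_le, ← zero_add (1 : M.N), add_one_le_iff, pos_iff_ne_zero]

@[fun_prop]
theorem Dec.imp (h : Dec P) (h' : Dec P') : Dec (fun x => P x → P' x) := by
  have := (h.and h'.not).not
  simpa only [not_and, not_not] using this

@[fun_prop]
theorem Dec.or (h : Dec P) (h' : Dec P') : Dec (fun x => P x ∨ P' x) := by
  have := (h.not.and h'.not).not
  simpa only [not_and_or, not_not] using this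

@[fun_prop]
theorem Dec.lt (hf : Internal f) (hg : Internal g) : Dec (fun x => f x < g x) := by
  have := (Dec.le hg hf).not
  simpa only [not_le] using this

@[fun_prop]
theorem Internal.ite (h : Dec P) [∀ x, Decidable (P x)] (hf : Internal f) (hg : Internal g) :
    Internal (fun x => if P x then f x else g x) := by
  obtain ⟨χ, ⟨a, ha⟩, hχ⟩ := h
  obtain ⟨c, hc⟩ := hf
  obtain ⟨d, hd⟩ := hg
  refine ⟨ev (a ◂ c ◂ d ◂ nil) (Tm.lam (Tm.cond (v1 ⬝ v0) (v2 ⬝ v0) (v3 ⬝ v0))), fun x => ?_⟩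
  simp [ha, hc, hd, hχ, cnd]

/-- `A` is a quotient of differences of internal functions. -/
@[fun_prop]
def Rational (A : M.C ρ → M.Q) : Prop := ∃ p m d : M.C ρ → M.N, Internal p ∧ Internal m ∧ Internal d ∧
  (∀ x, 0 < d x) ∧ ∀ x, A x = (ι (p x) - ι (m x)) / ι (d x)

variable {A B : M.C ρ → M.Q}

@[fun_prop]
theorem Rational.const (a : M.Q) : Rational (fun _ : M.C ρ => a) := by
  obtain ⟨p, m, d, hd, rfl⟩ := exists_eq_div a
  exact ⟨fun _ => p, fun _ => m, fun _ => d, by fun_prop, by fun_prop, by fun_prop, fun _ => hd,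
    fun _ => rfl⟩

@[fun_prop]
theorem Rational.comp {σ : Ty} {A : M.C σ → M.Q} {f : M.C ρ → M.C σ} (hA : Rational A)
    (hf : Internal f) : Rational (fun x => A (f x)) := by
  obtain ⟨p, m, d, hp, hm, hd, h, e⟩ := hA
  exact ⟨fun x => p (f x), fun x => m (f x), fun x => d (f x), by fun_prop, by fun_prop, by fun_prop,
    fun x => h _, fun x => e _⟩

@[fun_prop]
theorem Rational.ι (hf : Internal f) : Rational (fun x => ι (f x)) :=
  ⟨f, fun _ => 0, fun _ => 1, by fun_prop, by fun_prop, by fun_prop, fun _ => one_pos, fun x => by simp⟩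

@[fun_prop]
theorem Rational.ε (hf : Internal f) : Rational (fun x => ε (f x)) :=
  ⟨fun _ => 1, fun _ => 0, fun x => Model.pow2 (f x), by fun_prop, by fun_prop, by fun_prop,
    fun _ => pow2_pos _, fun x => by simp [Model.ε]⟩

@[fun_prop]
theorem Rational.add (hA : Rational A) (hB : Rational B) : Rational (fun x => A x + B x) := by
  obtain ⟨p, m, d, hp, hm, hd, h, e⟩ := hA
  obtain ⟨p', m', d', hp', hm', hd', h', e'⟩ := hB
  refine ⟨fun x => p x * d' x + p' x * d x, fun x => m x * d' x + m' x * d x, fun x => d x * d' x,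
    by fun_prop, by fun_prop, by fun_prop, fun x => mul_pos (h x) (h' x), fun x => ?_⟩
  have h1 := (ι_pos.2 (h x)).ne'
  have h2 := (ι_pos.2 (h' x)).ne'
  beta_reduce
  rw [e, e']
  simp only [map_add, map_mul]
  field_simp
  ring

@[fun_prop]
theorem Rational.neg (hA : Rational A) : Rational (fun x => - A x) := by
  obtain ⟨p, m, d, hp, hm, hd, h, e⟩ := hA
  refine ⟨m, p, d, hm, hp, hd, h, fun x => ?_⟩
  beta_reduce
  rw [e]; ring

@[fun_prop]
theorem Rational.sub (hA : Rational A) (hB : Rational B) : Rational (fun x => A x - B x) := by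
  simpa only [sub_eq_add_neg] using hA.add hB.neg

@[fun_prop]
theorem Rational.mul (hA : Rational A) (hB : Rational B) : Rational (fun x => A x * B x) := by
  obtain ⟨p, m, d, hp, hm, hd, h, e⟩ := hA
  obtain ⟨p', m', d', hp', hm', hd', h', e'⟩ := hB
  refine ⟨fun x => p x * p' x + m x * m' x, fun x => p x * m' x + m x * p' x, fun x => d x * d' x,
    by fun_prop, by fun_prop, by fun_prop, fun x => mul_pos (h x) (h' x), fun x => ?_⟩
  have h1 := (ι_pos.2 (h x)).ne'
  have h2 := (ι_pos.2 (h' x)).ne'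
  beta_reduce
  rw [e, e']
  simp only [map_add, map_mul]
  field_simp
  ring

@[fun_prop]
theorem Rational.div_ι (hA : Rational A) (hf : Internal f) (hpos : ∀ x, 0 < f x) :
    Rational (fun x => A x / Model.ι (f x)) := by
  have : Rational (fun x => (Model.ι (f x))⁻¹) :=
    ⟨fun _ => 1, fun _ => 0, f, by fun_prop, by fun_prop, hf, hpos, fun x => by simp⟩
  simpa only [div_eq_mul_inv] using hA.mul this

@[fun_prop]
theorem Rational.q {x : M.C ρ → M.C one} {n : M.C ρ → M.N} (hx : Internal x) (hn : Internal n) :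
    Rational (fun y => q (x y) (n y)) := by
  refine ⟨fun y => x y ◃ (3 * n y), fun y => x y ◃ (3 * n y + 1), fun y => x y ◃ (3 * n y + 1 + 1) + 1,
    by fun_prop, by fun_prop, by fun_prop, fun y => lt_of_lt_of_le zero_lt_one ⟨_, add_comm _ _⟩,
    fun y => ?_⟩
  beta_reduce
  rw [map_add, map_one]; rfl

@[fun_prop]
theorem Dec.le_rational (hA : Rational A) (hB : Rational B) : Dec (fun x => A x ≤ B x) := by
  obtain ⟨p, m, d, hp, hm, hd, h, e⟩ := hA
  obtain ⟨p', m', d', hp', hm', hd', h', e'⟩ := hB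
  have : Dec (fun x => p x * d' x + m' x * d x ≤ m x * d' x + p' x * d x) := by fun_prop
  convert this using 2 with x
  rw [e, e', div_le_div_iff₀ (ι_pos.2 (h x)) (ι_pos.2 (h' x)), ← ι_le]
  simp only [map_add, map_mul]
  constructor <;> intro h <;> linarith

end

/-- Induction for internally decidable predicates. -/
theorem Dec.ind {P : M.N → Prop} (h : Dec P) (h0 : P 0) (hS : ∀ n, P n → P (n + 1)) (n : M.N) : P n := by
  obtain ⟨χ, ⟨c, hc⟩, hχ⟩ := h
  refine Model.ind (v1 ⬝ v0 ≐ .zero) (by simp [Fm.QF]) (c ◂ nil) (fun n => ?_) h0 hS n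
  simp [hc, hχ]

/-- Choice for internally decidable relations between functions and numbers. -/
theorem exists_choice (A : M.C (one ⇾ Ty.nat ⇾ Ty.nat)) (h : ∀ f, ∃ n, A ◃ f ◃ n = 0) :
    ∃ F : M.C two, ∀ f, A ◃ f ◃ (F ◃ f) = 0 := by
  obtain ⟨F, hF⟩ := hM.out.qfac (v2 ⬝ v1 ⬝ v0 ≐ .zero) (by simp [Fm.QF]) (A ◂ nil) (by simpa using h)
  exact ⟨F, by simpa using hF⟩

/-! ### Coding of reals and of finite binary sequences -/

/-- A real is coded by triples at `3n`, `3n+1`, `3n+2`, so building one requires division by three.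
The remainder `m` is a counter that returns to `0` after `2`, and `d` advances at each return. -/
theorem exists_divMod3 : ∃ d m : M.C one, ∀ n, (m ◃ (3 * n) = 0 ∧ d ◃ (3 * n) = n) ∧
    (m ◃ (3 * n + 1) = 1 ∧ d ◃ (3 * n + 1) = n) ∧
    (m ◃ (3 * n + 1 + 1) = 2 ∧ d ◃ (3 * n + 1 + 1) = n) := by
  obtain ⟨m, hm0, hm⟩ := exists_rec (M := M) 0
    (ev nil (Tm.lam (Tm.lam (Tm.cond (Tm.sub ttwo v1) .zero (.succ ⬝ v1)))))
  obtain ⟨d, hd0, hd⟩ := exists_rec (M := M) 0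
    (ev (m ◂ nil) (Tm.lam (Tm.lam (Tm.cond (Tm.sub ttwo (v2 ⬝ v0)) (.succ ⬝ v1) v1))))
  simp only [ev_lam, ev_cond, ev_sub, ev_ttwo, ev_var, cons_zero, cons_succ, ev_zero, zero_eq, ev_app,
    ev_succ, succ_eq] at hm hd
  have h20 : ¬ (2 : M.N) ≤ 0 := by simp
  have h21 : ¬ (2 : M.N) ≤ 1 := not_le.2 one_lt_two
  have key : ∀ n, m ◃ (3 * n) = 0 ∧ d ◃ (3 * n) = n → (m ◃ (3 * n + 1) = 1 ∧ d ◃ (3 * n + 1) = n) ∧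
      (m ◃ (3 * n + 1 + 1) = 2 ∧ d ◃ (3 * n + 1 + 1) = n) := by
    rintro n ⟨h1, h2⟩
    have h3 : m ◃ (3 * n + 1) = 1 := by rw [hm, h1, cnd_sub_neg _ _ h20, zero_add]
    have h4 : d ◃ (3 * n + 1) = n := by rw [hd, h1, cnd_sub_neg _ _ h20, h2]
    exact ⟨⟨h3, h4⟩, by rw [hm, h3, cnd_sub_neg _ _ h21, one_add_one_eq_two], by rw [hd, h3, cnd_sub_neg _ _ h21, h4]⟩
  have base : ∀ n, m ◃ (3 * n) = 0 ∧ d ◃ (3 * n) = n := by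
    refine Dec.ind (by fun_prop) ?_ fun n h => ?_
    · rw [mul_zero]; exact ⟨hm0, hd0⟩
    · obtain ⟨h1, h2, h3⟩ := key n h
      have e : 3 * (n + 1) = 3 * n + 1 + 1 + 1 := by ring
      rw [e, hm, hd, h2, h3, cnd_sub_pos _ _ le_rfl, cnd_sub_pos _ _ le_rfl]
      exact ⟨rfl, rfl⟩
  exact ⟨d, m, fun n => ⟨base n, key n (base n)⟩⟩

theorem exists_interleave : ∃ J : M.C (one ⇾ one ⇾ one ⇾ one), ∀ p m d n,
    q (J ◃ p ◃ m ◃ d) n = (ι (p ◃ n) - ι (m ◃ n)) / (ι (d ◃ n) + 1) := by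
  obtain ⟨dv, md, h⟩ := exists_divMod3 (M := M)
  refine ⟨ev (dv ◂ md ◂ nil) (Tm.lam (Tm.lam (Tm.lam (Tm.lam (Tm.cond (v5 ⬝ v0) (v3 ⬝ (v4 ⬝ v0))
    (Tm.cond (Tm.pred (v5 ⬝ v0)) (v2 ⬝ (v4 ⬝ v0)) (v1 ⬝ (v4 ⬝ v0)))))))), fun p m d n => ?_⟩
  obtain ⟨⟨h1, h2⟩, ⟨h3, h4⟩, ⟨h5, h6⟩⟩ := h n
  have p1 : pred (1 : M.N) = 0 := by simpa using pred_succ (0 : M.N)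
  have p2 : pred (2 : M.N) = 1 := by rw [← one_add_one_eq_two, pred_succ]
  have p3 : ∀ b c : M.N, cnd 2 b c = c := fun b c => cnd_neg b c two_ne_zero
  simp [q, h1, h2, h3, h4, h5, h6, p1, p2, p3]

/-- Rational numbers are reals. -/
theorem exists_const_real (c : M.Q) : ∃ x : M.C one, ∀ n, q x n = c := by
  obtain ⟨J, hJ⟩ := exists_interleave (M := M)
  obtain ⟨p, m, d, hd, rfl⟩ := exists_eq_div c
  -- The code stores the denominator minus one.
  rcases eq_zero_or_succ d with rfl | ⟨d, rfl⟩
  · exact (lt_irrefl _ hd).elim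
  refine ⟨J ◃ (M.K _ _ ◃ p) ◃ (M.K _ _ ◃ m) ◃ (M.K _ _ ◃ d), fun n => ?_⟩
  rw [hJ, M.K_eq, M.K_eq, M.K_eq, map_add, map_one]

/-- Binary sequences. -/
def Cantor (h : M.C one) : Prop := ∀ n, h ◃ n = 0 ∨ h ◃ n = 1

/-- Numbers code finite binary sequences. -/
theorem exists_bits : ∃ e : M.C (Ty.nat ⇾ one), (∀ s, Cantor (e ◃ s)) ∧
    ∀ g, Cantor g → ∀ m, ∃ s, s < pow2 m ∧ (∀ i, i < m → e ◃ s ◃ i = g ◃ i) ∧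
      ∀ i, m ≤ i → e ◃ s ◃ i = 0 := by
  -- `p` is parity and `h` is halving, which grows by one after each odd number.
  obtain ⟨p, hp0, hp⟩ := exists_rec (M := M) 0 (ev nil (Tm.lam (Tm.lam (Tm.cond v1 tone .zero))))
  obtain ⟨h, hh0, hh⟩ := exists_rec (M := M) 0 (ev (p ◂ nil) (Tm.lam (Tm.lam (Tm.add v1 (v2 ⬝ v0)))))
  simp only [ev_lam, ev_cond, ev_add, ev_tone, ev_var, cons_zero, cons_succ, ev_zero, zero_eq,
    ev_app] at hp hh
  have hpc : Cantor p := by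
    refine Dec.ind (P := fun n => p ◃ n = 0 ∨ p ◃ n = 1) (by fun_prop) (.inl hp0) fun n hn => ?_
    rw [hp]
    rcases hn with hn | hn <;> rw [hn] <;> simp
  have hdbl : ∀ c, p ◃ (c + c) = 0 ∧ h ◃ (c + c) = c := by
    refine Dec.ind (by fun_prop) (by rw [add_zero]; exact ⟨hp0, hh0⟩) fun n hn => ?_
    have e : n + 1 + (n + 1) = n + n + 1 + 1 := by ring
    have h1 : p ◃ (n + n + 1) = 1 := by rw [hp, hn.1, cnd_zero]
    rw [e, hp, h1, cnd_one, hh, hh, hn.1, hn.2, h1]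
    simp
  have hbit : ∀ b c, b = 0 ∨ b = 1 → p ◃ (b + (c + c)) = b ∧ h ◃ (b + (c + c)) = c := by
    rintro b c (rfl | rfl)
    · rw [zero_add]; exact hdbl c
    · rw [add_comm, hp, hh, (hdbl c).1, (hdbl c).2]; simp
  let e : M.C (Ty.nat ⇾ one) := ev (h ◂ p ◂ nil)
    (Tm.lam (Tm.lam (v3 ⬝ (.R ⬝ v0 ⬝ v1 ⬝ Tm.lam (Tm.lam (v4 ⬝ v1))))))
  -- `D s i` is `s` halved `i` times, and its parity is the `i`-th bit of `s`.
  let D (s i : M.N) : M.N := M.R ◃ i ◃ s ◃ ev (h ◂ nil) (Tm.lam (Tm.lam (v2 ⬝ v1)))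
  have hD : ∀ s, Internal (D s) := fun s => by unfold D; fun_prop
  have hDS : ∀ s i, D s (i + 1) = h ◃ D s i := fun s i => by simp [D]
  have he : ∀ s i, e ◃ s ◃ i = p ◃ D s i := fun s i => by
    simp only [e, D, ev_lam, ev_app, ev_var, cons_zero, cons_succ, ev_R]
    exact congrArg (fun z => p ◃ (M.R ◃ i ◃ s ◃ z)) (ext₂ fun x y => by simp)
  refine ⟨e, fun s i => by rw [he]; exact hpc _, fun g hg m => ?_⟩
  -- Horner's scheme on the first `m` bits of `g`, read from `g (m - 1)` down to `g 0`. Hence `i`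
  -- halvings of `C m` give back `C (m - i)`.
  obtain ⟨C, hC0, hC⟩ := exists_rec (M := M) 0
    (ev (g ◂ m ◂ nil) (Tm.lam (Tm.lam (Tm.add (v2 ⬝ (Tm.sub v3 (.succ ⬝ v0))) (Tm.add v1 v1)))))
  simp only [ev_lam, ev_add, ev_sub, ev_succ, succ_eq, ev_var, cons_zero, cons_succ, ev_app] at hC
  have hlt : ∀ j, C ◃ j < pow2 j := by
    refine Dec.ind (by fun_prop) (by rw [hC0]; exact pow2_pos _) fun j hj => ?_
    rw [hC, pow2_succ, ← add_one_le_iff]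
    have h1 : g ◃ sub m (j + 1) ≤ 1 := by rcases hg (sub m (j + 1)) with h | h <;> rw [h]; exact zero_le
    have h2 := add_one_le_iff.2 hj
    calc _ ≤ 1 + (C ◃ j + C ◃ j) + 1 := by gcongr
      _ = (C ◃ j + 1) + (C ◃ j + 1) := by ring
      _ ≤ _ := add_le_add h2 h2
  have hDC : ∀ i, i ≤ m → D (C ◃ m) i = C ◃ sub m i := by
    have hDi := hD (C ◃ m)
    refine Dec.ind (by fun_prop) (fun _ => by simp [D]) fun i hi him => ?_
    obtain ⟨k, rfl⟩ := him
    have e1 : sub (i + 1 + k) i = k + 1 := by rw [show i + 1 + k = k + 1 + i by ring, sub_add]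
    have e2 : sub (i + 1 + k) (i + 1) = k := by rw [add_comm, sub_add]
    rw [hDS, hi ⟨1 + k, by ring⟩, e1, e2, hC]
    exact (hbit _ _ (hg _)).2
  refine ⟨C ◃ m, hlt m, fun i hi => ?_, fun i hi => ?_⟩
  · obtain ⟨k, rfl⟩ := add_one_le_iff.2 hi
    have e1 : sub (i + 1 + k) i = k + 1 := by rw [show i + 1 + k = k + 1 + i by ring, sub_add]
    rw [he, hDC i hi.le, e1, hC, (hbit _ _ (hg _)).1, show i + 1 + k = i + (k + 1) by ring, sub_add]
  · obtain ⟨k, rfl⟩ := hi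
    have : D (C ◃ m) (m + k) = 0 := by
      have hDi := hD (C ◃ m)
      refine Dec.ind (P := fun k => D (C ◃ m) (m + k) = 0) (by fun_prop) ?_ (fun k hk => ?_) k
      · rw [add_zero, hDC m le_rfl]
        have := sub_add m 0
        rw [zero_add] at this
        rw [this, hC0]
      · rw [← add_assoc, hDS, hk, hh0]
    rw [he, this, hp0]

/-! ### A surjection from Cantor space onto the unit interval -/

/-- Facts on the expansion `∑ i, h i * 2 ^ i / 3 ^ (i + 1)` with partial sums `P m / 3 ^ m`. -/
theorem expansion_sum {t h P : M.C one} (ht : ∀ n, 0 < t ◃ n) (htS : ∀ n, t ◃ (n + 1) = 3 * t ◃ n)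
    (hh : Cantor h) (hP : ∀ n, P ◃ (n + 1) = 3 * P ◃ n + h ◃ n * pow2 n) (m i : M.N) :
    ι (P ◃ m) / ι (t ◃ m) ≤ ι (P ◃ (m + i)) / ι (t ◃ (m + i)) ∧
    ι (P ◃ (m + i)) / ι (t ◃ (m + i)) + ι (pow2 (m + i)) / ι (t ◃ (m + i)) ≤
      ι (P ◃ m) / ι (t ◃ m) + ι (pow2 m) / ι (t ◃ m) := by
  have ht' : ∀ n, ι (t ◃ n) ≠ 0 := fun n => (ι_pos.2 (ht n)).ne'
  -- A digit `1` adds one third of the weight `(2/3)^n`, and the next weight is two thirds of it. So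
  -- partial sums increase while partial sum plus weight decreases.
  have hw : ∀ n, ι (pow2 (n + 1)) / ι (t ◃ (n + 1)) = ι (pow2 n) / ι (t ◃ n) * (2 / 3) := by
    intro n
    have := ht' n
    rw [pow2_succ, htS, map_add, map_mul, map_ofNat]; field_simp; ring
  have hs : ∀ n, ι (P ◃ (n + 1)) / ι (t ◃ (n + 1)) =
      ι (P ◃ n) / ι (t ◃ n) + ι (h ◃ n) * (ι (pow2 n) / ι (t ◃ n)) / 3 := by
    intro n
    have := ht' n
    rw [hP, htS, map_add, map_mul, map_mul, map_mul, map_ofNat]; field_simp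
  have hw0 : ∀ n, 0 ≤ ι (pow2 n) / ι (t ◃ n) := fun n => div_nonneg (ι_nonneg _) (ι_nonneg _)
  have h1 : Rational fun i => ι (P ◃ (m + i)) / ι (t ◃ (m + i)) :=
    Rational.div_ι (by fun_prop) (by fun_prop) fun _ => ht _
  have h2 : Rational fun i => ι (pow2 (m + i)) / ι (t ◃ (m + i)) :=
    Rational.div_ι (by fun_prop) (by fun_prop) fun _ => ht _
  refine Dec.ind (P := fun i => ι (P ◃ m) / ι (t ◃ m) ≤ ι (P ◃ (m + i)) / ι (t ◃ (m + i)) ∧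
    ι (P ◃ (m + i)) / ι (t ◃ (m + i)) + ι (pow2 (m + i)) / ι (t ◃ (m + i)) ≤
      ι (P ◃ m) / ι (t ◃ m) + ι (pow2 m) / ι (t ◃ m)) (by fun_prop) (by simp) (fun i hi => ?_) i
  rw [← add_assoc, hs, hw]
  have := hw0 (m + i)
  rcases hh (m + i) with h | h <;> rw [h]
  · rw [map_zero]; constructor <;> linarith [hi.1, hi.2]
  · rw [map_one]; constructor <;> linarith [hi.1, hi.2]

/-- `t` is the sequence of powers of three. As `4/9 ≤ 1/2`, two digits of the expansion gain at
least one binary place, which is why the `n`-th approximation uses `2 * n` digits. -/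
theorem exists_pow3 : ∃ t : M.C one, t ◃ 0 = 1 ∧ (∀ n, 0 < t ◃ n) ∧ (∀ n, t ◃ (n + 1) = 3 * t ◃ n) ∧
    (∀ n, ε n ≤ ι (pow2 n) / ι (t ◃ n)) ∧ ∀ n, ι (pow2 (2 * n)) / ι (t ◃ (2 * n)) ≤ ε n := by
  obtain ⟨t, ht0, htS⟩ := exists_rec (M := M) 1 (ev nil (Tm.lam (Tm.lam (Tm.mul tthree v1))))
  simp only [ev_lam, ev_mul, ev_tthree, ev_var, cons_zero, cons_succ] at htS
  have ht : ∀ n, 0 < t ◃ n := by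
    refine Dec.ind (by fun_prop) (by rw [ht0]; exact one_pos) fun n hn => ?_
    rw [htS]; exact mul_pos three_pos hn
  have ht' : ∀ n, ι (t ◃ n) ≠ 0 := fun n => (ι_pos.2 (ht n)).ne'
  have hw : ∀ n, ι (pow2 (n + 1)) / ι (t ◃ (n + 1)) = ι (pow2 n) / ι (t ◃ n) * (2 / 3) := by
    intro n
    have := ht' n
    rw [pow2_succ, htS, map_add, map_mul, map_ofNat]; field_simp; ring
  have hr : Rational fun n => ι (pow2 n) / ι (t ◃ n) :=
    Rational.div_ι (by fun_prop) (by fun_prop) ht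
  have hw0 : ∀ n, 0 ≤ ι (pow2 n) / ι (t ◃ n) := fun n => div_nonneg (ι_nonneg _) (ι_nonneg _)
  refine ⟨t, ht0, ht, htS, ?_, ?_⟩
  · refine Dec.ind (by fun_prop) (by simp [ht0]) fun n hn => ?_
    rw [hw, ε_succ]; linarith [hw0 n]
  · have hr' : Rational fun n => ι (pow2 (2 * n)) / ι (t ◃ (2 * n)) := hr.comp (by fun_prop)
    refine Dec.ind (by fun_prop) (by simp [ht0]) fun n hn => ?_
    rw [show 2 * (n + 1) = 2 * n + 1 + 1 by ring, hw, hw, ε_succ]; linarith [ε_pos n]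

/-- The digit weights `2^i / 3^(i+1)` give expansions with overlap: from an interval of length `w`
digit `0` keeps the lower and digit `1` the upper two thirds. A digit of `x` can therefore be chosen
from a rational approximation, whereas ordinary binary digits would require deciding an inequality
of reals. -/
theorem exists_parametrization : ∃ r : M.C (one ⇾ one), (∀ h, Cantor h → Unit (r ◃ h)) ∧
    (∀ h g n, (∀ i, i < 2 * n → h ◃ i = g ◃ i) → q (r ◃ h) n = q (r ◃ g) n) ∧
    ∀ x, Unit x → ∃ h, Cantor h ∧ REq x (r ◃ h) := by
  obtain ⟨J, hJ⟩ := exists_interleave (M := M)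
  obtain ⟨t, ht0, ht, htS, hεw, hwε⟩ := exists_pow3 (M := M)
  have ht' : ∀ n, ι (t ◃ n) ≠ 0 := fun n => (ι_pos.2 (ht n)).ne'
  obtain ⟨P, hP0, hPS⟩ := exists_rec' (M := M) 0
    (ev nil (Tm.lam (Tm.lam (Tm.lam (Tm.add (Tm.mul tthree v1) (Tm.mul (v2 ⬝ v0) (Tm.pow2 v0)))))) :
      M.C (one ⇾ Ty.nat ⇾ Ty.nat ⇾ Ty.nat))
  simp only [ev_lam, ev_mul, ev_add, ev_app, ev_pow2, ev_tthree, ev_var, cons_zero, cons_succ] at hPS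
  let r : M.C (one ⇾ one) := ev (J ◂ P ◂ t ◂ nil) (Tm.lam (v1 ⬝ (Tm.lam (v3 ⬝ v1 ⬝ (Tm.mul ttwo v0))) ⬝
    (Tm.lam .zero) ⬝ (Tm.lam (Tm.pred (v4 ⬝ (Tm.mul ttwo v0))))))
  have hr : ∀ h n, q (r ◃ h) n = ι (P ◃ h ◃ (2 * n)) / ι (t ◃ (2 * n)) := by
    intro h n
    have e1 : ι (pred (t ◃ (2 * n))) + 1 = ι (t ◃ (2 * n)) := by
      have := ht (2 * n)
      rcases eq_zero_or_succ (t ◃ (2 * n)) with h0 | ⟨k, hk⟩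
      · rw [h0] at this; exact (lt_irrefl _ this).elim
      · rw [hk, pred_succ, map_add, map_one]
    simp [r, hJ, e1]
  have hreal : ∀ h, Cantor h → IsReal (r ◃ h) := by
    intro h hh n i
    have := expansion_sum ht htS hh (hPS h) (2 * n) (2 * i)
    rw [← mul_add, ← hr, ← hr] at this
    have h1 := hwε n
    have h2 : 0 ≤ ι (pow2 (2 * (n + i))) / ι (t ◃ (2 * (n + i))) := div_nonneg (ι_nonneg _) (ι_nonneg _)
    constructor <;> linarith [ε_pos n, this.1, this.2]
  refine ⟨r, fun h hh => ⟨hreal h hh, fun n => ?_⟩, fun h g n hhg => ?_, fun x hx => ?_⟩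
  · have := expansion_sum ht htS hh (hPS h) 0 (2 * n)
    rw [zero_add, ← hr, hP0, ht0, pow2_zero, map_zero, map_one] at this
    have h2 : 0 ≤ ι (pow2 (2 * n)) / ι (t ◃ (2 * n)) := div_nonneg (ι_nonneg _) (ι_nonneg _)
    constructor <;> linarith [ε_pos n, this.1, this.2]
  · rw [hr, hr]
    have : ∀ j, j ≤ 2 * n → P ◃ h ◃ j = P ◃ g ◃ j := by
      refine Dec.ind (by fun_prop) (fun _ => by rw [hP0, hP0]) fun j hj hjn => ?_
      have hlt := add_one_le_iff.1 hjn
      rw [hPS, hPS, hj hlt.le, hhg j hlt]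
    rw [this _ le_rfl]
  · let b : M.C (Ty.nat ⇾ Ty.nat ⇾ Ty.nat) := ev (t ◂ x ◂ nil) (Tm.lam (Tm.lam (Tm.cond
      (Rat'.leTm ⟨(Tm.mul ttwo v1).add (Tm.pow2 v0), .zero, Tm.mul ttwo (v2 ⬝ v0)⟩
        (approx v3 (Tm.add v0 tthree))) tone .zero)))
    -- `R₀` yields numbers only, so the recursion carries the numerator of the partial sum; the
    -- digit is recovered from it through `b`.
    obtain ⟨B, hB0, hBS⟩ := exists_rec (M := M) 0 (ev (b ◂ nil)
      (Tm.lam (Tm.lam (Tm.add (Tm.mul tthree v1) (Tm.mul (v2 ⬝ v1 ⬝ v0) (Tm.pow2 v0))))))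
    simp only [ev_lam, ev_mul, ev_add, ev_app, ev_pow2, ev_tthree, ev_var, cons_zero, cons_succ] at hBS
    have hb : ∀ n, (ι (B ◃ n) / ι (t ◃ n) + ι (pow2 n) / ι (t ◃ n) / 2 ≤ q x (n + 3) ∧ b ◃ (B ◃ n) ◃ n = 1) ∨
        (q x (n + 3) < ι (B ◃ n) / ι (t ◃ n) + ι (pow2 n) / ι (t ◃ n) / 2 ∧ b ◃ (B ◃ n) ◃ n = 0) := by
      intro n
      have e : (ι (2 * B ◃ n + pow2 n)) / ι (2 * t ◃ n) =
          ι (B ◃ n) / ι (t ◃ n) + ι (pow2 n) / ι (t ◃ n) / 2 := by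
        have := ht' n
        rw [map_add, map_mul, map_mul, map_ofNat]; field_simp
      rw [← e]
      have h1 := ev_leTm (n ◂ B ◃ n ◂ t ◂ x ◂ nil)
        (q := ⟨(Tm.mul ttwo v1).add (Tm.pow2 v0), .zero, Tm.mul ttwo (v2 ⬝ v0)⟩)
        (r := approx v3 (Tm.add v0 tthree)) (by simpa using ht n) (d_approx_pos _ _ _)
      rw [rv_approx] at h1
      simp only [rv, ev_mul, ev_add, ev_ttwo, ev_tthree, ev_var, cons_zero, cons_succ, ev_pow2, ev_zero,
        zero_eq, map_zero, sub_zero, ev_app] at h1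
      rw [← h1, ← not_le, ← h1]
      simp only [b, ev_lam, ev_cond, ev_tone, ev_zero, zero_eq]
      by_cases hc : ev (n ◂ B ◃ n ◂ t ◂ x ◂ nil) (Rat'.leTm
          ⟨(Tm.mul ttwo v1).add (Tm.pow2 v0), .zero, Tm.mul ttwo (v2 ⬝ v0)⟩
          (approx v3 (Tm.add v0 tthree))) = 0
      · exact .inl ⟨hc, cnd_pos _ _ hc⟩
      · exact .inr ⟨hc, cnd_neg _ _ hc⟩
    let h : M.C one := ev (b ◂ B ◂ nil) (Tm.lam (v1 ⬝ (v2 ⬝ v0) ⬝ v0))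
    have hh : ∀ n, h ◃ n = b ◃ (B ◃ n) ◃ n := fun n => by simp [h]
    have hhc : Cantor h := fun n => by
      rw [hh]; rcases hb n with h | h
      · exact .inr h.2
      · exact .inl h.2
    have hPB : ∀ n, P ◃ h ◃ n = B ◃ n :=
      Dec.ind (by fun_prop) (by rw [hP0, hB0]) fun n hn => by rw [hPS, hBS, hn, hh]
    have hw0 : ∀ n, 0 ≤ ι (pow2 n) / ι (t ◃ n) := fun n => div_nonneg (ι_nonneg _) (ι_nonneg _)
    have hw : ∀ n, ι (pow2 (n + 1)) / ι (t ◃ (n + 1)) = ι (pow2 n) / ι (t ◃ n) * (2 / 3) := by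
      intro n
      have := ht' n
      rw [pow2_succ, htS, map_add, map_mul, map_ofNat]; field_simp; ring
    have hs : ∀ n, ι (B ◃ (n + 1)) / ι (t ◃ (n + 1)) =
        ι (B ◃ n) / ι (t ◃ n) + ι (b ◃ (B ◃ n) ◃ n) * (ι (pow2 n) / ι (t ◃ n)) / 3 := by
      intro n
      have := ht' n
      rw [hBS, htS, map_add, map_mul, map_mul, map_mul, map_ofNat]; field_simp
    have h1 : Rational fun i => ι (B ◃ i) / ι (t ◃ i) :=
      Rational.div_ι (by fun_prop) (by fun_prop) ht
    have h2 : Rational fun i => ι (pow2 i) / ι (t ◃ i) :=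
      Rational.div_ι (by fun_prop) (by fun_prop) ht
    -- All remaining intervals contain `x`. The statement compares rational approximations of `x` at
    -- a fixed `n`, so that it is decidable and can be proved by induction on `m`.
    have inv : ∀ n m, ι (B ◃ m) / ι (t ◃ m) - ε n ≤ q x n ∧
        q x n ≤ ι (B ◃ m) / ι (t ◃ m) + ι (pow2 m) / ι (t ◃ m) + ε n := by
      intro n
      refine Dec.ind (P := fun m => ι (B ◃ m) / ι (t ◃ m) - ε n ≤ q x n ∧
        q x n ≤ ι (B ◃ m) / ι (t ◃ m) + ι (pow2 m) / ι (t ◃ m) + ε n) (by fun_prop) ?_ fun m hm => ?_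
      · rw [hB0, ht0, pow2_zero, map_zero, map_one]
        constructor <;> linarith [(hx.2 n).1, (hx.2 n).2]
      · rw [hs, hw]
        have e3 : ε (m + 3) = ε m / 8 := by
          rw [show m + 3 = m + 1 + 1 + 1 by ring, ε_succ, ε_succ, ε_succ]; ring
        have hle := hεw m
        have hq : q x n ≤ q x (m + 3) + ε n + ε m / 8 ∧ q x (m + 3) ≤ q x n + ε n + ε m / 8 := by
          rcases le_total n (m + 3) with h | h
          · have := hx.1.abs_le h
            constructor <;> linarith [this.1, this.2, ε_pos m]
          · have := hx.1.abs_le h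
            rw [e3] at this
            constructor <;> linarith [this.1, this.2, ε_pos n]
        rcases hb m with ⟨hc, h⟩ | ⟨hc, h⟩ <;> rw [h]
        · rw [map_one]; constructor <;> linarith [hm.1, hm.2, hq.1, hq.2]
        · rw [map_zero]; constructor <;> linarith [hm.1, hm.2, hq.1, hq.2]
    refine ⟨h, hhc, fun n => ?_, fun n => ?_⟩ <;>
    · have := inv n (2 * n)
      rw [hr, hPB]
      linarith [this.1, this.2, hwε n, hw0 (2 * n), ε_pos n]

/-! ### Discontinuous functionals -/

/-- `M` contains a functional that decides the existence of zeros. -/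
def HasE (M : Model) [Fact M.RCA] : Prop := ∃ E : M.C two, ∀ x, E ◃ x = 0 ↔ ∃ n, x ◃ n = 0

/-- The existential functional from a functional with a discontinuity along a sequence
(Grilliot's trick). -/
theorem hasE_of_sequence (Y : M.C two) (h : M.C one) (G : M.C (Ty.nat ⇾ one))
    (hG : ∀ n i, i < n → G ◃ n ◃ i = h ◃ i) (hY : ∀ n, Y ◃ (G ◃ n) ≠ Y ◃ h) : HasE M := by
  -- `J x i` equals `i` as long as no zero of `x` has been met, and from then on stays at the first
  -- zero.
  obtain ⟨J, hJ0, hJS⟩ := exists_rec' (M := M) 0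
    (ev nil (Tm.lam (Tm.lam (Tm.lam (Tm.cond (v2 ⬝ v1) v1 (.succ ⬝ v0))))) :
      M.C (one ⇾ Ty.nat ⇾ Ty.nat ⇾ Ty.nat))
  simp only [ev_lam, ev_cond, ev_app, ev_var, cons_zero, cons_succ, ev_succ, succ_eq] at hJS
  -- `X x` is `G n` if `n` is the first zero of `x`, and `h` if there is none. Before a zero is
  -- found it can safely copy `h`, because `G n` agrees with `h` below `n`. So comparing `Y (X x)`
  -- with `Y h` decides whether `x` has a zero.
  let X : M.C (one ⇾ one) := ev (J ◂ G ◂ h ◂ nil) (Tm.lam (Tm.lam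
    (Tm.cond (v1 ⬝ (v2 ⬝ v1 ⬝ v0)) (v3 ⬝ (v2 ⬝ v1 ⬝ v0) ⬝ v0) (v4 ⬝ v0))))
  have hX : ∀ x i, X ◃ x ◃ i = cnd (x ◃ (J ◃ x ◃ i)) (G ◃ (J ◃ x ◃ i) ◃ i) (h ◃ i) := fun x i => by
    simp [X]
  have hstay : ∀ x i k, x ◃ (J ◃ x ◃ i) = 0 → J ◃ x ◃ (i + k) = J ◃ x ◃ i := by
    intro x i k hi
    refine Dec.ind (P := fun k => J ◃ x ◃ (i + k) = J ◃ x ◃ i) (by fun_prop) (by simp) (fun k hk => ?_) k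
    rw [← add_assoc, hJS, hk, cnd_pos _ _ hi]
  have hJ : ∀ x i, x ◃ (J ◃ x ◃ i) = 0 ∨ J ◃ x ◃ i = i := by
    intro x
    refine Dec.ind (P := fun i => x ◃ (J ◃ x ◃ i) = 0 ∨ J ◃ x ◃ i = i) (by fun_prop) (.inr (hJ0 x))
      fun i hi => ?_
    by_cases h0 : x ◃ (J ◃ x ◃ i) = 0
    · left; rw [hstay x i 1 h0, h0]
    · right; rw [hJS, cnd_neg _ _ h0]
  obtain ⟨E, hE⟩ : Internal fun x => if Y ◃ (X ◃ x) = Y ◃ h then (1 : M.N) else 0 := by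
    classical exact Internal.ite (by fun_prop) (by fun_prop) (by fun_prop)
  refine ⟨E, fun x => ?_⟩
  rw [hE]
  beta_reduce
  by_cases hx : ∃ n, x ◃ n = 0
  · obtain ⟨n, hn⟩ := hx
    have hj : x ◃ (J ◃ x ◃ n) = 0 := by
      rcases hJ x n with h | h
      · exact h
      · rw [h, hn]
    have : X ◃ x = G ◃ (J ◃ x ◃ n) := by
      refine M.ext fun i => ?_
      rw [hX]
      by_cases h0 : x ◃ (J ◃ x ◃ i) = 0
      · rw [cnd_pos _ _ h0, ← hstay x i n h0, add_comm, hstay x n i hj]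
      · have hi := (hJ x i).resolve_left h0
        rw [cnd_neg _ _ h0]
        refine (hG _ _ ?_).symm
        have hin : i ≤ n := by
          by_contra hc
          obtain ⟨k, hk⟩ := (not_le.1 hc).le
          exact h0 (by rw [hk, hstay x n k hj, hj])
        obtain ⟨k, rfl⟩ := hin
        have hge : i ≤ J ◃ x ◃ (i + k) := by
          refine Dec.ind (P := fun k => i ≤ J ◃ x ◃ (i + k)) (by fun_prop) (by simp [hi]) (fun k hk => ?_) k
          rw [← add_assoc, hJS, cnd]
          split_ifs
          · exact hk
          · exact ⟨k + 1, by rw [add_assoc]⟩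
        refine lt_of_le_of_ne hge fun he => h0 ?_
        rw [hi, he, hj]
    rw [this, if_neg (hY _)]
    exact iff_of_true rfl ⟨n, hn⟩
  · have : X ◃ x = h := M.ext fun i => by rw [hX, cnd_neg _ _ fun h => hx ⟨_, h⟩]
    rw [this, if_pos rfl]
    exact iff_of_false one_ne_zero hx

/-- Without the existential functional, all functionals are continuous on Cantor space. -/
theorem continuous_of_not_hasE (hE : ¬ HasE M) (Y : M.C two) (h : M.C one) :
    ∃ n, ∀ g, Cantor g → (∀ i, i < n → h ◃ i = g ◃ i) → Y ◃ h = Y ◃ g := by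
  by_contra hc
  push Not at hc
  obtain ⟨e, he, hcode⟩ := exists_bits (M := M)
  -- `W n s` follows `h` below `n` and the bits of the number `s` from `n` on.
  let W : M.C (Ty.nat ⇾ Ty.nat ⇾ one) := ev (e ◂ h ◂ nil) (Tm.lam (Tm.lam (Tm.lam
    (Tm.cond (Tm.sub (.succ ⬝ v0) v2) (v4 ⬝ v0) (v3 ⬝ v1 ⬝ v0)))))
  have hW : ∀ n s i, W ◃ n ◃ s ◃ i = cnd (sub (i + 1) n) (h ◃ i) (e ◃ s ◃ i) := fun n s i => by simp [W]
  have hlt : ∀ {i n : M.N} (b c : M.N), i < n → cnd (sub (i + 1) n) b c = b := fun b c hi =>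
    cnd_sub_pos _ _ (add_one_le_iff.2 hi)
  have hge : ∀ {i n : M.N} (b c : M.N), n ≤ i → cnd (sub (i + 1) n) b c = c := fun b c hi =>
    cnd_sub_neg _ _ fun h => not_lt.2 hi (add_one_le_iff.1 h)
  -- A sequence witnessing the discontinuity would have to be chosen among functions, while
  -- `QF-AC^{1,0}` chooses numbers only. If sequences coded by numbers suffice as witnesses, the
  -- choice is possible; the input `n` is passed as `f 0`.
  by_cases hA : ∀ n, ∃ s, Y ◃ (W ◃ n ◃ s) ≠ Y ◃ h
  · obtain ⟨F, hF⟩ := exists_choice (M := M) (ev (Y ◂ W ◂ h ◂ nil) (Tm.lam (Tm.lam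
      (Tm.cond (Tm.add (Tm.sub (v2 ⬝ (v3 ⬝ (v1 ⬝ .zero) ⬝ v0)) (v2 ⬝ v4))
        (Tm.sub (v2 ⬝ v4) (v2 ⬝ (v3 ⬝ (v1 ⬝ .zero) ⬝ v0)))) tone .zero)))) (fun f => by
        obtain ⟨s, hs⟩ := hA (f ◃ 0)
        refine ⟨s, ?_⟩
        simp only [ev_lam, ev_cond, ev_add, ev_sub, ev_app, ev_var, cons_zero, cons_succ, ev_zero,
          zero_eq, ev_tone]
        refine cnd_neg _ _ fun h => hs ?_
        rwa [add_eq_zero, sub_eq_zero_iff_le, sub_eq_zero_iff_le, ← le_antisymm_iff] at h)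
    simp only [ev_lam, ev_cond, ev_add, ev_sub, ev_app, ev_var, cons_zero, cons_succ, ev_zero,
          zero_eq, ev_tone] at hF
    have hF' : ∀ f, Y ◃ (W ◃ (f ◃ 0) ◃ (F ◃ f)) ≠ Y ◃ h := fun f h => by
      have := hF f
      rw [h, cnd_pos _ _ (by simp [sub_eq_zero_iff_le])] at this
      exact one_ne_zero this
    refine hE (hasE_of_sequence Y h
      (ev (W ◂ F ◂ nil) (Tm.lam (v1 ⬝ v0 ⬝ (v2 ⬝ (Tm.K _ _ ⬝ v0))))) (fun n i hi => ?_) fun n => ?_)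
    · simp [hW, hlt _ _ hi]
    · have := hF' (M.K _ _ ◃ n)
      rw [M.K_eq] at this
      simpa using this
  -- Now `Y` takes the value `Y h` at every `W m s`, but not at some `g` that agrees with `h` below
  -- `m`. The truncations of `g` are of the form `W m s` and converge to `g`, so `Y` is
  -- discontinuous at `g` along an explicit sequence.
  · push Not at hA
    obtain ⟨m, hm⟩ := hA
    obtain ⟨g, hg, hhg, hne⟩ := hc m
    let G : M.C (Ty.nat ⇾ one) := ev (g ◂ m ◂ nil) (Tm.lam (Tm.lam
      (Tm.cond (Tm.sub (.succ ⬝ v0) (Tm.add v1 v3)) (v2 ⬝ v0) .zero)))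
    have hG : ∀ n i, G ◃ n ◃ i = cnd (sub (i + 1) (n + m)) (g ◃ i) 0 := fun n i => by simp [G]
    refine hE (hasE_of_sequence Y g G (fun n i hi => ?_) fun n => ?_)
    · rw [hG, hlt _ _ (hi.trans_le ⟨m, rfl⟩)]
    · obtain ⟨s, -, h1, h2⟩ := hcode g hg (n + m)
      have : G ◃ n = W ◃ m ◃ s := by
        refine M.ext fun i => ?_
        rw [hG, hW]
        rcases lt_or_ge i (n + m) with hi | hi
        · rw [hlt _ _ hi, h1 i hi]
          rcases lt_or_ge i m with hi' | hi'
          · rw [hlt _ _ hi', hhg i hi']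
          · rw [hge _ _ hi']
        · rw [hge _ _ hi, hge _ _ (le_trans ⟨n, add_comm _ _⟩ hi), h2 i hi]
      rw [this, hm]
      exact hne

/-- The points are the images of the binary sequences coded by numbers. The first `2 * (m + 4)` bits
determine the approximation at index `m + 4`, where the total error is `4 * ε (m + 4)`, a quarter of
the radius. -/
theorem exists_dense : ∃ D : M.C (Ty.nat ⇾ one), (∀ k, Unit (D ◃ k)) ∧
    ∀ u, Unit u → ∀ m, ∃ k, Near u (D ◃ k) m := by
  obtain ⟨e, he, hcode⟩ := exists_bits (M := M)
  obtain ⟨r, hr, hagree, hsurj⟩ := exists_parametrization (M := M)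
  refine ⟨ev (e ◂ r ◂ nil) (Tm.lam (v2 ⬝ (v1 ⬝ v0))), fun k => ?_, fun u hu m => ?_⟩
  · simpa using hr _ (he k)
  · obtain ⟨h, hh, hur⟩ := hsurj u hu
    obtain ⟨k, -, hk, -⟩ := hcode h hh (2 * (m + 4))
    refine ⟨k, near_of_approx (n := m + 4) ?_ ?_⟩ <;>
    · simp only [ev_lam, ev_app, ev_var, cons_zero, cons_succ]
      rw [hagree _ _ _ hk]
      have e4 : ε (m + 4) = ε m / 16 := by
        rw [show m + 4 = m + 1 + 1 + 1 + 1 by ring, ε_succ, ε_succ, ε_succ, ε_succ]; ring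
      linarith [hur.1 (m + 4), hur.2 (m + 4), ε_pos m]

/-! ### Extended reals and suprema -/

/-- The real number that is coded by an extended real. -/
def tail (s : M.C one) : M.C one := ev (s ◂ nil) (Tm.lam (v1 ⬝ (.succ ⬝ v0)))

def IsExt (s : M.C one) : Prop := (s ◃ 0 = 0 ∧ IsReal (tail s)) ∨ s ◃ 0 = 1 ∨ s ◃ 0 = 2

def ExtEq (s t : M.C one) : Prop := s ◃ 0 = t ◃ 0 ∧ (s ◃ 0 = 0 → REq (tail s) (tail t))

def LeExt (x s : M.C one) : Prop := (s ◃ 0 = 0 ∧ Le x (tail s) 0) ∨ s ◃ 0 = 1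

def LtExt (x s : M.C one) : Prop := (s ◃ 0 = 0 ∧ ¬ Le (tail s) x 0) ∨ s ◃ 0 = 1

def UnitFunEq (f g : M.C (one ⇾ one)) : Prop := ∀ x, Unit x → REq (f ◃ x) (g ◃ x)

def IsSup (f : M.C (one ⇾ one)) (s : M.C one) : Prop := IsExt s ∧ (∀ x, Unit x → LeExt (f ◃ x) s) ∧
  ∀ y, IsReal y → LtExt y s → ∃ x, Unit x ∧ ¬ Le (f ◃ x) y 0

/-- The functional `Ξ` assigns a supremum to all functions with the property `P`. -/
def IsSupFunctional (P : M.C (one ⇾ one) → Prop) (Ξ : M.C ((one ⇾ one) ⇾ one)) : Prop :=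
  (∀ f, UnitFun f → IsExt (Ξ ◃ f)) ∧
  (∀ f g, UnitFun f → UnitFun g → UnitFunEq f g → ExtEq (Ξ ◃ f) (Ξ ◃ g)) ∧
  ∀ f, UnitFun f → P f → IsSup f (Ξ ◃ f)

/-- Extended reals from tags and reals. -/
theorem exists_mkExt : ∃ c : M.C (Ty.nat ⇾ one ⇾ one), ∀ b z, c ◃ b ◃ z ◃ 0 = b ∧ tail (c ◃ b ◃ z) = z :=
  ⟨ev nil (Tm.lam (Tm.lam (Tm.lam (Tm.cond v0 v2 (v1 ⬝ Tm.pred v0))))), fun b z =>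
    ⟨by simp, M.ext fun i => by simp [tail, cnd_neg _ _ (add_one_ne_zero i), pred_succ]⟩⟩

/-- The diagonal of a sequence of sequences of rationals. -/
theorem exists_diagonal : ∃ a : M.C ((Ty.nat ⇾ one) ⇾ one), ∀ X n, q (a ◃ X) n = q (X ◃ n) n := by
  obtain ⟨d, m, h⟩ := exists_divMod3 (M := M)
  refine ⟨ev (d ◂ nil) (Tm.lam (Tm.lam (v1 ⬝ (v2 ⬝ v0) ⬝ v0))), fun X n => ?_⟩
  obtain ⟨⟨-, h1⟩, ⟨-, h2⟩, ⟨-, h3⟩⟩ := h n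
  simp [q, h1, h2, h3]

/-- Maxima of finitely many rationals. -/
theorem exists_argmax : ∃ A : M.C ((Ty.nat ⇾ one) ⇾ Ty.nat ⇾ one), ∀ F n N j, j ≤ N →
    q (F ◃ j) n ≤ q (F ◃ (A ◃ F ◃ n ◃ N)) n := by
  let g : M.C ((Ty.nat ⇾ one) ⇾ Ty.nat ⇾ Ty.nat ⇾ Ty.nat ⇾ Ty.nat) :=
    ev nil (Tm.lam (Tm.lam (Tm.lam (Tm.lam (Tm.cond (Rat'.leTm (approx (v3 ⬝ (.succ ⬝ v0)) v2)
      (approx (v3 ⬝ v1) v2)) v1 (.succ ⬝ v0))))))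
  have hg : ∀ F n a i, (q (F ◃ (i + 1)) n ≤ q (F ◃ a) n ∧ g ◃ F ◃ n ◃ a ◃ i = a) ∨
      (q (F ◃ a) n < q (F ◃ (i + 1)) n ∧ g ◃ F ◃ n ◃ a ◃ i = i + 1) := by
    intro F n a i
    have h1 := ev_leTm (i ◂ a ◂ n ◂ F ◂ nil) (d_approx_pos _ (v3 ⬝ (.succ ⬝ v0)) v2)
      (d_approx_pos _ (v3 ⬝ v1) v2)
    simp only [rv_approx, ev_app, ev_var, cons_zero, cons_succ, ev_succ, succ_eq] at h1
    rw [← not_le, ← h1]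
    simp only [g, ev_lam, ev_cond, ev_app, ev_var, cons_zero, cons_succ, ev_succ, succ_eq]
    by_cases hc : ev (i ◂ a ◂ n ◂ F ◂ nil) (Rat'.leTm (approx (v3 ⬝ (.succ ⬝ v0)) v2)
      (approx (v3 ⬝ v1) v2)) = 0
    · exact .inl ⟨hc, cnd_pos _ _ hc⟩
    · exact .inr ⟨hc, cnd_neg _ _ hc⟩
  -- The recursion returns an index where the maximum is attained, since a rational is not an object
  -- of type `0`.
  let A : M.C ((Ty.nat ⇾ one) ⇾ Ty.nat ⇾ one) :=
    ev (g ◂ nil) (Tm.lam (Tm.lam (Tm.lam (.R ⬝ v0 ⬝ .zero ⬝ (v3 ⬝ v2 ⬝ v1)))))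
  have hA : ∀ F n N, A ◃ F ◃ n ◃ (N + 1) = g ◃ F ◃ n ◃ (A ◃ F ◃ n ◃ N) ◃ N := fun F n N => by simp [A]
  have hA0 : ∀ F n, A ◃ F ◃ n ◃ 0 = 0 := fun F n => by simp [A]
  refine ⟨A, fun F n N j hj => ?_⟩
  obtain ⟨k, rfl⟩ := hj
  have h0 : q (F ◃ j) n ≤ q (F ◃ (A ◃ F ◃ n ◃ j)) n := by
    rcases eq_zero_or_succ j with rfl | ⟨j, rfl⟩
    · rw [hA0]
    · rw [hA]
      rcases hg F n (A ◃ F ◃ n ◃ j) j with ⟨h, e⟩ | ⟨h, e⟩ <;> rw [e]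
      exact h
  refine Dec.ind (P := fun k => q (F ◃ j) n ≤ q (F ◃ (A ◃ F ◃ n ◃ (j + k))) n) (by fun_prop)
    (by rw [add_zero]; exact h0) (fun k hk => ?_) k
  rw [← add_assoc, hA]
  rcases hg F n (A ◃ F ◃ n ◃ (j + k)) (j + k) with ⟨h, e⟩ | ⟨h, e⟩ <;> rw [e]
  · exact hk
  · exact hk.trans h.le

/-- If all functionals are uniformly continuous on Cantor space, with a modulus given by `Ω`, then
all functions have suprema. -/
theorem exists_sup_of_modulus (Ω : M.C (two ⇾ Ty.nat)) (hΩ : ∀ Y h g, Cantor h → Cantor g →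
    (∀ i, i < Ω ◃ Y → h ◃ i = g ◃ i) → Y ◃ h = Y ◃ g) : ∃ Ξ, IsSupFunctional (M := M) (fun _ => True) Ξ := by
  obtain ⟨e, he, hcode⟩ := exists_bits (M := M)
  obtain ⟨r, hr, -, hsurj⟩ := exists_parametrization (M := M)
  obtain ⟨c, hc⟩ := exists_mkExt (M := M)
  obtain ⟨a, ha⟩ := exists_diagonal (M := M)
  obtain ⟨A, hA⟩ := exists_argmax (M := M)
  -- Each entry of the code of `f (r h)` is a number depending on `h`, so `Ω` applies to it. It is
  -- the code that depends on finitely many bits; continuity of `f` as a function of reals is not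
  -- needed.
  let Y : M.C ((one ⇾ one) ⇾ Ty.nat ⇾ two) := ev (r ◂ nil) (Tm.lam (Tm.lam (Tm.lam (v2 ⬝ (v3 ⬝ v0) ⬝ v1))))
  have hY : ∀ f i h, Y ◃ f ◃ i ◃ h = f ◃ (r ◃ h) ◃ i := fun f i h => by simp [Y]
  let N : M.C ((one ⇾ one) ⇾ one) := ev (Y ◂ Ω ◂ nil) (Tm.lam (Tm.lam (Tm.add (Tm.add
    (v3 ⬝ (v2 ⬝ v1 ⬝ (Tm.mul tthree v0))) (v3 ⬝ (v2 ⬝ v1 ⬝ (.succ ⬝ (Tm.mul tthree v0)))))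
    (v3 ⬝ (v2 ⬝ v1 ⬝ (.succ ⬝ (.succ ⬝ (Tm.mul tthree v0))))))))
  have hN : ∀ f n, N ◃ f ◃ n = Ω ◃ (Y ◃ f ◃ (3 * n)) + Ω ◃ (Y ◃ f ◃ (3 * n + 1)) +
      Ω ◃ (Y ◃ f ◃ (3 * n + 1 + 1)) := fun f n => by simp [N]
  have hmod : ∀ f n h g, Cantor h → Cantor g → (∀ i, i < N ◃ f ◃ n → h ◃ i = g ◃ i) →
      q (f ◃ (r ◃ h)) n = q (f ◃ (r ◃ g)) n := by
    intro f n h g hh hg hhg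
    have key : ∀ i, Ω ◃ (Y ◃ f ◃ i) ≤ N ◃ f ◃ n → f ◃ (r ◃ h) ◃ i = f ◃ (r ◃ g) ◃ i := fun i hi => by
      rw [← hY, ← hY]
      exact hΩ _ _ _ hh hg fun j hj => hhg j (hj.trans_le hi)
    rw [q, q, key (3 * n), key (3 * n + 1), key (3 * n + 1 + 1)]
    · rw [hN]; exact le_add_self
    · rw [hN]; exact le_trans le_add_self le_self_add
    · rw [hN, add_assoc]; exact le_self_add
  let F : M.C ((one ⇾ one) ⇾ Ty.nat ⇾ one) := ev (e ◂ r ◂ nil) (Tm.lam (Tm.lam (v1 ⬝ (v3 ⬝ (v2 ⬝ v0)))))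
  have hF : ∀ f s, F ◃ f ◃ s = f ◃ (r ◃ (e ◃ s)) := fun f s => by simp [F]
  -- The `n`-th approximation of the supremum is the largest `n`-th approximation of `f` over the
  -- codes up to `2 ^ N`, where `N` is the common modulus of the three entries involved. It
  -- dominates the `n`-th approximation at every point of Cantor space.
  let z : M.C ((one ⇾ one) ⇾ one) := ev (a ◂ F ◂ A ◂ N ◂ nil) (Tm.lam (v1 ⬝ (Tm.lam
    (v3 ⬝ v1 ⬝ (v4 ⬝ (v3 ⬝ v1) ⬝ v0 ⬝ (Tm.pow2 (v5 ⬝ v1 ⬝ v0)))))))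
  have hz : ∀ f n, ∃ s, q (z ◃ f) n = q (f ◃ (r ◃ (e ◃ s))) n ∧
      ∀ h, Cantor h → q (f ◃ (r ◃ h)) n ≤ q (z ◃ f) n := by
    intro f n
    have e1 : q (z ◃ f) n = q (F ◃ f ◃ (A ◃ (F ◃ f) ◃ n ◃ (pow2 (N ◃ f ◃ n)))) n := by simp [z, ha]
    refine ⟨A ◃ (F ◃ f) ◃ n ◃ (pow2 (N ◃ f ◃ n)), by rw [e1, hF], fun h hh => ?_⟩
    obtain ⟨s, hs, hsh, -⟩ := hcode h hh (N ◃ f ◃ n)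
    rw [hmod f n h (e ◃ s) hh (he s) fun i hi => (hsh i hi).symm, e1, ← hF]
    exact hA _ _ _ _ hs.le
  have hreal : ∀ f, UnitFun f → IsReal (z ◃ f) := by
    intro f hf n i
    obtain ⟨s, hs, hsm⟩ := hz f n
    obtain ⟨s', hs', hsm'⟩ := hz f (n + i)
    have h1 := hf.1 _ (hr _ (he s)) n i
    have h2 := hf.1 _ (hr _ (he s')) n i
    constructor
    · linarith [hsm' _ (he s), h1.1]
    · linarith [hsm _ (he s'), h2.2]
  have hext : ∀ f, UnitFun f → IsExt (c ◃ 0 ◃ (z ◃ f)) := fun f hf =>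
    .inl ⟨(hc _ _).1, by rw [(hc _ _).2]; exact hreal f hf⟩
  have hle : ∀ f g, UnitFunEq f g → Le (z ◃ f) (z ◃ g) 0 := by
    intro f g hfg n
    obtain ⟨s, hs, -⟩ := hz f n
    obtain ⟨-, -, hsm⟩ := hz g n
    rw [hs]
    linarith [(hfg _ (hr _ (he s))).1 n, hsm _ (he s)]
  refine ⟨ev (c ◂ z ◂ nil) (Tm.lam (v1 ⬝ .zero ⬝ (v2 ⬝ v0))), ?_, ?_, ?_⟩ <;>
    simp only [ev_lam, ev_app, ev_var, cons_zero, cons_succ, ev_zero, zero_eq]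
  · exact hext
  · intro f g hf hg hfg
    refine ⟨by rw [(hc _ _).1, (hc _ _).1], fun _ => ?_⟩
    rw [(hc _ _).2, (hc _ _).2]
    exact ⟨hle f g hfg, hle g f fun x hx => (hfg x hx).symm⟩
  · refine fun f hf _ => ⟨hext f hf, fun x hx => .inl ⟨(hc _ _).1, ?_⟩, fun y hy hlt => ?_⟩
    · rw [(hc _ _).2]
      obtain ⟨h, hh, hxh⟩ := hsurj x hx
      have h1 := (hf.2 _ _ hx (hr h hh) hxh).1
      have h2 : Le (f ◃ (r ◃ h)) (z ◃ f) 0 := fun n => by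
        obtain ⟨-, -, hsm⟩ := hz f n
        linarith [hsm h hh, ε_pos n]
      simpa using h1.trans (hf.1 x hx) (hreal f hf) h2
    · rcases hlt with ⟨-, hlt⟩ | hlt
      · rw [(hc _ _).2] at hlt
        simp only [Le, not_forall, not_le] at hlt
        obtain ⟨n, hn⟩ := hlt
        obtain ⟨s, hs, -⟩ := hz f n
        exact ⟨_, hr _ (he s), fun h => by linarith [h n]⟩
      · rw [(hc _ _).1] at hlt
        exact (zero_ne_one hlt).elim

/-! ### Suprema from the existential functional -/

/-- Feferman's `μ`. Given the existential functional, "if `x` has a zero then `n` is one" is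
quantifier-free in `x` and `n`, and `QF-AC^{1,0}` selects `n`. -/
theorem HasE.exists_mu (hE : HasE M) : ∃ μ : M.C two, ∀ x, (∃ n, x ◃ n = 0) → x ◃ (μ ◃ x) = 0 := by
  obtain ⟨E, hE⟩ := hE
  obtain ⟨μ, hμ⟩ := exists_choice (M := M)
    (ev (E ◂ nil) (Tm.lam (Tm.lam (Tm.cond (v2 ⬝ v1) (v1 ⬝ v0) .zero)))) (fun x => by
      by_cases h : ∃ n, x ◃ n = 0
      · obtain ⟨n, hn⟩ := h
        exact ⟨n, by simp [(hE x).2 ⟨n, hn⟩, hn]⟩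
      · exact ⟨0, by simp [cnd_neg _ _ (mt (hE x).1 h)]⟩)
  refine ⟨μ, fun x hx => ?_⟩
  have := hμ x
  simpa [(hE x).2 hx] using this

theorem HasE.exists_forall (hE : HasE M) : ∃ A : M.C two, ∀ x, A ◃ x = 0 ↔ ∀ n, x ◃ n = 0 := by
  obtain ⟨E, hE⟩ := hE
  refine ⟨ev (E ◂ nil) (Tm.lam (Tm.cond (v1 ⬝ (Tm.lam (Tm.cond (v1 ⬝ v0) tone .zero))) tone .zero)),
    fun x => ?_⟩
  have := hE (ev (x ◂ E ◂ nil) (Tm.lam (Tm.cond (v1 ⬝ v0) tone .zero)))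
  simp only [ev_lam, ev_cond, ev_app, ev_var, cons_zero, cons_succ, ev_zero, zero_eq, ev_tone] at this ⊢
  have h2 : ∀ n, cnd (x ◃ n) 1 0 = 0 ↔ ¬ x ◃ n = 0 := fun n => by
    by_cases h : x ◃ n = 0
    · simp [h]
    · simp [h, cnd_neg _ _ h]
  simp only [h2] at this
  by_cases h : ∀ n, x ◃ n = 0
  · rw [cnd_neg _ _ fun h' => ?_]
    · exact iff_of_true rfl h
    · obtain ⟨n, hn⟩ := this.1 h'
      exact hn (h n)
  · rw [cnd_pos _ _ (this.2 (not_forall.1 h))]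
    exact iff_of_false one_ne_zero h

theorem HasE.exists_le (hE : HasE M) : ∃ L : M.C (Ty.nat ⇾ one ⇾ one ⇾ Ty.nat), ∀ k x y,
    L ◃ k ◃ x ◃ y = 0 ↔ Le x y (-ε k) := by
  obtain ⟨A, hA⟩ := hE.exists_forall
  refine ⟨ev (A ◂ nil) (Tm.lam (Tm.lam (Tm.lam (v3 ⬝ (Tm.lam (Rat'.leTm
    ((approx v2 v0).add (Rat'.dyadic tone v3)) ((approx v1 v0).add (Rat'.dyadic ttwo v0)))))))),
    fun k x y => ?_⟩
  simp only [ev_lam, ev_app, ev_var, cons_zero, cons_succ, hA]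
  refine forall_congr' fun n => ?_
  rw [ev_leTm _ (d_add_pos _ (d_approx_pos _ _ _) (d_dyadic_pos _ _ _))
      (d_add_pos _ (d_approx_pos _ _ _) (d_dyadic_pos _ _ _)),
    rv_add _ (d_approx_pos _ _ _) (d_dyadic_pos _ _ _),
    rv_add _ (d_approx_pos _ _ _) (d_dyadic_pos _ _ _)]
  simp only [rv_approx, rv_dyadic, ev_tone, ev_ttwo, ev_var, cons_zero, cons_succ, map_one, map_ofNat]
  constructor <;> intro h <;> linarith

/-- Equality of reals is decidable. -/
theorem HasE.exists_rEq (hE : HasE M) : ∃ L : M.C (one ⇾ one ⇾ Ty.nat), ∀ x y,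
    L ◃ x ◃ y = 0 ↔ REq x y := by
  obtain ⟨A, hA⟩ := hE.exists_forall
  refine ⟨ev (A ◂ nil) (Tm.lam (Tm.lam (v2 ⬝ (Tm.lam (Tm.add (Rat'.leTm
    (approx v2 v0) ((approx v1 v0).add (Rat'.dyadic ttwo v0))) (Rat'.leTm
    (approx v1 v0) ((approx v2 v0).add (Rat'.dyadic ttwo v0)))))))), fun x y => ?_⟩
  simp only [ev_lam, ev_app, ev_var, cons_zero, cons_succ, hA, ev_add, add_eq_zero, forall_and, REq]
  refine and_congr (forall_congr' fun n => ?_) (forall_congr' fun n => ?_) <;>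
  · rw [ev_leTm _ (d_approx_pos _ _ _) (d_add_pos _ (d_approx_pos _ _ _) (d_dyadic_pos _ _ _)),
      rv_add _ (d_approx_pos _ _ _) (d_dyadic_pos _ _ _)]
    simp only [rv_approx, rv_dyadic, ev_ttwo, ev_var, cons_zero, cons_succ, map_ofNat]
    constructor <;> intro h <;> linarith

/-- `s` is the supremum of a sequence of reals. -/
structure IsSupSeq (F : M.C (Ty.nat ⇾ one)) (s : M.C one) : Prop where
  ext : (s ◃ 0 = 0 ∧ IsReal (tail s)) ∨ s ◃ 0 = 1
  le : ∀ k, LeExt (F ◃ k) s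
  exists_lt : ∀ y, IsReal y → LtExt y s → ∃ k, ¬ Le (F ◃ k) y 0

/-- Almost maximal terms of bounded sequences of rationals. -/
theorem exists_almost_max (hE : HasE M) (F : M.C (Ty.nat ⇾ one)) (n B : M.N)
    (hB : ∀ k, q (F ◃ k) n ≤ ι B) : ∃ k, ∀ j, q (F ◃ j) n ≤ q (F ◃ k) n + ε n := by
  obtain ⟨μ, hμ⟩ := hE.exists_mu
  by_contra hc
  push Not at hc
  let t : M.C (Ty.nat ⇾ one) := ev (F ◂ n ◂ nil) (Tm.lam (Tm.lam (Tm.cond (Rat'.leTm (approx (v2 ⬝ v0) v3)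
    ((approx (v2 ⬝ v1) v3).add (Rat'.dyadic tone v3))) tone .zero)))
  have ht : ∀ k j, t ◃ k ◃ j = 0 ↔ q (F ◃ k) n + ε n < q (F ◃ j) n := by
    intro k j
    have h1 := ev_leTm (j ◂ k ◂ F ◂ n ◂ nil) (d_approx_pos _ (v2 ⬝ v0) v3)
      (d_add_pos _ (d_approx_pos _ (v2 ⬝ v1) v3) (d_dyadic_pos _ tone v3))
    rw [rv_add _ (d_approx_pos _ _ _) (d_dyadic_pos _ _ _)] at h1
    simp only [rv_approx, rv_dyadic, ev_tone, ev_app, ev_var, cons_zero, cons_succ, map_one, one_mul] at h1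
    rw [← not_le, ← h1]
    simp only [t, ev_lam, ev_cond, ev_tone, ev_zero, zero_eq]
    by_cases h : ev (j ◂ k ◂ F ◂ n ◂ nil) (Rat'.leTm (approx (v2 ⬝ v0) v3)
      ((approx (v2 ⬝ v1) v3).add (Rat'.dyadic tone v3))) = 0
    · simp [h]
    · simp [h, cnd_neg _ _ h]
  -- If no term were almost maximal, `μ` would find from each term one that is larger by more than
  -- `ε n`. Iterating gives a chain growing linearly, against the bound `B`.
  obtain ⟨κ, hκ0, hκ⟩ := exists_rec (M := M) 0 (ev (μ ◂ t ◂ nil) (Tm.lam (Tm.lam (v2 ⬝ (v3 ⬝ v1)))))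
  simp only [ev_lam, ev_app, ev_var, cons_zero, cons_succ] at hκ
  have hstep : ∀ i, q (F ◃ (κ ◃ i)) n + ε n < q (F ◃ (κ ◃ (i + 1))) n := by
    intro i
    rw [hκ, ← ht]
    obtain ⟨j, hj⟩ := hc (κ ◃ i)
    exact hμ _ ⟨j, (ht _ _).2 hj⟩
  have hgrow : ∀ i, q (F ◃ (κ ◃ 0)) n + ι i * ε n ≤ q (F ◃ (κ ◃ i)) n := by
    refine Dec.ind (by fun_prop) (by simp) fun i hi => ?_
    rw [map_add, map_one, add_mul, one_mul]
    linarith [hstep i]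
  obtain ⟨i, hi⟩ := exists_natCast_gt ((ι B - q (F ◃ (κ ◃ 0)) n) / ε n)
  rw [div_lt_iff₀ (ε_pos n)] at hi
  linarith [hgrow i, hB (κ ◃ i)]

/-- Boundedness of the sequence is arithmetical, so the tag of the supremum can be computed; the
approximations at index `0` suffice for it, as they are within `1` of the others. In the bounded
case `μ` picks almost maximal terms. -/
theorem HasE.exists_sup_seq (hE : HasE M) : ∃ σ : M.C ((Ty.nat ⇾ one) ⇾ one),
    ∀ F, (∀ k, IsReal (F ◃ k)) → IsSupSeq F (σ ◃ F) := by
  obtain ⟨c, hc⟩ := exists_mkExt (M := M)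
  obtain ⟨a, ha⟩ := exists_diagonal (M := M)
  obtain ⟨μ, hμ⟩ := hE.exists_mu
  obtain ⟨A, hA⟩ := hE.exists_forall
  let t : M.C ((Ty.nat ⇾ one) ⇾ Ty.nat ⇾ Ty.nat ⇾ one) := ev nil (Tm.lam (Tm.lam (Tm.lam (Tm.lam
    (Rat'.leTm (approx (v3 ⬝ v0) v2) ((approx (v3 ⬝ v1) v2).add (Rat'.dyadic tone v2)))))))
  have ht : ∀ F n k j, t ◃ F ◃ n ◃ k ◃ j = 0 ↔ q (F ◃ j) n ≤ q (F ◃ k) n + ε n := by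
    intro F n k j
    have h1 := ev_leTm (j ◂ k ◂ n ◂ F ◂ nil) (d_approx_pos _ (v3 ⬝ v0) v2)
      (d_add_pos _ (d_approx_pos _ (v3 ⬝ v1) v2) (d_dyadic_pos _ tone v2))
    rw [rv_add _ (d_approx_pos _ _ _) (d_dyadic_pos _ _ _)] at h1
    simpa only [rv_approx, rv_dyadic, ev_tone, ev_app, ev_var, cons_zero, cons_succ, map_one, one_mul,
      t, ev_lam] using h1
  let b : M.C ((Ty.nat ⇾ one) ⇾ Ty.nat ⇾ one) := ev nil (Tm.lam (Tm.lam (Tm.lam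
    (Rat'.leTm (approx (v2 ⬝ v0) .zero) ⟨v1, .zero, tone⟩))))
  have hb : ∀ F B k, b ◃ F ◃ B ◃ k = 0 ↔ q (F ◃ k) 0 ≤ ι B := by
    intro F B k
    have h1 := ev_leTm (k ◂ B ◂ F ◂ nil) (q := approx (v2 ⬝ v0) .zero) (r := ⟨v1, .zero, tone⟩)
      (d_approx_pos _ _ _) (by simp)
    rw [rv_approx] at h1
    simpa [b, rv] using h1
  let V : M.C ((Ty.nat ⇾ one) ⇾ Ty.nat ⇾ one) := ev (A ◂ t ◂ nil) (Tm.lam (Tm.lam (Tm.lam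
    (v3 ⬝ (v4 ⬝ v2 ⬝ v1 ⬝ v0)))))
  have hV : ∀ F n k, V ◃ F ◃ n ◃ k = 0 ↔ ∀ j, q (F ◃ j) n ≤ q (F ◃ k) n + ε n := fun F n k => by
    simp [V, hA, ht]
  let U : M.C ((Ty.nat ⇾ one) ⇾ one) := ev (A ◂ b ◂ nil) (Tm.lam (Tm.lam (v2 ⬝ (v3 ⬝ v1 ⬝ v0))))
  have hU : ∀ F B, U ◃ F ◃ B = 0 ↔ ∀ k, q (F ◃ k) 0 ≤ ι B := fun F B => by simp [U, hA, hb]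
  obtain ⟨E, hE'⟩ := id hE
  let T : M.C ((Ty.nat ⇾ one) ⇾ Ty.nat) := ev (E ◂ U ◂ nil) (Tm.lam (Tm.cond (v1 ⬝ (v2 ⬝ v0)) .zero tone))
  have hT : ∀ F, ((∃ B, ∀ k, q (F ◃ k) 0 ≤ ι B) ∧ T ◃ F = 0) ∨
      ((¬ ∃ B, ∀ k, q (F ◃ k) 0 ≤ ι B) ∧ T ◃ F = 1) := by
    intro F
    have h1 := hE' (U ◃ F)
    simp only [hU] at h1
    rw [← h1]
    by_cases h : E ◃ (U ◃ F) = 0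
    · exact .inl ⟨h, by simp [T, h]⟩
    · exact .inr ⟨h, by simp [T, cnd_neg _ _ h]⟩
  -- The `n`-th approximation uses precision `n + 1`: the error of an almost maximal term and that
  -- of its approximation then add up to at most `ε n`.
  let z : M.C ((Ty.nat ⇾ one) ⇾ one) := ev (a ◂ V ◂ μ ◂ nil) (Tm.lam (v1 ⬝ (Tm.lam (Tm.lam
    (v2 ⬝ (v5 ⬝ (v4 ⬝ v2 ⬝ (.succ ⬝ v1))) ⬝ (Tm.add v0 tthree))))))
  have hz : ∀ F n, q (z ◃ F) n = q (F ◃ (μ ◃ (V ◃ F ◃ (n + 1)))) (n + 1) := by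
    intro F n
    have e1 : 3 * (n + 1) = 3 * n + 3 := by ring
    have e2 : 3 * n + 1 + 3 = 3 * n + 3 + 1 := by ring
    have e3 : 3 * n + 1 + 1 + 3 = 3 * n + 3 + 1 + 1 := by ring
    simp only [z, ev_lam, ev_app, ev_var, cons_zero, cons_succ, ha]
    simp [q, e1, e2, e3]
  refine ⟨ev (c ◂ T ◂ z ◂ nil) (Tm.lam (v1 ⬝ (v2 ⬝ v0) ⬝ (v3 ⬝ v0))), fun F hF => ?_⟩
  simp only [ev_lam, ev_app, ev_var, cons_zero, cons_succ]
  have tag := (hc (T ◃ F) (z ◃ F)).1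
  have tl := (hc (T ◃ F) (z ◃ F)).2
  rcases hT F with ⟨⟨B, hB⟩, h⟩ | ⟨hn, h⟩ <;> replace tag := tag.trans h
  · have hk : ∀ n j, q (F ◃ j) (n + 1) ≤ q (z ◃ F) n + ε n / 2 := by
      intro n j
      rw [hz, ← ε_succ]
      obtain ⟨k, hk⟩ := exists_almost_max hE F (n + 1) (B + 1) fun k => by
        have := (hF k).abs_le (zero_le (a := n + 1))
        rw [ε_zero] at this
        rw [map_add, map_one]
        linarith [hB k, this.2]
      exact (hV _ _ _).1 (hμ (V ◃ F ◃ (n + 1)) ⟨k, (hV _ _ _).2 hk⟩) j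
    have hreal : IsReal (z ◃ F) := by
      intro n i
      have h1 := hk n (μ ◃ (V ◃ F ◃ (n + i + 1)))
      have h2 := hk (n + i) (μ ◃ (V ◃ F ◃ (n + 1)))
      have h3 := hF (μ ◃ (V ◃ F ◃ (n + 1))) (n + 1) i
      have h4 := hF (μ ◃ (V ◃ F ◃ (n + i + 1))) (n + 1) i
      rw [show n + 1 + i = n + i + 1 by ring, ε_succ] at h3 h4
      have h5 := ε_add_le n i
      rw [← hz] at h3 h4
      constructor <;> linarith [h3.1, h4.2]
    refine ⟨.inl ⟨tag, by rw [tl]; exact hreal⟩, fun k => .inl ⟨tag, ?_⟩, fun y hy hlt => ?_⟩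
    · rw [tl]
      intro n
      linarith [hk n k, (hF k n 1).1, ε_pos n]
    · rcases hlt with ⟨-, hlt⟩ | hlt
      · rw [tl] at hlt
        simp only [Le, not_forall, not_le] at hlt
        obtain ⟨n, hn⟩ := hlt
        refine ⟨μ ◃ (V ◃ F ◃ (n + 1)), fun h => ?_⟩
        have h1 := h (n + 1)
        rw [← hz, ε_succ] at h1
        linarith [(hy n 1).2]
      · rw [tag] at hlt
        exact (zero_ne_one hlt).elim
  · refine ⟨.inr tag, fun k => .inr tag, fun y hy _ => ?_⟩
    obtain ⟨B, hB⟩ := exists_natCast_gt (q y 0 + 2)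
    push Not at hn
    obtain ⟨k, hk⟩ := hn B
    refine ⟨k, fun h => ?_⟩
    have := h 0
    rw [ε_zero] at this
    linarith

/-- A supremum functional acts on codes, so its invariance under equality of reals has to come from
the uniqueness of suprema: a finite supremum of one sequence bounds the other. -/
theorem IsSupSeq.extEq {F G : M.C (Ty.nat ⇾ one)} {s t : M.C one} (hF : ∀ k, IsReal (F ◃ k))
    (hG : ∀ k, IsReal (G ◃ k)) (hFG : ∀ k, REq (F ◃ k) (G ◃ k)) (hs : IsSupSeq F s) (ht : IsSupSeq G t) :
    ExtEq s t := by
  have key : ∀ {F G : M.C (Ty.nat ⇾ one)} {s t : M.C one}, (∀ k, IsReal (F ◃ k)) →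
      (∀ k, REq (F ◃ k) (G ◃ k)) → IsSupSeq F s → IsSupSeq G t → t ◃ 0 = 0 →
      IsReal (tail t) → s ◃ 0 = 0 ∧ Le (tail s) (tail t) 0 := by
    intro F G s t hF hFG hs ht h0 hr
    have : ¬ LtExt (tail t) s := fun hlt => by
      obtain ⟨k, hk⟩ := hs.exists_lt _ hr hlt
      rcases ht.le k with ⟨-, h⟩ | h
      · exact hk (by simpa using (hFG k).1.trans (hF k) hr h)
      · rw [h0] at h
        exact zero_ne_one h
    simp only [LtExt, not_or, not_and, not_not] at this
    rcases hs.ext with ⟨h, -⟩ | h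
    · exact ⟨h, this.1 h⟩
    · exact (this.2 h).elim
  have hGF : ∀ k, REq (G ◃ k) (F ◃ k) := fun k => (hFG k).symm
  rcases hs.ext with ⟨h0, hr⟩ | h1
  · have h2 := key hG hGF ht hs h0 hr
    rcases ht.ext with ⟨h0', hr'⟩ | h1'
    · exact ⟨h0.trans h0'.symm, fun _ => ⟨(key hF hFG hs ht h0' hr').2, h2.2⟩⟩
    · rw [h2.1] at h1'; exact (zero_ne_one h1').elim
  · rcases ht.ext with ⟨h0', hr'⟩ | h1'
    · rw [(key hF hFG hs ht h0' hr').1] at h1; exact (zero_ne_one h1).elim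
    · exact ⟨h1.trans h1'.symm, fun h => (zero_ne_one (h.symm.trans h1)).elim⟩

/-- The existential functional yields suprema of functions that are determined by a sequence of
points. -/
theorem HasE.exists_sup (hE : HasE M) (D : M.C (Ty.nat ⇾ one)) (hD : ∀ k, Unit (D ◃ k)) :
    ∃ Ξ, IsSupFunctional (fun f => ∀ x, Unit x → ∀ j, ∃ k, Near (f ◃ x) (f ◃ (D ◃ k)) j) Ξ := by
  obtain ⟨σ, hσ⟩ := hE.exists_sup_seq
  let F : M.C ((one ⇾ one) ⇾ Ty.nat ⇾ one) := ev (D ◂ nil) (Tm.lam (Tm.lam (v1 ⬝ (v2 ⬝ v0))))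
  have hF : ∀ f k, F ◃ f ◃ k = f ◃ (D ◃ k) := fun f k => by simp [F]
  have hr : ∀ f, UnitFun f → ∀ k, IsReal (F ◃ f ◃ k) := fun f hf k => by rw [hF]; exact hf.1 _ (hD k)
  have hext : ∀ f, UnitFun f → IsExt (σ ◃ (F ◃ f)) := fun f hf =>
    (hσ _ (hr f hf)).ext.imp_right .inl
  refine ⟨ev (σ ◂ F ◂ nil) (Tm.lam (v1 ⬝ (v2 ⬝ v0))), ?_, ?_, ?_⟩ <;>
    simp only [ev_lam, ev_app, ev_var, cons_zero, cons_succ]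
  · exact hext
  · exact fun f g hf hg hfg => (hσ _ (hr f hf)).extEq (hr f hf) (hr g hg)
      (fun k => by rw [hF, hF]; exact hfg _ (hD k)) (hσ _ (hr g hg))
  · intro f hf hdense
    have hs := hσ _ (hr f hf)
    refine ⟨hext f hf, fun x hx => ?_, fun y hy hlt => ?_⟩
    · rcases hs.ext with ⟨h0, hreal⟩ | h1
      · refine .inl ⟨h0, fun n => le_of_forall_ε 1 one_pos fun j => ?_⟩
        obtain ⟨k, hk⟩ := hdense x hx j
        obtain ⟨d, hd, h1, -⟩ := (near_iff (hf.1 x hx) (hf.1 _ (hD k))).1 hk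
        rcases hs.le k with ⟨-, h⟩ | h
        · rw [hF] at h
          linarith [h1.trans (hf.1 x hx) hreal h n]
        · rw [h0] at h; exact (zero_ne_one h).elim
      · exact .inr h1
    · obtain ⟨k, hk⟩ := hs.exists_lt y hy hlt
      rw [hF] at hk
      exact ⟨_, hD k, hk⟩

/-! ### Weak continuity in a model -/

/-- Interior in the unit interval. -/
def Int (A : M.C one → Prop) (x : M.C one) : Prop := ∃ m, ∀ z, Unit z → Near x z m → A z

/-- Closure in the unit interval. -/
def Cl (A : M.C one → Prop) (x : M.C one) : Prop := ∀ m, ∃ z, Unit z ∧ Near x z m ∧ A z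

/-- Inclusion of subsets of the unit interval. -/
def Subset (A B : M.C one → Prop) : Prop := ∀ x, Unit x → A x → B x

def IsSet (F : M.C two) : Prop := (∀ x, IsReal x → F ◃ x = 0 ∨ F ◃ x = 1) ∧
  ∀ x y, IsReal x → IsReal y → REq x y → F ◃ x = F ◃ y

def IsOpenReal (G : M.C two) : Prop := IsSet G ∧ ∀ x, IsReal x → G ◃ x = 1 →
  ∃ m, ∀ y, IsReal y → Near x y m → G ◃ y = 1

section

variable {Γ : List Ty} (e : M.Env Γ)

omit hM in
theorem sat_weaken {σ : Ty} (A : VSet Γ) (a : M.C σ) (x : M.C one) :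
    Sat (x ◂ a ◂ e) A.weaken ↔ Sat (x ◂ e) A := by
  rw [VSet.weaken, sat_subst, cons_lift]; rfl

@[simp] theorem sat_interior (A : VSet Γ) (x : M.C one) :
    Sat (x ◂ e) A.interior ↔ Int (fun z => Sat (z ◂ e) A) x := by
  simp [VSet.interior, sat_weaken, Int]

@[simp] theorem sat_closure (A : VSet Γ) (x : M.C one) :
    Sat (x ◂ e) A.closure ↔ Cl (fun z => Sat (z ◂ e) A) x := by
  simp [VSet.closure, sat_weaken, Cl]

@[simp] theorem sat_subset (A B : VSet Γ) :
    Sat e (A.subset B) ↔ Subset (fun z => Sat (z ◂ e) A) fun z => Sat (z ◂ e) B := by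
  simp [VSet.subset, Subset]

@[simp] theorem sat_isSet (F : Tm Γ two) : Sat e (isSet F) ↔ IsSet (ev e F) := by
  simp [isSet, IsSet]

@[simp] theorem sat_isOpenReal (F : Tm Γ two) : Sat e (isOpenReal F) ↔ IsOpenReal (ev e F) := by
  simp [isOpenReal, IsOpenReal]

omit hM in
@[simp] theorem sat_ofChar (F : Tm Γ two) (x : M.C one) :
    Sat (x ◂ e) (VSet.ofChar F) ↔ ev e F ◃ x = 1 := by
  simp [VSet.ofChar]

omit hM in
@[simp] theorem sat_preimage (f : Tm Γ (one ⇾ one)) (G : Tm Γ two) (x : M.C one) :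
    Sat (x ◂ e) (VSet.preimage f G) ↔ ev e G ◃ (ev e f ◃ x) = 1 := by
  simp [VSet.preimage]

end

/-- The sets `O ∩ C` with `O` open and `C` semi-open meet every dense set. -/
theorem exists_mem_of_semiOpen {D : M.C (Ty.nat ⇾ one)} (hD : ∀ u, Unit u → ∀ m, ∃ k, Near u (D ◃ k) m)
    (hDu : ∀ k, Unit (D ◃ k)) {A O C : M.C one → Prop} (hA : ∀ z, Unit z → O z → C z → A z)
    (hO : Subset O (Int O)) (hC : Subset C (Cl (Int C))) {x : M.C one} (hx : Unit x) (hxO : O x)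
    (hxC : C x) : ∃ k, A (D ◃ k) := by
  obtain ⟨m, hm⟩ := hO x hx hxO
  obtain ⟨z, hz, hxz, m₁, h₁⟩ := hC x hx hxC m
  obtain ⟨m₂, h₂⟩ := hO z hz (hm z hz hxz)
  obtain ⟨k, hk⟩ := hD z hz (max m₁ m₂)
  exact ⟨k, hA _ (hDu k) (h₂ _ (hDu k) (hk.mono (le_max_right _ _)))
    (h₁ _ (hDu k) (hk.mono (le_max_left _ _)))⟩

/-- Balls in the reals are sets. -/
theorem HasE.exists_ball (hE : HasE M) {y : M.C one} (hy : IsReal y) (j : M.N) : ∃ G : M.C two,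
    IsOpenReal G ∧ ∀ z, G ◃ z = 1 ↔ Near y z j := by
  -- Distances can be compared only with the help of the existential functional, so it is needed for
  -- the ball to have a characteristic function in the model.
  obtain ⟨L, hL⟩ := hE.exists_le
  let G : M.C two := ev (L ◂ j ◂ y ◂ nil) (Tm.lam (Tm.cond (v1 ⬝ v2 ⬝ v3 ⬝ v0) .zero
    (Tm.cond (v1 ⬝ v2 ⬝ v0 ⬝ v3) .zero tone)))
  have hG : ∀ z, (Near y z j ∧ G ◃ z = 1) ∨ (¬ Near y z j ∧ G ◃ z = 0) := by
    intro z
    simp only [Near, ← hL]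
    by_cases h1 : L ◃ j ◃ y ◃ z = 0
    · exact .inr ⟨by simp [h1], by simp [G, h1]⟩
    · by_cases h2 : L ◃ j ◃ z ◃ y = 0
      · exact .inr ⟨by simp [h2], by simp [G, h2, cnd_neg _ _ h1]⟩
      · exact .inl ⟨⟨h1, h2⟩, by simp [G, cnd_neg _ _ h1, cnd_neg _ _ h2]⟩
  have hG1 : ∀ z, G ◃ z = 1 ↔ Near y z j := fun z => by
    rcases hG z with ⟨h, e⟩ | ⟨h, e⟩ <;> simp [h, e]
  refine ⟨G, ⟨⟨fun z _ => ?_, fun z w hz hw hzw => ?_⟩, fun z hz hGz => ?_⟩, hG1⟩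
  · rcases hG z with ⟨h, e⟩ | ⟨h, e⟩
    · exact .inr e
    · exact .inl e
  · rcases hG z with ⟨h, e⟩ | ⟨h, e⟩ <;> rcases hG w with ⟨h', e'⟩ | ⟨h', e'⟩ <;> rw [e, e']
    · exact (h' (h.congr_right hy hz hw hzw)).elim
    · exact (h (h'.congr_right hy hw hz hzw.symm)).elim
  · obtain ⟨m, hm⟩ := ((hG1 z).1 hGz).exists_ball hy hz
    exact ⟨m, fun w hw h => (hG1 w).2 (hm w hw h)⟩

/-- Complements of points are open sets. -/
theorem HasE.exists_compl_singleton (hE : HasE M) {y : M.C one} (hy : IsReal y) : ∃ G : M.C two,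
    IsOpenReal G ∧ ∀ z, G ◃ z = 1 ↔ ¬ REq y z := by
  obtain ⟨L, hL⟩ := hE.exists_rEq
  let G : M.C two := ev (L ◂ y ◂ nil) (Tm.lam (Tm.cond (v1 ⬝ v2 ⬝ v0) .zero tone))
  have hG : ∀ z, (¬ REq y z ∧ G ◃ z = 1) ∨ (REq y z ∧ G ◃ z = 0) := by
    intro z
    rw [← hL]
    by_cases h1 : L ◃ y ◃ z = 0
    · exact .inr ⟨h1, by simp [G, h1]⟩
    · exact .inl ⟨h1, by simp [G, cnd_neg _ _ h1]⟩
  have hG1 : ∀ z, G ◃ z = 1 ↔ ¬ REq y z := fun z => by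
    rcases hG z with ⟨h, e⟩ | ⟨h, e⟩ <;> simp [h, e]
  refine ⟨G, ⟨⟨fun z _ => ?_, fun z w hz hw hzw => ?_⟩, fun z hz hGz => ?_⟩, hG1⟩
  · rcases hG z with ⟨h, e⟩ | ⟨h, e⟩
    · exact .inr e
    · exact .inl e
  · rcases hG z with ⟨h, e⟩ | ⟨h, e⟩ <;> rcases hG w with ⟨h', e'⟩ | ⟨h', e'⟩ <;> rw [e, e']
    · exact (h (h'.trans hy hz hzw.symm)).elim
    · exact (h' (h.trans hy hw hzw)).elim
  · obtain ⟨m, hm⟩ := exists_not_near hy hz ((hG1 z).1 hGz)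
    exact ⟨m, fun w hw h => (hG1 w).2 fun h' => hm (h.congr_right hz hw hy h'.symm).symm⟩

/-- Every non-empty open interval of the unit interval meets every dense set. -/
theorem exists_mem_Ioo {D : M.C (Ty.nat ⇾ one)} (hDu : ∀ k, Unit (D ◃ k))
    (hD : ∀ u, Unit u → ∀ m, ∃ k, Near u (D ◃ k) m) {a b : M.C one} (ha : IsReal a) (hb : IsReal b)
    (hab : ¬ Le b a 0) (hu : ∀ y, IsReal y → ¬ Le y a 0 → ¬ Le b y 0 → Unit y) :
    ∃ k, ¬ Le (D ◃ k) a 0 ∧ ¬ Le b (D ◃ k) 0 := by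
  simp only [Le, not_forall, not_le] at hab
  obtain ⟨n, hn⟩ := hab
  -- At index `n` the approximations of `a` and `b` are more than `2 * ε n` apart, so their midpoint
  -- keeps the positive margin `(q b n - q a n) / 2 - ε n` from both reals.
  obtain ⟨y, hy⟩ := exists_const_real (M := M) ((q a n + q b n) / 2)
  have hyr : IsReal y := fun n i => by
    rw [hy, hy]; constructor <;> linarith [ε_pos n]
  have h1 : Le a y (-((q b n - q a n) / 2 - ε n)) := le_of_eventually ha hyr n fun m hm => by
    rw [hy]; linarith [(ha.abs_le hm).2]
  have h2 : Le y b (-((q b n - q a n) / 2 - ε n)) := le_of_eventually hyr hb n fun m hm => by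
    rw [hy]; linarith [(hb.abs_le hm).1]
  have lt : ∀ {u v : M.C one} {d : M.Q}, Le u v d → d < 0 → ¬ Le v u 0 := fun h hd => by
    simpa using not_le_of_le hd h
  have hyu : Unit y := hu y hyr (lt h1 (by linarith)) (lt h2 (by linarith))
  obtain ⟨m, hm⟩ := exists_ε_lt (δ := (q b n - q a n) / 2 - ε n) (by linarith)
  obtain ⟨k, hk⟩ := hD y hyu m
  obtain ⟨d, hd, h3, h4⟩ := (near_iff hyr (hDu k).1).1 hk
  exact ⟨k, lt (h1.trans ha (hDu k).1 h3) (by linarith), lt (h4.trans (hDu k).1 hb h2) (by linarith)⟩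

/-- The values of functions with one of the weak continuity properties are approximated by the
values at the points of a dense sequence. -/
theorem HasE.exists_near_of_tame (hE : HasE M) {D : M.C (Ty.nat ⇾ one)} (hDu : ∀ k, Unit (D ◃ k))
    (hD : ∀ u, Unit u → ∀ m, ∃ k, Near u (D ◃ k) m) {f : M.C (one ⇾ one)} (hf : UnitFun f)
    {Γ : List Ty} {e : M.Env Γ} (ht : Sat (f ◂ e) (tame v0)) {x : M.C one} (hx : Unit x) (j : M.N) :
    ∃ k, Near (f ◃ x) (f ◃ (D ◃ k)) j := by
  obtain ⟨G, hGo, hG⟩ := hE.exists_ball (hf.1 x hx) j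
  have hxG : G ◃ (f ◃ x) = 1 := (hG _).2 (near_self _ _)
  have semi : Subset (fun z => G ◃ (f ◃ z) = 1) (Cl (Int fun z => G ◃ (f ◃ z) = 1)) →
      ∃ k, Near (f ◃ x) (f ◃ (D ◃ k)) j := fun h =>
    exists_mem_of_semiOpen (A := fun z => Near (f ◃ x) (f ◃ z) j) (O := fun _ => True) hD hDu
      (fun z _ _ h => (hG _).1 h) (fun z _ _ => ⟨0, fun _ _ _ => trivial⟩) h hx trivial hxG
  have inter : ∀ O C : M.C two, Subset (fun z => O ◃ z = 1) (Int fun z => O ◃ z = 1) →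
      Subset (fun z => C ◃ z = 1) (Cl (Int fun z => C ◃ z = 1)) →
      Subset (fun z => G ◃ (f ◃ z) = 1) (fun z => O ◃ z = 1 ∧ C ◃ z = 1) →
      Subset (fun z => O ◃ z = 1 ∧ C ◃ z = 1) (fun z => G ◃ (f ◃ z) = 1) →
      ∃ k, Near (f ◃ x) (f ◃ (D ◃ k)) j := fun O C hO hC h h' =>
    exists_mem_of_semiOpen (A := fun z => Near (f ◃ x) (f ◃ z) j) hD hDu
      (fun z hz h1 h2 => (hG _).1 (h' z hz ⟨h1, h2⟩)) hO hC hx (h x hx hxG).1 (h x hx hxG).2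
  simp only [tame, sat_or] at ht
  rcases ht with h | h | h | h | h | h | h
  · simp only [alphaCont, VSet.alphaSet, sat_all, sat_imp, sat_isOpenReal, sat_subset, sat_preimage,
      sat_interior, sat_closure, ev_var, ev_wk, cons_zero] at h
    -- An `α`-set is semi-open, because a set contains its interior.
    refine semi fun z hz hGz => ?_
    obtain ⟨m, hm⟩ := h G hGo z hz hGz
    exact hm z hz (near_self _ _)
  · simp only [sCont, VSet.semiOpen, sat_all, sat_imp, sat_isOpenReal, sat_subset, sat_preimage,
      sat_interior, sat_closure, ev_var, ev_wk, cons_zero] at h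
    exact semi (h G hGo)
  · simp only [aCont, VSet.aSet, VSet.isOpen, VSet.regularClosed, VSet.seteq, VSet.inter, sat_all, sat_imp,
      sat_ex, sat_and, sat_isSet, sat_ofChar, sat_weaken, sat_isOpenReal, sat_subset, sat_preimage,
      sat_interior, sat_closure, ev_var, ev_wk, cons_zero, cons_succ] at h
    -- Only one inclusion of regular closedness enters, namely that `C` is semi-open.
    obtain ⟨O, C, -, -, hO, ⟨hC, -⟩, h1, h2⟩ := h G hGo
    exact inter O C hO hC h1 h2
  · simp only [abCont, VSet.abSet, VSet.isOpen, VSet.semiOpen, VSet.semiClosed, VSet.seteq, VSet.inter,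
      sat_all, sat_imp, sat_ex, sat_and, sat_isSet, sat_ofChar, sat_weaken, sat_isOpenReal, sat_subset,
      sat_preimage, sat_interior, sat_closure, ev_var, ev_wk, cons_zero, cons_succ] at h
    obtain ⟨O, C, -, -, hO, -, hC, h1, h2⟩ := h G hGo
    exact inter O C hO hC h1 h2
  · simp only [quasiCont, VSet.isOpen, sat_all, sat_imp, sat_ex, sat_and, sat_isSet, sat_ofChar, sat_unit,
      sat_isReal, sat_realLt, sat_near, sat_eq, ev_app, sat_subset, sat_interior, ev_var, ev_wk, ev_tone,
      cons_zero, cons_succ] at h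
    -- Quasi-continuity is applied with the whole interval as neighbourhood: nearness of the values
    -- matters, and nearness of the points does not.
    have hU : ∀ z, M.K Ty.nat one ◃ 1 ◃ z = 1 := fun z => M.K_eq _ _
    obtain ⟨a, b, ha, hb, hab, hab'⟩ := h x j (M.K Ty.nat one ◃ 1) hx
      ⟨fun z _ => .inr (hU z), fun z w _ _ _ => by rw [hU, hU]⟩
      (fun z _ _ => ⟨0, fun w _ _ => hU w⟩) (hU x)
    obtain ⟨k, h1, h2⟩ := exists_mem_Ioo hDu hD ha hb hab fun y hy h1 h2 => (hab' y hy h1 h2).1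
    exact ⟨k, (hab' _ (hDu k).1 h1 h2).2.2⟩
  · simp only [contraCont, VSet.isClosed, VSet.isOpen, VSet.compl, sat_all, sat_imp, sat_neg, sat_isOpenReal,
      sat_subset, sat_preimage, sat_interior, ev_var, ev_wk, cons_zero] at h
    -- The preimage of the complement of the point `f x` is closed and omits `x`. So `f` is constant
    -- near `x`, and any nearby point of the sequence has the same value.
    obtain ⟨G', hGo', hG'⟩ := hE.exists_compl_singleton (hf.1 x hx)
    obtain ⟨m, hm⟩ := h G' hGo' x hx fun h => (hG' _).1 h REq.refl
    obtain ⟨k, hk⟩ := hD x hx m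
    have hreq : REq (f ◃ x) (f ◃ (D ◃ k)) := by
      by_contra hc
      exact hm _ (hDu k) hk ((hG' _).2 hc)
    have hx' := hf.1 x hx
    exact ⟨k, (near_self (f ◃ x) j).congr_right hx' hx' (hf.1 _ (hDu k)) hreq⟩
  · simp only [srCont, VSet.semiOpen, VSet.semiClosed, sat_all, sat_imp, sat_and, sat_isOpenReal, sat_subset,
      sat_preimage, sat_interior, sat_closure, ev_var, ev_wk, cons_zero] at h
    exact semi (h G hGo).1

/-! ### The fan functional and the supremum functional in a model -/

theorem sat_FF : Sat (M := M) nil FF ↔ ∃ Ω : M.C (two ⇾ Ty.nat), ∀ Y, (∀ h, Cantor h → ∃ n, ∀ g, Cantor g →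
    (∀ i, i < n → h ◃ i = g ◃ i) → Y ◃ h = Y ◃ g) → ∀ h g, Cantor h → Cantor g →
    (∀ i, i < Ω ◃ Y → h ◃ i = g ◃ i) → Y ◃ h = Y ◃ g := by
  simp [FF, contCantor, cantor, agree, Cantor]

omit hM in
theorem ev_extReal {Γ : List Ty} (e : M.Env Γ) (s : Tm Γ one) : ev e (extReal s) = tail (ev e s) :=
  M.ext fun i => by simp [extReal, tail]

theorem IsSupFunctional.sat {P : M.C (one ⇾ one) → Prop} {Ξ : M.C ((one ⇾ one) ⇾ one)}
    (h : IsSupFunctional P Ξ)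
    (hP : ∀ f, UnitFun f → Sat (f ◂ Ξ ◂ nil) (tame v0) → P f) : Sat (M := M) nil SupremumFunctional := by
  obtain ⟨h1, h2, h3⟩ := h
  simp only [SupremumFunctional, sat_ex, sat_and, sat_all, sat_imp, sat_unitFun]
  refine ⟨Ξ, fun f hf => ?_, fun f g hf hg hfg => ?_, fun f hf ht => ?_⟩
  · simpa [isExt, extTag, ev_extReal, one_add_one_eq_two, IsExt] using h1 f hf
  · have := h2 f g hf hg (by simpa [unitFunEq, UnitFunEq] using hfg)
    simpa [extEq, extTag, ev_extReal, ExtEq] using this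
  · have := h3 f hf (hP f hf ht)
    simpa [isSup, isExt, leExt, ltExt, extTag, ev_extReal, IsSup, IsExt, LeExt, LtExt] using this

/-- The case distinction takes place outside the model, and the two cases use different functionals.
The fan functional is used only when the existential functional is absent; then its continuity
hypothesis holds for all `Y`. -/
theorem exists_supFunctional (h : Sat (M := M) nil FF) : Sat (M := M) nil SupremumFunctional := by
  obtain ⟨Ω, hΩ⟩ := sat_FF.1 h
  by_cases hE : HasE M
  · obtain ⟨D, hDu, hD⟩ := exists_dense (M := M)
    obtain ⟨Ξ, hΞ⟩ := hE.exists_sup D hDu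
    exact hΞ.sat fun f hf ht x hx j => hE.exists_near_of_tame hDu hD hf ht hx j
  · obtain ⟨Ξ, hΞ⟩ := exists_sup_of_modulus Ω fun Y h g hh hg =>
      hΩ Y (fun h _ => continuous_of_not_hasE hE Y h) h g hh hg
    exact hΞ.sat fun _ _ _ => trivial

end Model

end HORM

/-- `RCA₀^ω + FF` proves the existence of a supremum functional for the functions `[0,1] → ℝ` that are
`α`-, `s`-, `𝒜`-, `𝒜ℬ`-, quasi-, contra- or SR-continuous. -/
theorem corollary2p8 : HORM.Derives HORM.RCAω [HORM.FF] HORM.SupremumFunctional :=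
  HORM.completeness fun M hM h => by
    have : Fact M.RCA := ⟨hM⟩
    exact HORM.Model.exists_supFunctional h
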